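/- Let $\mathbb R^{2,1}$ be Minkowski space with form $\langle x,y\rangle=-x_0y_0+x_1y_1+x_2y_2$, let $\mathbb H^2=\{x:\langle x,x\rangle=-1,\ x_0>0\}$, and let $I^-(p)$ be the chronological past of $p$. A domain of dependence is a non-empty open set $D\subset\mathbb R^{2,1}$ that is an intersection of futures of lightlike planes and whose complement contains two non-parallel lightlike planes. For $p\in D$ let $\tau(p)=\sup\{|p-q| : q\in D\cap I^-(p)\}$ be the cosmological time, where $|w|=\sqrt{-\langle w,w\rangle}$, and let $\mathbf r(p)$ be the unique point of $\partial D\cap I^-(p)$ with $\tau(p)=|p-\mathbf r(p)|$. **The lamination and its dual tree.** The initial singularity $T=\mathbf r(D)$ is the dual tree of the lamination of $D$. It is called simplicial if it is an embedded simplicial tree whose edges are spacelike segments meeting only in common vertices (vertices of valence two are allowed). For $r\in\partial D$ let $\mathcal F_r$ be the set of $x\in\mathbb H^2$ such that $r+x$ lies in the convex hull of the lightlike half-lines in $\partial D$ that start at $r$; $r$ is a vertex if there are at least three such half-lines. The leaves of the lamination $\tilde\lambda(D)$ dual to $T$ are the geodesics $\mathcal F_r$, for $r\in T$ not a vertex,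 and the complete geodesics contained in the boundary of $\mathcal F_r$ in $\mathbb H^2$, for $r$ a vertex. A leaf $l$ is seen by an observer $(p,v)$, where $p\in D$ and $v\in\mathbb H^2$, if for some $x\in l$ the intersection of $\overline D$ with the support plane of $D$ orthogonal to $x$ meets $I^-(p)$. Let $\tilde\lambda_{(p,v)}(D)$ be the set of leaves of $\tilde\lambda(D)$ seen by $(p,v)$. **The intensity function.** Let $T^1_v\mathbb H^2=\{u:\langle u,v\rangle=0,\ \langle u,u\rangle=1\}$. For $u\in T^1_v\mathbb H^2$ let $q_0(u)$ be the point where the light ray $p+t(u-v)$, $t\ge 0$, meets $\partial D$, and let $x=q_0(u)+\langle q_0(u),v\rangle v$ be its orthogonal projection to $v^\perp$. The (rescaled) intensity function of the observer is $$\rho^D_{p,v}(u)=\lim_{\epsilon\to0^+}-\epsilon\,\langle\nu_\epsilon(q_\epsilon),v\rangle,$$ where $q_\epsilon$ is the point at which the line $x+\mathbb Rv$ meets the level surface $H_\epsilon=\tau^{-1}(\epsilon)$ and $\nu_\epsilon$ is the future-directed unit normal of $H_\epsilon$. **Proposition.** The intensity function determines the sublamination of leaves seen by the observer: let $D_1,D_2$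 be domains of dependence in $\mathbb R^{2,1}$ whose dual trees are simplicial, let $p_1\in D_1$, $p_2\in D_2$ and $v\in\mathbb H^2$. If $\rho^{D_1}_{p_1,v}=\rho^{D_2}_{p_2,v}$ as functions on $T^1_v\mathbb H^2$, then $$\tilde\lambda_{(p_1,v)}(D_1)=\tilde\lambda_{(p_2,v)}(D_2).$$ -/

import Mathlib

open Set Filter Topology

noncomputable section

namespace Mink21

/-- The underlying space of Minkowski space `ℝ^{2,1}`; coordinate `0` is the time coordinate. -/
abbrev Mink : Type := Fin 3 → ℝ

/-- The Minkowski form `-x₀y₀ + x₁y₁ + x₂y₂`. -/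
def mink (x y : Mink) : ℝ := -(x 0 * y 0) + x 1 * y 1 + x 2 * y 2

/-- The Lorentzian length `√(-⟨w,w⟩)` of a timelike vector. -/
def mlen (w : Mink) : ℝ := Real.sqrt (-mink w w)

def FutureTimelike (w : Mink) : Prop := mink w w < 0 ∧ 0 < w 0

def FutureNull (n : Mink) : Prop := mink n n = 0 ∧ 0 < n 0

def Spacelike (w : Mink) : Prop := 0 < mink w w

/-- The hyperbolic plane: the future-directed unit timelike vectors. -/
def hyp : Set Mink := {x | mink x x = -1 ∧ 0 < x 0}

/-- The chronological past `I⁻(p)`. -/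
def chronPast (p : Mink) : Set Mink := {q | FutureTimelike (p - q)}

/-- The lightlike affine plane with normal `n` at level `c`. -/
def nullPlane (n : Mink) (c : ℝ) : Set Mink := {x | mink x n = c}

/-- The (chronological) future of the lightlike plane `nullPlane n c`, for `n` future null. -/
def nullFuture (n : Mink) (c : ℝ) : Set Mink := {x | mink x n < c}

/-- Domains of dependence: nonempty open sets that are intersections of futures of lightlike
planes and whose complement contains at least two non-parallel lightlike planes. -/
def IsDomainOfDependence (D : Set Mink) : Prop :=
  IsOpen D ∧ D.Nonempty ∧
  (∃ P : Set (Mink × ℝ), (∀ a ∈ P, FutureNull a.1) ∧ D = ⋂ a ∈ P, nullFuture a.1 a.2) ∧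
  (∃ (n m : Mink) (c d : ℝ), FutureNull n ∧ FutureNull m ∧ LinearIndependent ℝ ![n, m] ∧
    nullPlane n c ⊆ Dᶜ ∧ nullPlane m d ⊆ Dᶜ)

/-! ### Cosmological time and the initial singularity -/

/-- The cosmological time of `D` at `p`: the supremum of the Lorentzian lengths of the causal
curves in `D` that end at `p`. Since `D` is convex, it is the supremum of `|p - q|` over
`q ∈ I⁻(p) ∩ D`. -/
def cosmoTime (D : Set Mink) (p : Mink) : ℝ :=
  sSup {l | ∃ q ∈ D ∩ chronPast p, l = mlen (p - q)}

/-- The initial singularity of `D`: the image of the map sending `p ∈ D` to the point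
`r ∈ ∂D ∩ I⁻(p)` with `τ(p) = |p - r|`. It is the dual tree of the lamination of `D`. -/
def singularity (D : Set Mink) : Set Mink :=
  {r | ∃ p ∈ D, r ∈ frontier D ∩ chronPast p ∧ cosmoTime D p = mlen (p - r)}

/-- The dual tree (the initial singularity) is simplicial: it is an embedded simplicial tree,
whose edges are spacelike segments that meet each other only in common vertices.
Vertices of valence two are allowed, so that unbounded edges can be subdivided. -/
def HasSimplicialDualTree (D : Set Mink) : Prop :=
  ∃ (V : Set Mink) (G : SimpleGraph V), G.IsTree ∧
    (∀ a b : V, G.Adj a b → Spacelike (b.1 - a.1)) ∧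
    (∀ a b c d : V, G.Adj a b → G.Adj c d → s(a, b) ≠ s(c, d) →
      segment ℝ a.1 b.1 ∩ segment ℝ c.1 d.1 ⊆ {a.1, b.1} ∩ {c.1, d.1}) ∧
    singularity D = V ∪ {x | ∃ a b : V, G.Adj a b ∧ x ∈ segment ℝ a.1 b.1}

/-! ### The dual lamination -/

/-- The future lightlike directions `n` (normalized by `n₀ = 1`) of the lightlike half-lines
from `r` that are contained in `∂D`. -/
def nullDirs (D : Set Mink) (r : Mink) : Set Mink :=
  {n | FutureNull n ∧ n 0 = 1 ∧ ∀ t : ℝ, 0 ≤ t → r + t • n ∈ frontier D}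

/-- The vertices: the points of `∂D` at which at least three lightlike half-lines start. -/
def IsVertex (D : Set Mink) (r : Mink) : Prop :=
  r ∈ frontier D ∧ 3 ≤ (nullDirs D r).encard

/-- The convex hull of the lightlike half-lines of `∂D` that start at `r`. -/
def nullHull (D : Set Mink) (r : Mink) : Set Mink :=
  convexHull ℝ {y | ∃ n ∈ nullDirs D r, ∃ t : ℝ, 0 ≤ t ∧ y = r + t • n}

/-- The stratum `𝓕_r` of the hyperbolic plane dual to the point `r` of the singularity. -/
def stratum (D : Set Mink) (r : Mink) : Set Mink := {x | x ∈ hyp ∧ r + x ∈ nullHull D r}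

/-- The frontier of a subset of the hyperbolic plane, relative to the hyperbolic plane. -/
def hypFrontier (F : Set Mink) : Set Mink := hyp ∩ closure F ∩ closure (hyp \ F)

/-- Complete geodesics: intersections of the hyperbolic plane with timelike linear planes. -/
def IsGeodesic (l : Set Mink) : Prop :=
  ∃ W : Submodule ℝ Mink, Module.finrank ℝ W = 2 ∧ (∃ w ∈ W, mink w w < 0) ∧ l = hyp ∩ W

/-- The leaves of the geodesic lamination dual to the singularity of `D`: the geodesics
`𝓕_r` for `r` in the singularity but not a vertex, and the boundary geodesics of `𝓕_r` for
`r` a vertex. -/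
def leaves (D : Set Mink) : Set (Set Mink) :=
  {l | IsGeodesic l ∧
    ((∃ r ∈ singularity D, ¬ IsVertex D r ∧ l = stratum D r) ∨
      (∃ r, IsVertex D r ∧ l ⊆ hypFrontier (stratum D r)))}

/-- The intersection of `closure D` with the support plane of `D` orthogonal to `x`. -/
def supportFace (D : Set Mink) (x : Mink) : Set Mink :=
  {q | q ∈ closure D ∧ ∀ y ∈ D, mink y x ≤ mink q x}

/-- The leaves seen by an observer at the event `p`: those for which the support plane
orthogonal to some point of the leaf touches `closure D` at some point of `I⁻(p)`. -/
def seenLeaves (D : Set Mink) (p : Mink) : Set (Set Mink) :=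
  {l | l ∈ leaves D ∧ ∃ x ∈ l, (supportFace D x ∩ chronPast p).Nonempty}

/-! ### The rescaled intensity function -/

/-- The Lorentzian gradient: `mink (mgrad f q) w` is the derivative of `f` at `q` along `w`. -/
def mgrad (f : Mink → ℝ) (q : Mink) : Mink :=
  ![-(fderiv ℝ f q (Pi.single 0 1)), fderiv ℝ f q (Pi.single 1 1), fderiv ℝ f q (Pi.single 2 1)]

/-- The level surface `H_ε` of the cosmological time. -/
def levelSurface (D : Set Mink) (ε : ℝ) : Set Mink := {q | q ∈ D ∧ cosmoTime D q = ε}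

/-- The future-directed unit normal at `q` of the level surface of the cosmological time
through `q`. -/
def unitNormal (D : Set Mink) (q : Mink) : Mink :=
  (mlen (mgrad (cosmoTime D) q))⁻¹ • (-mgrad (cosmoTime D) q)

/-- The function `u_ε` on the plane orthogonal to `v` whose graph in the direction `v` is `H_ε`
(for `x` in that plane there is exactly one `s` with `x + s v ∈ H_ε`). -/
def levelHeight (D : Set Mink) (v : Mink) (ε : ℝ) (x : Mink) : ℝ :=
  sInf {s : ℝ | x + s • v ∈ levelSurface D ε}

/-- `ι_ε(x) = -ε ⟨ν_ε(q), v⟩`, where `q = x + u_ε(x) v ∈ H_ε`. -/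
def iotaEps (D : Set Mink) (v : Mink) (ε : ℝ) (x : Mink) : ℝ :=
  -ε * mink (unitNormal D (x + levelHeight D v ε x • v)) v

/-- `ι(x) = lim_{ε → 0+} ι_ε(x)`. -/
def iota (D : Set Mink) (v : Mink) (x : Mink) : ℝ :=
  limUnder (𝓝[>] (0 : ℝ)) (fun ε => iotaEps D v ε x)

/-- The point where the past-directed light ray from `p` in the direction `u - v` leaves `D`,
that is, its intersection point with `∂D`. -/
def boundaryHit (D : Set Mink) (p v u : Mink) : Mink :=
  p + sSup {t : ℝ | 0 ≤ t ∧ p + t • (u - v) ∈ D} • (u - v)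

/-- The orthogonal projection to the plane orthogonal to the unit timelike vector `v`. -/
def projPerp (v q : Mink) : Mink := q + mink q v • v

/-- The unit tangent circle `T¹_v` of the hyperbolic plane at `v`. -/
def unitTangent (v : Mink) : Set Mink := {u | mink u v = 0 ∧ mink u u = 1}

/-- The rescaled intensity function of the domain `D` for the observer `(p, v)`. -/
def intensity (D : Set Mink) (p v : Mink) : unitTangent v → ℝ :=
  fun u => iota D v (projPerp v (boundaryHit D p v u.1))

end Mink21

end

/-!
The domain `D` is convex, and the plane through the foot `r` of `q ∈ D` orthogonal to `q - r` is a
support plane. Hence the gradient of the cosmological time at `q` is determined by `q - r`, and the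
level surface has unit normal `(q - r) / |q - r|` there (`unitNormal_eq`). Letting `q` descend to
`∂D`, its foot tends to the past endpoint of the lightlike segment of `∂D` through the limit, so
the intensity at a point of `∂D` is its height above that endpoint (`iota_eq`).

The whole argument is about edges of the singularity. At an interior point of an edge there are
exactly two lightlike support normals `n₁` and `n₂` (`IsEdgePoint`), and the dual leaf is the
geodesic `geod n₁ n₂`. The plane orthogonal to an edge at such a point meets the singularity in
that point only, so connected subsets of the tree must pass through it to change sides. It follows
that a leaf is seen by the observer if and only if it is dual to an edge that has a point in the
past of the observer (`exists_isEdgePoint_of_mem_seenLeaves`, `IsEdgePoint.geod_mem_seenLeaves`);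
for a boundary leaf at a vertex, a path of feet that crosses the leaf enters the dual edge.

Light rays are parametrized by the circle of null directions `m`. The rays that hit the strip
spanned by an edge and its null direction `n₁` form an arc on which the intensity is
`A + B ⟨m, n₂⟩ / ⟨m, n₁⟩` with `B < 0` (`rayIntensity_strip`), and by analytic continuation around
the circle this formula determines `n₁` and `n₂` (`eq_of_strip_formulas`). In the other domain, near
the middle of this arc the intensity is continuous and positive, hence the feet of points slightly
above `∂D` stay close to the past endpoint of a segment. Either one of these feet is an edge point,
whose strip is met by rays of the same arc, or all are vertices and therefore, the feet forming a
connected set, equal (`strip_or_fan`). In the second case `∂D` is locally a light cone, where the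
intensity is the quotient of a quadratic form in `m` by `⟨m, w⟩` with `w` timelike. Comparing with
the first formula at `m = n₁` rules this out, since `⟨n₁, w⟩ ≠ 0` whereas `B ⟨n₁, n₂⟩ ≠ 0` is the
residue of the pole. In the first case the two pairs of null directions agree, and so do the leaves.
-/

noncomputable section

namespace Mink21

/-! ### Algebra of the Minkowski form -/

theorem mink_comm (x y : Mink) : mink x y = mink y x := by
  simp only [mink]; ring

@[simp] theorem mink_add_left (x y z : Mink) : mink (x + y) z = mink x z + mink y z := by
  simp only [mink, Pi.add_apply]; ring

@[simp] theorem mink_add_right (x y z : Mink) : mink x (y + z) = mink x y + mink x z := by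
  simp only [mink, Pi.add_apply]; ring

@[simp] theorem mink_sub_left (x y z : Mink) : mink (x - y) z = mink x z - mink y z := by
  simp only [mink, Pi.sub_apply]; ring

@[simp] theorem mink_sub_right (x y z : Mink) : mink x (y - z) = mink x y - mink x z := by
  simp only [mink, Pi.sub_apply]; ring

@[simp] theorem mink_smul_left (c : ℝ) (x y : Mink) : mink (c • x) y = c * mink x y := by
  simp only [mink, Pi.smul_apply, smul_eq_mul]; ring

@[simp] theorem mink_smul_right (c : ℝ) (x y : Mink) : mink x (c • y) = c * mink x y := by
  simp only [mink, Pi.smul_apply, smul_eq_mul]; ring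

@[simp] theorem mink_neg_left (x y : Mink) : mink (-x) y = -mink x y := by
  simp only [mink, Pi.neg_apply]; ring

@[simp] theorem mink_neg_right (x y : Mink) : mink x (-y) = -mink x y := by
  simp only [mink, Pi.neg_apply]; ring

@[simp] theorem mink_zero_left (x : Mink) : mink 0 x = 0 := by simp [mink]

@[simp] theorem mink_zero_right (x : Mink) : mink x 0 = 0 := by simp [mink]

@[fun_prop]
theorem Continuous.mink {X : Type*} [TopologicalSpace X] {f g : X → Mink}
    (hf : Continuous f) (hg : Continuous g) : Continuous fun x => mink (f x) (g x) := by
  unfold Mink21.mink; fun_prop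

theorem tendsto_mink {X : Type*} {F : Filter X} {f g : X → Mink} {a b : Mink}
    (hf : Tendsto f F (𝓝 a)) (hg : Tendsto g F (𝓝 b)) :
    Tendsto (fun x => mink (f x) (g x)) F (𝓝 (mink a b)) := by
  have h : Continuous fun x : Mink × Mink => mink x.1 x.2 := by fun_prop
  exact (h.tendsto (a, b)).comp (hf.prodMk_nhds hg)

/-- Future-directed causal vectors, the zero vector included. -/
def FutureCausal (w : Mink) : Prop := mink w w ≤ 0 ∧ 0 ≤ w 0

/-- The circle of future lightlike directions, normalized by `n 0 = 1`. -/
def dirs : Set Mink := {n | FutureNull n ∧ n 0 = 1}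

theorem FutureTimelike.causal {w : Mink} (h : FutureTimelike w) : FutureCausal w :=
  ⟨h.1.le, h.2.le⟩

theorem FutureNull.causal {w : Mink} (h : FutureNull w) : FutureCausal w :=
  ⟨h.1.le, h.2.le⟩

theorem dirs_causal {n : Mink} (h : n ∈ dirs) : FutureCausal n := h.1.causal

theorem hyp_timelike {v : Mink} (h : v ∈ hyp) : FutureTimelike v :=
  ⟨by rw [h.1]; norm_num, h.2⟩

theorem mem_dirs_iff {n : Mink} : n ∈ dirs ↔ n 0 = 1 ∧ n 1 ^ 2 + n 2 ^ 2 = 1 := by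
  constructor
  · rintro ⟨⟨h, -⟩, h1⟩
    refine ⟨h1, ?_⟩
    simp only [mink, h1] at h
    linarith
  · rintro ⟨h0, h⟩
    refine ⟨⟨?_, ?_⟩, h0⟩
    · simp only [mink, h0]; linarith
    · rw [h0]; norm_num

theorem causal_sq_le {w : Mink} (h : FutureCausal w) : w 1 ^ 2 + w 2 ^ 2 ≤ w 0 ^ 2 := by
  have := h.1
  simp only [mink] at this
  nlinarith

theorem FutureCausal.mink_nonpos {w x : Mink} (hw : FutureCausal w) (hx : FutureCausal x) :
    mink w x ≤ 0 := by
  have h1 := causal_sq_le hw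
  have h2 := causal_sq_le hx
  have h3 : w 1 * x 1 + w 2 * x 2 ≤ w 0 * x 0 := by
    apply le_of_sq_le_sq _ (mul_nonneg hw.2 hx.2)
    calc (w 1 * x 1 + w 2 * x 2) ^ 2 ≤ (w 1 ^ 2 + w 2 ^ 2) * (x 1 ^ 2 + x 2 ^ 2) := by
          nlinarith [sq_nonneg (w 1 * x 2 - w 2 * x 1)]
      _ ≤ w 0 ^ 2 * x 0 ^ 2 := by gcongr
      _ = _ := by ring
  simp only [mink]; linarith

theorem FutureCausal.pos_of_ne {w : Mink} (hw : FutureCausal w) (h : w ≠ 0) : 0 < w 0 := by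
  rcases hw.2.lt_or_eq with h0 | h0
  · exact h0
  · exfalso
    apply h
    have h1 := causal_sq_le hw
    rw [← h0] at h1
    have h2 : w 1 = 0 := by nlinarith [sq_nonneg (w 1), sq_nonneg (w 2)]
    have h3 : w 2 = 0 := by nlinarith [sq_nonneg (w 1), sq_nonneg (w 2)]
    funext i; fin_cases i <;> simp [← h0, h2, h3]

theorem FutureCausal.add {w x : Mink} (hw : FutureCausal w) (hx : FutureCausal x) :
    FutureCausal (w + x) := by
  refine ⟨?_, add_nonneg hw.2 hx.2⟩
  have := hw.mink_nonpos hx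
  simp only [mink_add_left, mink_add_right, mink_comm x w]
  linarith [hw.1, hx.1]

theorem FutureCausal.smul {w : Mink} (hw : FutureCausal w) {c : ℝ} (hc : 0 ≤ c) :
    FutureCausal (c • w) := by
  refine ⟨?_, mul_nonneg hc hw.2⟩
  simp only [mink_smul_left, mink_smul_right]
  nlinarith [hw.1, mul_nonneg hc hc]

theorem FutureTimelike.smul {w : Mink} (hw : FutureTimelike w) {c : ℝ} (hc : 0 < c) :
    FutureTimelike (c • w) := by
  refine ⟨?_, mul_pos hc hw.2⟩
  simp only [mink_smul_left, mink_smul_right]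
  nlinarith [hw.1, mul_pos hc hc]

theorem FutureTimelike.add {w x : Mink} (hw : FutureTimelike w) (hx : FutureCausal x) :
    FutureTimelike (w + x) := by
  refine ⟨?_, add_pos_of_pos_of_nonneg hw.2 hx.2⟩
  have := hw.causal.mink_nonpos hx
  simp only [mink_add_left, mink_add_right, mink_comm x w]
  linarith [hw.1, hx.1]

/-- Vectors orthogonal to a timelike vector are spacelike, with a quantitative bound. -/
theorem orth_timelike_bound {w y : Mink} (h : mink y w = 0) :
    -mink w w * (y 1 ^ 2 + y 2 ^ 2) ≤ w 0 ^ 2 * mink y y := by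
  have h0 : y 0 * w 0 = y 1 * w 1 + y 2 * w 2 := by simp only [mink] at h; linarith
  have h1 : w 0 ^ 2 * y 0 ^ 2 = (y 1 * w 1 + y 2 * w 2) ^ 2 := by rw [← h0]; ring
  have h2 : w 0 ^ 2 * mink y y = w 0 ^ 2 * (y 1 ^ 2 + y 2 ^ 2) - w 0 ^ 2 * y 0 ^ 2 := by
    simp only [mink]; ring
  rw [h2, h1]
  simp only [mink]
  nlinarith [sq_nonneg (y 1 * w 2 - y 2 * w 1)]

theorem mink_nonneg_of_orth {w y : Mink} (hw : FutureTimelike w) (h : mink y w = 0) :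
    0 ≤ mink y y := by
  have h1 := orth_timelike_bound h
  have h2 : 0 < w 0 ^ 2 := pow_pos hw.2 2
  have h3 : 0 ≤ -mink w w * (y 1 ^ 2 + y 2 ^ 2) :=
    mul_nonneg (by linarith [hw.1]) (by positivity)
  by_contra hc
  push Not at hc
  nlinarith

theorem eq_zero_of_orth {w y : Mink} (hw : FutureTimelike w) (h : mink y w = 0)
    (hy : mink y y ≤ 0) : y = 0 := by
  have h1 := orth_timelike_bound h
  have h2 : 0 < w 0 ^ 2 := pow_pos hw.2 2
  have hw1 := hw.1
  have hs : y 1 ^ 2 + y 2 ^ 2 ≤ 0 := by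
    by_contra hc
    push Not at hc
    nlinarith [mul_pos (neg_pos.2 hw1) hc]
  have h3 : y 1 = 0 := by nlinarith [sq_nonneg (y 1), sq_nonneg (y 2)]
  have h4 : y 2 = 0 := by nlinarith [sq_nonneg (y 1), sq_nonneg (y 2)]
  have h5 : y 0 = 0 := by
    simp only [mink, h3, h4] at h
    have := hw.2
    have h6 : y 0 * w 0 = 0 := by linarith
    rcases mul_eq_zero.1 h6 with h | h
    · exact h
    · exact absurd h this.ne'
  funext i; fin_cases i <;> simp [h3, h4, h5]

theorem FutureTimelike.mink_neg {w x : Mink} (hw : FutureTimelike w) (hx : FutureCausal x)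
    (h0 : x ≠ 0) : mink x w < 0 := by
  rcases (hx.mink_nonpos hw.causal).lt_or_eq with h | h
  · exact h
  · exact absurd (eq_zero_of_orth hw h hx.1) h0

theorem dirs_ne_zero {n : Mink} (hn : n ∈ dirs) : n ≠ 0 := by
  rintro rfl
  exact absurd hn.2 (by simp)

theorem FutureTimelike.mink_dirs_neg {w n : Mink} (hw : FutureTimelike w) (hn : n ∈ dirs) :
    mink n w < 0 :=
  hw.mink_neg (dirs_causal hn) (dirs_ne_zero hn)

/-- The reversed Cauchy–Schwarz inequality. -/
theorem reversed_cauchy_schwarz {w : Mink} (hw : FutureTimelike w) (x : Mink) :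
    mink w w * mink x x ≤ mink x w ^ 2 := by
  have hw1 := hw.1
  have h := mink_nonneg_of_orth hw (y := mink w w • x - mink x w • w)
    (by simp only [mink_sub_left, mink_smul_left]; ring)
  simp only [mink_sub_left, mink_smul_left, mink_sub_right, mink_smul_right, mink_comm w x] at h
  have h2 : 0 ≤ mink w w * (mink w w * mink x x - mink x w ^ 2) := by
    linarith
  by_contra hc
  push Not at hc
  nlinarith

theorem mlen_le_of_timelike {w x : Mink} (hw : FutureTimelike w) (hx : FutureCausal x) :
    mlen x * mlen w ≤ -mink x w := by
  unfold mlen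
  rw [← Real.sqrt_mul (by linarith [hx.1])]
  apply Real.sqrt_le_iff.2
  refine ⟨by linarith [hx.mink_nonpos hw.causal], ?_⟩
  have := reversed_cauchy_schwarz hw x
  nlinarith

theorem mlen_sq {w : Mink} (hw : FutureCausal w) : mlen w ^ 2 = -mink w w :=
  Real.sq_sqrt (by linarith [hw.1])

theorem mlen_pos {w : Mink} (hw : FutureTimelike w) : 0 < mlen w :=
  Real.sqrt_pos.2 (by linarith [hw.1])

theorem mlen_nonneg (w : Mink) : 0 ≤ mlen w := Real.sqrt_nonneg _

/-- Consequence of the sign of the Gram determinant of `w`, a lightlike `n` and a unit timelike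
`v`. -/
theorem neg_mink_self_le {w n v : Mink} (hn : n ∈ dirs) (hv : v ∈ hyp) :
    -mink w w * -mink n v ≤ 2 * (mink w n * mink w v) := by
  have hk : 0 < -mink n v := neg_pos.2 ((hyp_timelike hv).mink_dirs_neg hn)
  have hg : mink w w * (mink n n * mink v v - mink n v ^ 2)
      - mink w n * (mink w n * mink v v - mink n v * mink w v)
      + mink w v * (mink w n * mink n v - mink n n * mink w v)
      = -(w 0 * (n 1 * v 2 - n 2 * v 1) - w 1 * (n 0 * v 2 - n 2 * v 0)
        + w 2 * (n 0 * v 1 - n 1 * v 0)) ^ 2 := by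
    simp only [mink]; ring
  have hnn : mink n n = 0 := hn.1.1
  rw [hnn, hv.1] at hg
  have hd := sq_nonneg (w 0 * (n 1 * v 2 - n 2 * v 1) - w 1 * (n 0 * v 2 - n 2 * v 0)
        + w 2 * (n 0 * v 1 - n 1 * v 0))
  have h2 : (-mink w w * -mink n v) * -mink n v ≤ (2 * (mink w n * mink w v)) * -mink n v := by
    nlinarith [sq_nonneg (mink w n)]
  exact le_of_mul_le_mul_right h2 hk

theorem dirs_mink_nonpos {n m : Mink} (hn : n ∈ dirs) (hm : m ∈ dirs) : mink n m ≤ 0 :=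
  (dirs_causal hn).mink_nonpos (dirs_causal hm)

theorem FutureCausal.eq_smul_of_orth {w n : Mink} (hw : FutureCausal w) (hn : n ∈ dirs)
    (h : mink w n = 0) : w = w 0 • n := by
  obtain ⟨hn0, hn1⟩ := mem_dirs_iff.1 hn
  have h1 := causal_sq_le hw
  simp only [mink, hn0] at h
  have h2 : (w 1 - w 0 * n 1) ^ 2 + (w 2 - w 0 * n 2) ^ 2 ≤ 0 := by
    have : (w 1 - w 0 * n 1) ^ 2 + (w 2 - w 0 * n 2) ^ 2 = (w 1 ^ 2 + w 2 ^ 2)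
      - 2 * w 0 * (w 1 * n 1 + w 2 * n 2) + w 0 ^ 2 * (n 1 ^ 2 + n 2 ^ 2) := by ring
    rw [this, hn1, show w 1 * n 1 + w 2 * n 2 = w 0 by linarith]
    nlinarith
  have h3 : w 1 - w 0 * n 1 = 0 := by
    nlinarith [sq_nonneg (w 1 - w 0 * n 1), sq_nonneg (w 2 - w 0 * n 2)]
  have h4 : w 2 - w 0 * n 2 = 0 := by
    nlinarith [sq_nonneg (w 1 - w 0 * n 1), sq_nonneg (w 2 - w 0 * n 2)]
  funext i; fin_cases i
  · simp [hn0]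
  · simp; linarith
  · simp; linarith

theorem dirs_eq_of_orth {n m : Mink} (hn : n ∈ dirs) (hm : m ∈ dirs) (h : mink n m = 0) :
    n = m := by
  have := (dirs_causal hn).eq_smul_of_orth hm h
  rwa [hn.2, one_smul] at this

theorem dirs_mink_neg {n m : Mink} (hn : n ∈ dirs) (hm : m ∈ dirs) (h : n ≠ m) :
    mink n m < 0 :=
  (dirs_mink_nonpos hn hm).lt_of_ne fun h0 => h (dirs_eq_of_orth hn hm h0)

theorem dirs_norm_sub_sq_le {n m : Mink} (hn : n ∈ dirs) (hm : m ∈ dirs) :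
    ‖n - m‖ ^ 2 ≤ -2 * mink n m := by
  obtain ⟨hn0, hn1⟩ := mem_dirs_iff.1 hn
  obtain ⟨hm0, hm1⟩ := mem_dirs_iff.1 hm
  have e : -2 * mink n m = (n 1 - m 1) ^ 2 + (n 2 - m 2) ^ 2 := by
    simp only [mink, hn0, hm0]; linarith
  rw [e]
  have h : ‖n - m‖ ≤ Real.sqrt ((n 1 - m 1) ^ 2 + (n 2 - m 2) ^ 2) := by
    rw [pi_norm_le_iff_of_nonneg (Real.sqrt_nonneg _)]
    intro i
    apply Real.le_sqrt_of_sq_le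
    rw [Real.norm_eq_abs, sq_abs]
    fin_cases i
    · simp [hn0, hm0]; positivity
    · simp; positivity
    · simp; positivity
  calc ‖n - m‖ ^ 2 ≤ Real.sqrt ((n 1 - m 1) ^ 2 + (n 2 - m 2) ^ 2) ^ 2 := by gcongr
    _ = _ := Real.sq_sqrt (by positivity)

theorem isCompact_dirs : IsCompact dirs := by
  have hc : IsClosed dirs := by
    have : dirs = {n : Mink | n 0 = 1} ∩ {n : Mink | n 1 ^ 2 + n 2 ^ 2 = 1} := by
      ext n; exact mem_dirs_iff
    rw [this]
    exact (isClosed_eq (by fun_prop) (by fun_prop)).inter (isClosed_eq (by fun_prop) (by fun_prop))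
  refine (isCompact_closedBall (0 : Mink) 1).of_isClosed_subset hc fun n hn => ?_
  obtain ⟨hn0, hn1⟩ := mem_dirs_iff.1 hn
  rw [mem_closedBall_zero_iff, pi_norm_le_iff_of_nonneg zero_le_one]
  intro i
  rw [Real.norm_eq_abs]
  fin_cases i
  · simp [hn0]
  · exact (sq_le_one_iff_abs_le_one (n 1)).1 (by nlinarith [sq_nonneg (n 2)])
  · exact (sq_le_one_iff_abs_le_one (n 2)).1 (by nlinarith [sq_nonneg (n 1)])

theorem FutureNull.normalize {n : Mink} (hn : FutureNull n) : (n 0)⁻¹ • n ∈ dirs := by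
  refine ⟨⟨?_, ?_⟩, ?_⟩
  · simp [hn.1]
  · exact mul_pos (inv_pos.2 hn.2) hn.2
  · exact inv_mul_cancel₀ hn.2.ne'

/-- A vector spanning the orthogonal complement of two lightlike directions. -/
def perp (n m : Mink) : Mink := ![n 2 * m 1 - n 1 * m 2, n 2 - m 2, m 1 - n 1]

theorem mink_perp_left {n m : Mink} (hn : n ∈ dirs) : mink (perp n m) n = 0 := by
  simp only [mink, perp, hn.2]; simp; ring

theorem mink_perp_right {n m : Mink} (hm : m ∈ dirs) : mink (perp n m) m = 0 := by
  simp only [mink, perp, hm.2]; simp; ring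

theorem mink_perp_self {n m : Mink} (hn : n ∈ dirs) (hm : m ∈ dirs) :
    mink (perp n m) (perp n m) = mink n m ^ 2 := by
  obtain ⟨hn0, hn1⟩ := mem_dirs_iff.1 hn
  obtain ⟨hm0, hm1⟩ := mem_dirs_iff.1 hm
  simp only [mink, perp, hn0, hm0]
  simp
  linear_combination (1 - m 1 ^ 2 - m 2 ^ 2) * hn1

theorem mink_perp_self_pos {n m : Mink} (hn : n ∈ dirs) (hm : m ∈ dirs) (h : n ≠ m) :
    0 < mink (perp n m) (perp n m) := by
  rw [mink_perp_self hn hm]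
  exact sq_pos_of_neg (dirs_mink_neg hn hm h)

theorem orth_dirs_eq_smul_perp {n m y : Mink} (hn : n ∈ dirs) (hm : m ∈ dirs) (h : n ≠ m)
    (h1 : mink y n = 0) (h2 : mink y m = 0) : ∃ c : ℝ, y = c • perp n m := by
  obtain ⟨hn0, hn1⟩ := mem_dirs_iff.1 hn
  obtain ⟨hm0, hm1⟩ := mem_dirs_iff.1 hm
  have hd : (n 2 - m 2) ^ 2 + (m 1 - n 1) ^ 2 ≠ 0 := by
    intro h0
    apply h
    have h3 : n 2 - m 2 = 0 := by nlinarith [sq_nonneg (n 2 - m 2), sq_nonneg (m 1 - n 1)]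
    have h4 : m 1 - n 1 = 0 := by nlinarith [sq_nonneg (n 2 - m 2), sq_nonneg (m 1 - n 1)]
    funext i; fin_cases i
    · simp [hn0, hm0]
    · simp; linarith
    · simp; linarith
  simp only [mink, hn0, hm0] at h1 h2
  have h3 : (n 1 - m 1) * y 1 + (n 2 - m 2) * y 2 = 0 := by linarith
  refine ⟨(y 1 * (n 2 - m 2) + y 2 * (m 1 - n 1)) / ((n 2 - m 2) ^ 2 + (m 1 - n 1) ^ 2), ?_⟩
  have e1 : y 1 = (y 1 * (n 2 - m 2) + y 2 * (m 1 - n 1)) /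
      ((n 2 - m 2) ^ 2 + (m 1 - n 1) ^ 2) * (n 2 - m 2) := by
    field_simp
    linear_combination (n 1 - m 1) * h3
  have e2 : y 2 = (y 1 * (n 2 - m 2) + y 2 * (m 1 - n 1)) /
      ((n 2 - m 2) ^ 2 + (m 1 - n 1) ^ 2) * (m 1 - n 1) := by
    field_simp
    linear_combination (n 2 - m 2) * h3
  set c := (y 1 * (n 2 - m 2) + y 2 * (m 1 - n 1)) / ((n 2 - m 2) ^ 2 + (m 1 - n 1) ^ 2)
  funext i; fin_cases i
  · simp [perp]
    linear_combination -h1 + n 1 * e1 + n 2 * e2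
  · simpa [perp] using e1
  · simpa [perp] using e2

/-- Coordinates with respect to two lightlike directions and the vector orthogonal to them. -/
theorem dirs_decomposition {n m : Mink} (hn : n ∈ dirs) (hm : m ∈ dirs) (h : n ≠ m) (x : Mink) :
    x = (mink x m / mink n m) • n + (mink x n / mink n m) • m
      + (mink x (perp n m) / mink (perp n m) (perp n m)) • perp n m := by
  have hk := (dirs_mink_neg hn hm h).ne
  have he := (mink_perp_self_pos hn hm h).ne'
  set y := x - ((mink x m / mink n m) • n + (mink x n / mink n m) • m) with hy
  have hnn : mink n n = 0 := hn.1.1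
  have hmm : mink m m = 0 := hm.1.1
  have h1 : mink y n = 0 := by
    simp only [hy, mink_sub_left, mink_add_left, mink_smul_left, hnn, mink_comm m n]
    field_simp; ring
  have h2 : mink y m = 0 := by
    simp only [hy, mink_sub_left, mink_add_left, mink_smul_left, hmm]
    field_simp; ring
  obtain ⟨c, hc⟩ := orth_dirs_eq_smul_perp hn hm h h1 h2
  have h3 : mink x (perp n m) = c * mink (perp n m) (perp n m) := by
    have : x = y + ((mink x m / mink n m) • n + (mink x n / mink n m) • m) := by
      rw [hy]; abel
    conv_lhs => rw [this, hc]
    simp only [mink_add_left, mink_smul_left, mink_comm n (perp n m), mink_perp_left hn,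
      mink_comm m (perp n m), mink_perp_right hm]
    ring
  rw [h3, mul_div_assoc, div_self he, mul_one, ← hc, hy]
  abel

/-! ### Domains of dependence -/

theorem exists_pos_mul_norm_le {w : Mink} (hw : FutureTimelike w) :
    ∃ κ > 0, ∀ x, FutureCausal x → κ * ‖x‖ ≤ -mink x w := by
  have hs : Real.sqrt (w 1 ^ 2 + w 2 ^ 2) < w 0 := by
    rw [Real.sqrt_lt' hw.2]
    have := hw.1
    simp only [mink] at this
    linarith
  refine ⟨w 0 - Real.sqrt (w 1 ^ 2 + w 2 ^ 2), by linarith, fun x hx => ?_⟩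
  have hx2 := causal_sq_le hx
  have hn : ‖x‖ ≤ x 0 := by
    rw [pi_norm_le_iff_of_nonneg hx.2]
    intro i
    rw [Real.norm_eq_abs]
    fin_cases i
    · exact (abs_of_nonneg hx.2).le
    · exact abs_le_of_sq_le_sq (a := x 1) (by nlinarith [sq_nonneg (x 2)]) hx.2
    · exact abs_le_of_sq_le_sq (a := x 2) (by nlinarith [sq_nonneg (x 1)]) hx.2
  have hc : x 1 * w 1 + x 2 * w 2 ≤ x 0 * Real.sqrt (w 1 ^ 2 + w 2 ^ 2) := by
    apply le_of_sq_le_sq _ (mul_nonneg hx.2 (Real.sqrt_nonneg _))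
    rw [mul_pow, Real.sq_sqrt (by positivity)]
    calc (x 1 * w 1 + x 2 * w 2) ^ 2 ≤ (x 1 ^ 2 + x 2 ^ 2) * (w 1 ^ 2 + w 2 ^ 2) := by
          nlinarith [sq_nonneg (x 1 * w 2 - x 2 * w 1)]
      _ ≤ _ := by gcongr
  calc _ ≤ (w 0 - Real.sqrt (w 1 ^ 2 + w 2 ^ 2)) * x 0 := by gcongr
    _ ≤ _ := by simp only [mink]; linarith

/-- The normalized normals of the lightlike support planes of `D` at `r`. -/
def nullNormals (D : Set Mink) (r : Mink) : Set Mink :=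
  {n | n ∈ dirs ∧ ∀ y ∈ D, mink (y - r) n ≤ 0}

theorem mink_sub_le_of_mem_closure {D : Set Mink} {a n : Mink} {c : ℝ}
    (h : ∀ y ∈ D, mink (y - a) n ≤ c) {y : Mink} (hy : y ∈ closure D) : mink (y - a) n ≤ c := by
  have hc : IsClosed {y : Mink | mink (y - a) n ≤ c} :=
    isClosed_le (by fun_prop) continuous_const
  exact closure_minimal (t := {y : Mink | mink (y - a) n ≤ c}) h hc hy

theorem isOpen_futureTimelike : IsOpen {w : Mink | FutureTimelike w} :=
  (isOpen_lt (f := fun w : Mink => mink w w) (by fun_prop) continuous_const).inter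
    (isOpen_lt (g := fun w : Mink => w 0) continuous_const (by fun_prop))

theorem isClosed_futureCausal : IsClosed {w : Mink | FutureCausal w} :=
  (isClosed_le (f := fun w : Mink => mink w w) (by fun_prop) continuous_const).inter
    (isClosed_le (g := fun w : Mink => w 0) continuous_const (by fun_prop))

namespace IsDomainOfDependence

variable {D : Set Mink}

theorem isOpen (hD : IsDomainOfDependence D) : IsOpen D := hD.1

theorem convex (hD : IsDomainOfDependence D) : Convex ℝ D := by
  obtain ⟨-, -, ⟨P, -, rfl⟩, -⟩ := hD
  refine convex_iInter₂ fun a _ => ?_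
  intro x hx y hy s t hs ht hst
  simp only [nullFuture, mem_ofPred_eq, mink_add_left, mink_smul_left] at *
  have : a.2 = s * a.2 + t * a.2 := by rw [← add_mul, hst, one_mul]
  rw [this]
  rcases hs.eq_or_lt with rfl | hs'
  · rw [zero_add] at hst; subst hst; simpa using hy
  · have := mul_lt_mul_of_pos_left hx hs'
    have := mul_le_mul_of_nonneg_left hy.le ht
    linarith

theorem exists_separating (hD : IsDomainOfDependence D) {q : Mink} (hq : q ∉ D) :
    ∃ n ∈ dirs, ∀ y ∈ D, mink (y - q) n < 0 := by
  obtain ⟨-, -, ⟨P, hP, rfl⟩, -⟩ := hD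
  simp only [mem_iInter, not_forall] at hq
  obtain ⟨a, ha, hqa⟩ := hq
  have h0 := (hP a ha).2
  refine ⟨(a.1 0)⁻¹ • a.1, (hP a ha).normalize, fun y hy => ?_⟩
  have hy' : mink y a.1 < a.2 := mem_iInter₂.1 hy a ha
  simp only [nullFuture, mem_ofPred_eq, not_lt] at hqa
  rw [mink_smul_right, mink_sub_left]
  exact mul_neg_of_pos_of_neg (inv_pos.2 h0) (by linarith)

theorem add_mem (hD : IsDomainOfDependence D) {y w : Mink} (hy : y ∈ D) (hw : FutureCausal w) :
    y + w ∈ D := by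
  by_contra h
  obtain ⟨n, hn, hn'⟩ := hD.exists_separating h
  have h1 := hn' y hy
  have h2 := hw.mink_nonpos (dirs_causal hn)
  rw [show y - (y + w) = -w by abel, mink_neg_left] at h1
  linarith

theorem add_mem_closure (hD : IsDomainOfDependence D) {y w : Mink} (hy : y ∈ closure D)
    (hw : FutureCausal w) :
    y + w ∈ closure D :=
  map_mem_closure (f := fun z => z + w) (by fun_prop) hy fun _ hz => hD.add_mem hz hw

theorem add_timelike_mem (hD : IsDomainOfDependence D) {y w : Mink} (hy : y ∈ closure D)
    (hw : FutureTimelike w) :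
    y + w ∈ D := by
  have ho : IsOpen {z : Mink | FutureTimelike (y + w - z)} :=
    isOpen_futureTimelike.preimage (by fun_prop)
  obtain ⟨z, hz, hzD⟩ := mem_closure_iff.1 hy _ ho (by simpa using hw)
  have := hD.add_mem hzD hz.causal
  rwa [add_sub_cancel] at this

theorem mem_of_timelike (hD : IsDomainOfDependence D) {y q : Mink} (hy : y ∈ closure D)
    (hw : FutureTimelike (q - y)) :
    q ∈ D := by
  have := hD.add_timelike_mem hy hw
  rwa [add_sub_cancel] at this

theorem mem_frontier_iff (hD : IsDomainOfDependence D) {q : Mink} :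
    q ∈ frontier D ↔ q ∈ closure D ∧ q ∉ D := by
  rw [frontier, hD.isOpen.interior_eq]; rfl

theorem closure_convex (hD : IsDomainOfDependence D) : Convex ℝ (closure D) := hD.convex.closure

theorem add_smul_sub_mem (hD : IsDomainOfDependence D) {x y : Mink} (hx : x ∈ closure D)
    (hy : y ∈ D) {t : ℝ} (ht : 0 < t)
    (ht1 : t ≤ 1) : x + t • (y - x) ∈ D := by
  have := hD.convex.add_smul_sub_mem_interior' hx (by rwa [hD.isOpen.interior_eq]) ⟨ht, ht1⟩
  rwa [hD.isOpen.interior_eq] at this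

/-- The normals of two non-parallel lightlike planes outside `D` add up to a timelike vector, and
the corresponding linear form is bounded on `D`. This is what makes pasts compact. -/
theorem exists_bound (hD : IsDomainOfDependence D) :
    ∃ (w : Mink) (C : ℝ), FutureTimelike w ∧ ∀ y ∈ closure D, mink y w ≤ C := by
  obtain ⟨hDo, ⟨q, hq⟩, -, n, m, c, d, hn, hm, hnm, hnc, hmd⟩ := id hD
  -- From a point `y` of `D` with `c ≤ ⟨y, n⟩`, a move to the future stays in `D` and reaches the plane.
  have key : ∀ (n : Mink) (c : ℝ), FutureNull n → nullPlane n c ⊆ Dᶜ → ∀ y ∈ D, mink y n < c := by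
    intro n c hn hnc y hy
    by_contra hlt
    push Not at hlt
    set t := (mink y n - c) / (2 * n 0 ^ 2) with ht
    have hne : n 0 ≠ 0 := hn.2.ne'
    have h0 : 0 ≤ t := div_nonneg (by linarith) (by positivity)
    set e : Mink := ![n 0, -n 1, -n 2] with he
    have hnn : n 0 ^ 2 = n 1 ^ 2 + n 2 ^ 2 := by
      have := hn.1
      simp only [mink] at this; linarith
    have hee : FutureCausal e := by
      refine ⟨?_, hn.2.le⟩
      simp [he, mink]; nlinarith
    have hen : mink e n = -(2 * n 0 ^ 2) := by
      simp [he, mink]; linarith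
    refine hnc ?_ (hD.add_mem hy (hee.smul h0))
    simp only [nullPlane, mem_ofPred_eq, mink_add_left, mink_smul_left, hen, ht]
    field_simp; ring
  refine ⟨n + m, c + d, ⟨?_, add_pos hn.2 hm.2⟩, fun y hy => ?_⟩
  · have h1 : mink n m < 0 := by
      refine (hn.causal.mink_nonpos hm.causal).lt_of_ne fun h => ?_
      have h2 := dirs_eq_of_orth hn.normalize hm.normalize (by simp [h])
      rw [LinearIndependent.pair_iff] at hnm
      obtain ⟨h3, -⟩ := hnm ((n 0)⁻¹) (-(m 0)⁻¹) (by rw [h2, neg_smul, add_neg_cancel])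
      exact (inv_pos.2 hn.2).ne' h3
    simp only [mink_add_left, mink_add_right, mink_comm m n, hn.1, hm.1]
    linarith
  · have := mink_sub_le_of_mem_closure (a := 0) (n := n + m) (c := c + d) (D := D)
      (fun y hy => by
        have h1 := key n c hn hnc y hy
        have h2 := key m d hm hmd y hy
        simp; linarith) hy
    simpa using this

/-- The causal pasts of the points near `q` meet `closure D` in a common compact set. -/
theorem exists_compact_past (hD : IsDomainOfDependence D) (q : Mink) : ∃ S : Set Mink, IsCompact S ∧
    ∀ᶠ x in 𝓝 q, ∀ y ∈ closure D, FutureCausal (x - y) → y ∈ S := by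
  obtain ⟨w, C, hw, hC⟩ := hD.exists_bound
  obtain ⟨κ, hκ, hκ'⟩ := exists_pos_mul_norm_le hw
  refine ⟨Metric.closedBall 0 ((C + (1 - mink q w)) / κ + (‖q‖ + 1)), isCompact_closedBall _ _, ?_⟩
  have h1 : ∀ᶠ x in 𝓝 q, mink q w - 1 < mink x w :=
    (tendsto_mink tendsto_id tendsto_const_nhds).eventually (lt_mem_nhds (by simp))
  have h2 : ∀ᶠ x : Mink in 𝓝 q, ‖x‖ < ‖q‖ + 1 :=
    (continuous_norm.tendsto q).eventually (gt_mem_nhds (by linarith))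
  filter_upwards [h1, h2] with x hx1 hx2 y hy hxy
  rw [mem_closedBall_zero_iff]
  have h3 : ‖x - y‖ ≤ (C + (1 - mink q w)) / κ := by
    rw [le_div_iff₀ hκ]
    have h4 := hκ' _ hxy
    have h5 := hC y hy
    rw [mink_sub_left] at h4
    linarith
  calc ‖y‖ = ‖x - (x - y)‖ := by rw [sub_sub_cancel]
    _ ≤ ‖x‖ + ‖x - y‖ := norm_sub_le _ _
    _ ≤ _ := by linarith

theorem isCompact_past (hD : IsDomainOfDependence D) (q : Mink) : IsCompact
    {y | y ∈ closure D ∧ FutureCausal (q - y)} := by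
  obtain ⟨S, hS, h⟩ := hD.exists_compact_past q
  refine hS.of_isClosed_subset ?_ fun y hy => h.self_of_nhds y hy.1 hy.2
  exact isClosed_closure.inter (isClosed_futureCausal.preimage (by fun_prop))

theorem exists_nullNormal (hD : IsDomainOfDependence D) {q : Mink} (hq : q ∉ D) :
    (nullNormals D q).Nonempty := by
  obtain ⟨n, hn, h⟩ := hD.exists_separating hq
  exact ⟨n, hn, fun y hy => (h y hy).le⟩

theorem nullNormal_lt (hD : IsDomainOfDependence D) {r n y : Mink} (hn : n ∈ nullNormals D r)
    (hy : y ∈ D) :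
    mink (y - r) n < 0 := by
  have ho : Tendsto (fun t : ℝ => y - t • (![1, 0, 0] : Mink)) (𝓝[>] 0) (𝓝 y) := by
    have : Tendsto (fun t : ℝ => y - t • (![1, 0, 0] : Mink)) (𝓝 0)
        (𝓝 (y - (0 : ℝ) • (![1, 0, 0] : Mink))) := Continuous.tendsto (by fun_prop) 0
    rw [zero_smul, sub_zero] at this
    exact this.mono_left nhdsWithin_le_nhds
  obtain ⟨t, ht, ht0⟩ := ((ho.eventually (hD.isOpen.mem_nhds hy)).and
    self_mem_nhdsWithin).exists
  have h1 := hn.2 _ ht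
  have h2 : mink (![1, 0, 0] : Mink) n = -1 := by simp [mink, hn.1.2]
  simp only [mink_sub_left, mink_smul_left, h2] at h1 ⊢
  have : (0 : ℝ) < t := ht0
  linarith

theorem notMem_of_nullNormal (hD : IsDomainOfDependence D) {r n : Mink}
    (hn : n ∈ nullNormals D r) : r ∉ D := fun h => by
  have := hD.nullNormal_lt hn h
  simp at this

/-- A lightlike half-line in `∂D` is the ray spanned by the normal of a support plane. -/
theorem nullDirs_eq (hD : IsDomainOfDependence D) {r : Mink} (hr : r ∈ closure D) :
    nullDirs D r = nullNormals D r := by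
  ext n
  constructor
  · rintro ⟨hn, hn0, h⟩
    have hnd : n ∈ dirs := ⟨hn, hn0⟩
    have h1 := h 1 zero_le_one
    rw [one_smul] at h1
    obtain ⟨m, hm, hm'⟩ := hD.exists_nullNormal (hD.mem_frontier_iff.1 h1).2
    have h2 := mink_sub_le_of_mem_closure hm' hr
    rw [show r - (r + n) = -n by abel, mink_neg_left] at h2
    have h3 := dirs_mink_nonpos hnd hm
    have h4 : n = m := dirs_eq_of_orth hnd hm (by linarith)
    subst h4
    refine ⟨hnd, fun y hy => ?_⟩
    have h5 := hm' y hy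
    simp only [mink_sub_left, mink_add_left, hn.1] at h5 ⊢
    linarith
  · rintro ⟨hn, h⟩
    refine ⟨hn.1, hn.2, fun t ht => hD.mem_frontier_iff.2
      ⟨hD.add_mem_closure hr ((dirs_causal hn).smul ht), ?_⟩⟩
    refine hD.notMem_of_nullNormal (n := n) ⟨hn, fun y hy => ?_⟩
    have := h y hy
    simp only [mink_sub_left, mink_add_left, mink_smul_left, hn.1.1] at this ⊢
    linarith

end IsDomainOfDependence

/-- Support plane normals persist along the rays and the faces of `∂D` that they are
orthogonal to. -/
theorem nullNormals_of_orth {D : Set Mink} {r s n : Mink} (hn : n ∈ nullNormals D r)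
    (h : mink (s - r) n = 0) : n ∈ nullNormals D s := by
  refine ⟨hn.1, fun y hy => ?_⟩
  have := hn.2 y hy
  simp only [mink_sub_left] at *
  linarith

/-! ### Feet: the retraction onto the initial singularity -/

/-- `r` is the foot of `q`: the plane through `r` orthogonal to the future timelike vector
`q - r` is a support plane of `D`. -/
def IsFoot (D : Set Mink) (q r : Mink) : Prop :=
  r ∈ closure D ∧ FutureTimelike (q - r) ∧ ∀ y ∈ D, mink (y - r) (q - r) ≤ 0

theorem IsFoot.le {D : Set Mink} {q r y : Mink} (h : IsFoot D q r) (hy : y ∈ closure D) :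
    mink (y - r) (q - r) ≤ 0 :=
  mink_sub_le_of_mem_closure h.2.2 hy

theorem IsFoot.unique {D : Set Mink} {q r s : Mink} (hr : IsFoot D q r) (hs : IsFoot D q s) :
    r = s := by
  have h1 := hr.le hs.1
  have h2 := hs.le hr.1
  have hc : mink (s - r) (s - r) ≤ 0 := by
    simp only [mink_sub_left, mink_sub_right] at *
    linarith
  by_contra hne
  have hne' : s - r ≠ 0 := sub_ne_zero.2 (Ne.symm hne)
  rcases le_total 0 ((s - r) 0) with h0 | h0
  · have := hs.2.1.mink_neg ⟨hc, h0⟩ hne'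
    rw [show s - r = -(r - s) by abel, mink_neg_left] at this
    linarith
  · have hc' : FutureCausal (r - s) := by
      rw [show r - s = -(s - r) by abel]
      refine ⟨?_, by simpa using h0⟩
      rwa [mink_neg_left, mink_neg_right, neg_neg]
    have := hr.2.1.mink_neg hc' (sub_ne_zero.2 hne)
    rw [show r - s = -(s - r) by abel, mink_neg_left] at this
    linarith

theorem IsFoot.mlen_le {D : Set Mink} {q r y : Mink} (h : IsFoot D q r) (hy : y ∈ closure D)
    {q' : Mink} (hq : FutureCausal (q' - y)) :
    mlen (q' - y) ≤ -mink (q' - r) (q - r) / mlen (q - r) := by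
  rw [le_div_iff₀ (mlen_pos h.2.1)]
  have h1 := mlen_le_of_timelike h.2.1 hq
  have h2 := h.le hy
  simp only [mink_sub_left] at *
  linarith

theorem mlen_smul {c : ℝ} (hc : 0 ≤ c) (w : Mink) : mlen (c • w) = c * mlen w := by
  unfold mlen
  rw [show -mink (c • w) (c • w) = c ^ 2 * -mink w w by simp; ring,
    Real.sqrt_mul (sq_nonneg c), Real.sqrt_sq hc]

theorem neg_mink_self_div_mlen {w : Mink} (hw : FutureTimelike w) :
    -mink w w / mlen w = mlen w := by
  rw [← mlen_sq hw.causal, sq, mul_div_assoc, div_self (mlen_pos hw).ne', mul_one]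

namespace IsDomainOfDependence

variable {D : Set Mink}

theorem mem_of_isFoot (hD : IsDomainOfDependence D) {q r : Mink} (h : IsFoot D q r) : q ∈ D :=
  hD.mem_of_timelike h.1 h.2.1

theorem cosmoTime_eq (hD : IsDomainOfDependence D) {q r : Mink} (h : IsFoot D q r) :
    cosmoTime D q = mlen (q - r) := by
  have hpos := mlen_pos h.2.1
  have key : ∀ c : ℝ, 0 < c → c < 1 →
      c * mlen (q - r) ∈ {l | ∃ y ∈ D ∩ chronPast q, l = mlen (q - y)} := by
    intro c hc hc1
    have e : q - (r + (1 - c) • (q - r)) = c • (q - r) := by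
      rw [sub_smul, one_smul]; abel
    refine ⟨r + (1 - c) • (q - r), ⟨hD.add_timelike_mem h.1 (h.2.1.smul (by linarith)), ?_⟩, ?_⟩
    · change FutureTimelike _
      rw [e]; exact h.2.1.smul hc
    · rw [e, mlen_smul hc.le]
  refine csSup_eq_of_forall_le_of_forall_lt_exists_gt ⟨_, key (1 / 2) (by norm_num) (by norm_num)⟩
    ?_ ?_
  · rintro l ⟨y, hy, rfl⟩
    have h1 := h.mlen_le (subset_closure hy.1) (q' := q) hy.2.causal
    rwa [neg_mink_self_div_mlen h.2.1] at h1
  · intro b hb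
    have hb1 : b / mlen (q - r) < 1 := (div_lt_one hpos).2 hb
    obtain ⟨c, hc, hc1⟩ := exists_between (max_lt hb1 (zero_lt_one (α := ℝ)))
    rw [max_lt_iff] at hc
    exact ⟨_, key c hc.2 hc1, (div_lt_iff₀ hpos).1 hc.1⟩

/-- A point at maximal Lorentzian distance in the past of `q` is the foot of `q`. -/
theorem isFoot_of_max (hD : IsDomainOfDependence D) {q r : Mink} (hr : r ∈ closure D)
    (hw : FutureTimelike (q - r))
    (hmax : ∀ y ∈ D ∩ chronPast q, -mink (q - y) (q - y) ≤ -mink (q - r) (q - r)) :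
    IsFoot D q r := by
  refine ⟨hr, hw, fun y hy => ?_⟩
  by_contra hlt
  push Not at hlt
  have h1 : ∀ᶠ t : ℝ in 𝓝 0, FutureTimelike (q - (r + t • (y - r))) := by
    have hc : Continuous fun t : ℝ => q - (r + t • (y - r)) := by fun_prop
    exact hc.tendsto 0 |>.eventually (isOpen_futureTimelike.mem_nhds (by simpa using hw))
  have h2 : ∀ᶠ t : ℝ in 𝓝 0, t * mink (y - r) (y - r) < 2 * mink (y - r) (q - r) := by
    have hc : Continuous fun t : ℝ => t * mink (y - r) (y - r) := by fun_prop
    exact hc.tendsto 0 |>.eventually (gt_mem_nhds (by simpa using hlt))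
  have h3 : ∀ᶠ t : ℝ in 𝓝 0, t < 1 := gt_mem_nhds zero_lt_one
  obtain ⟨t, ⟨⟨ht1, ht2⟩, ht3⟩, ht0⟩ :=
    ((((h1.and h2).and h3).filter_mono nhdsWithin_le_nhds).and
      (self_mem_nhdsWithin (s := Ioi (0 : ℝ)))).exists
  have ht0' : (0 : ℝ) < t := ht0
  have h4 := hmax _ ⟨hD.add_smul_sub_mem hr hy ht0' ht3.le, ht1⟩
  rw [show q - (r + t • (y - r)) = (q - r) - t • (y - r) by abel] at h4
  generalize q - r = w at *
  generalize y - r = h at *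
  simp only [mink_sub_left, mink_sub_right, mink_smul_left, mink_smul_right, mink_comm w h] at h4
  nlinarith

theorem exists_sub_mem (hD : IsDomainOfDependence D) {q : Mink} (hq : q ∈ D) {w : Mink} :
    ∃ t : ℝ, 0 < t ∧ q - t • w ∈ D := by
  have hc : Continuous fun t : ℝ => q - t • w := by fun_prop
  have h1 : ∀ᶠ t : ℝ in 𝓝 0, q - t • w ∈ D :=
    hc.tendsto 0 |>.eventually (hD.isOpen.mem_nhds (by simpa using hq))
  obtain ⟨t, ht, ht0⟩ := ((h1.filter_mono nhdsWithin_le_nhds).and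
    (self_mem_nhdsWithin (s := Ioi (0 : ℝ)))).exists
  exact ⟨t, ht0, ht⟩

theorem exists_isFoot (hD : IsDomainOfDependence D) {q : Mink} (hq : q ∈ D) :
    ∃ r, IsFoot D q r := by
  have hne : {y | y ∈ closure D ∧ FutureCausal (q - y)}.Nonempty :=
    ⟨q, subset_closure hq, by simp [FutureCausal]⟩
  obtain ⟨r, ⟨hr, hrq⟩, hmax⟩ := (hD.isCompact_past q).exists_isMaxOn hne
    (f := fun y => -mink (q - y) (q - y))
    (Continuous.continuousOn (by unfold mink; fun_prop))
  have hm : ∀ y ∈ D ∩ chronPast q, -mink (q - y) (q - y) ≤ -mink (q - r) (q - r) :=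
    fun y hy => hmax ⟨subset_closure hy.1, hy.2.causal⟩
  refine ⟨r, hD.isFoot_of_max hr ?_ hm⟩
  have he : FutureTimelike ![1, 0, 0] := by constructor <;> simp [mink]
  obtain ⟨t, ht, htD⟩ := hD.exists_sub_mem hq (w := ![1, 0, 0])
  have h1 := hm _ ⟨htD, by
    change FutureTimelike _
    rw [sub_sub_cancel]; exact he.smul ht⟩
  rw [sub_sub_cancel] at h1
  have h2 := (he.smul ht).1
  have h3 : mink (q - r) (q - r) < 0 := by linarith
  exact ⟨h3, hrq.pos_of_ne (by intro h0; rw [h0] at h3; simp at h3)⟩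

theorem mem_singularity_iff (hD : IsDomainOfDependence D) {r : Mink} :
    r ∈ singularity D ↔ ∃ q, IsFoot D q r := by
  constructor
  · rintro ⟨q, hq, ⟨hr, hrq⟩, h⟩
    obtain ⟨s, hs⟩ := hD.exists_isFoot hq
    refine ⟨q, hD.isFoot_of_max hr.1 hrq fun y hy => ?_⟩
    rw [hD.cosmoTime_eq hs] at h
    have h1 := hs.mlen_le (subset_closure hy.1) (q' := q) hy.2.causal
    rw [neg_mink_self_div_mlen hs.2.1, h] at h1
    rw [← mlen_sq hy.2.causal, ← mlen_sq hrq.causal]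
    exact pow_le_pow_left₀ (mlen_nonneg _) h1 2
  · rintro ⟨q, h⟩
    refine ⟨q, hD.mem_of_isFoot h, ⟨hD.mem_frontier_iff.2 ⟨h.1, fun hr => ?_⟩, h.2.1⟩,
      hD.cosmoTime_eq h⟩
    obtain ⟨t, ht, htD⟩ := hD.exists_sub_mem hr (w := q - r)
    have h1 := h.2.2 _ htD
    rw [show r - t • (q - r) - r = -(t • (q - r)) by abel, mink_neg_left, mink_smul_left] at h1
    nlinarith [h.2.1.1]

end IsDomainOfDependence

/-- The foot of `q`, for `q` in a domain of dependence (and a junk value elsewhere). -/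
def foot (D : Set Mink) (q : Mink) : Mink := Classical.epsilon (IsFoot D q)

namespace IsDomainOfDependence

variable {D : Set Mink}

theorem isFoot_foot (hD : IsDomainOfDependence D) {q : Mink} (hq : q ∈ D) :
    IsFoot D q (foot D q) :=
  Classical.epsilon_spec (hD.exists_isFoot hq)

theorem foot_eq (hD : IsDomainOfDependence D) {q r : Mink} (h : IsFoot D q r) : foot D q = r :=
  (hD.isFoot_foot (hD.mem_of_isFoot h)).unique h

theorem foot_mem_singularity (hD : IsDomainOfDependence D) {q : Mink} (hq : q ∈ D) :
    foot D q ∈ singularity D :=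
  hD.mem_singularity_iff.2 ⟨q, hD.isFoot_foot hq⟩

theorem mlen_le_cosmoTime (hD : IsDomainOfDependence D) {q y : Mink} (hy : y ∈ closure D)
    (h : FutureTimelike (q - y)) : mlen (q - y) ≤ cosmoTime D q := by
  have hf := hD.isFoot_foot (hD.mem_of_timelike hy h)
  rw [hD.cosmoTime_eq hf]
  have := hf.mlen_le hy (q' := q) h.causal
  rwa [neg_mink_self_div_mlen hf.2.1] at this

theorem tendsto_foot (hD : IsDomainOfDependence D) {q : Mink} (hq : q ∈ D) :
    Tendsto (foot D) (𝓝 q) (𝓝 (foot D q)) := by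
  obtain ⟨S, hS, hS'⟩ := hD.exists_compact_past q
  have hqD : ∀ᶠ x in 𝓝 q, x ∈ D := hD.isOpen.mem_nhds hq
  refine hS.tendsto_nhds_of_unique_mapClusterPt ?_ ?_
  · filter_upwards [hS', hqD] with x hx hxD
    exact hx _ (hD.isFoot_foot hxD).1 (hD.isFoot_foot hxD).2.1.causal
  · intro r _ hr
    obtain ⟨U, hU, hUr⟩ := mapClusterPt_iff_ultrafilter.1 hr
    have hUq : Tendsto id (U : Filter Mink) (𝓝 q) := hU
    have hw : Tendsto (fun x => x - foot D x) (U : Filter Mink) (𝓝 (q - r)) := hUq.sub hUr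
    have hf : ∀ᶠ x in (U : Filter Mink), IsFoot D x (foot D x) :=
      (hqD.filter_mono hU).mono fun x hx => hD.isFoot_foot hx
    have hrD : r ∈ closure D := isClosed_closure.mem_of_tendsto hUr (hf.mono fun x hx => hx.1)
    have hc : FutureCausal (q - r) :=
      isClosed_futureCausal.mem_of_tendsto hw (hf.mono fun x hx => hx.2.1.causal)
    -- The limit stays timelike because the squared length is bounded below near `q`.
    have hlt : mink (q - r) (q - r) < 0 := by
      have he : FutureTimelike ![1, 0, 0] := by constructor <;> simp [mink]
      obtain ⟨t, ht, htD⟩ := hD.exists_sub_mem hq (w := ![1, 0, 0])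
      set y := q - t • (![1, 0, 0] : Mink) with hy
      have hqy : FutureTimelike (q - y) := by rw [hy, sub_sub_cancel]; exact he.smul ht
      have hxy : Tendsto (fun x => x - y) (U : Filter Mink) (𝓝 (q - y)) := hUq.sub_const y
      have h1 : mink (q - r) (q - r) ≤ mink (q - y) (q - y) := by
        refine le_of_tendsto_of_tendsto (tendsto_mink hw hw) (tendsto_mink hxy hxy) ?_
        filter_upwards [hf, hxy.eventually (isOpen_futureTimelike.mem_nhds hqy)] with x hx hx'
        have h2 := hx.mlen_le (subset_closure htD) (q' := x) hx'.causal
        rw [neg_mink_self_div_mlen hx.2.1] at h2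
        have h3 := pow_le_pow_left₀ (mlen_nonneg _) h2 2
        rw [mlen_sq hx'.causal, mlen_sq hx.2.1.causal] at h3
        linarith
      exact h1.trans_lt hqy.1
    refine (hD.foot_eq ⟨hrD, ⟨hlt, hc.pos_of_ne ?_⟩, fun y hy => ?_⟩).symm
    · intro h0; rw [h0] at hlt; simp at hlt
    · refine le_of_tendsto (tendsto_mink (hUr.const_sub y) hw) ?_
      filter_upwards [hf] with x hx using hx.2.2 y hy

theorem continuousOn_foot (hD : IsDomainOfDependence D) : ContinuousOn (foot D) D :=
  fun _ hq => (hD.tendsto_foot hq).mono_left nhdsWithin_le_nhds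

/-! ### The gradient of the cosmological time -/

theorem hasFDerivAt_cosmoTime (hD : IsDomainOfDependence D) {q r : Mink} (h : IsFoot D q r) :
    ∃ L : Mink →L[ℝ] ℝ, HasFDerivAt (cosmoTime D) L q ∧
      ∀ x, L x = -mink x (q - r) / mlen (q - r) := by
  set w := q - r with hw
  have hpos := mlen_pos h.2.1
  let M : Mink →ₗ[ℝ] ℝ :=
    { toFun := fun x => -mink x w / mlen w
      map_add' := fun x y => by simp only [mink_add_left]; ring
      map_smul' := fun c x => by simp only [mink_smul_left, RingHom.id_apply, smul_eq_mul]; ring }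
  have hM : ∀ x, LinearMap.toContinuousLinearMap M x = -mink x w / mlen w := fun x => rfl
  refine ⟨LinearMap.toContinuousLinearMap M, ?_, hM⟩
  set L := LinearMap.toContinuousLinearMap M
  -- The lower barrier `mlen (· - r)` has the same derivative.
  have hf : HasFDerivAt (fun x : Mink => mlen (x - r)) L q := by
    have hp : ∀ i : Fin 3, HasFDerivAt (fun x : Mink => (x - r) i)
        (ContinuousLinearMap.proj i : Mink →L[ℝ] ℝ) q := fun i => by
      simpa using ((ContinuousLinearMap.proj i : Mink →L[ℝ] ℝ).hasFDerivAt (x := q)).sub_const (r i)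
    have hne : -mink (q - r) (q - r) ≠ 0 := by have := h.2.1.1; linarith
    have h2 := (((((hp 0).mul (hp 0)).neg.add ((hp 1).mul (hp 1))).add
      ((hp 2).mul (hp 2))).neg.sqrt (by simpa [mink] using hne))
    refine (h2.congr_fderiv ?_)
    ext x
    rw [hM]
    have e : -((q 2 - r 2) * (q 2 - r 2)) + (-((q 1 - r 1) * (q 1 - r 1))
        + (q 0 - r 0) * (q 0 - r 0)) = -mink w w := by
      simp only [mink, hw, Pi.sub_apply]; ring
    simp [e]
    rw [← mlen, div_eq_inv_mul]
    simp only [mink, hw, Pi.sub_apply]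
    ring
  have h1 : ∀ᶠ x in 𝓝 q, FutureTimelike (x - r) := by
    have hc : Continuous fun x : Mink => x - r := by fun_prop
    exact hc.tendsto q |>.eventually (isOpen_futureTimelike.mem_nhds h.2.1)
  have h2 : ∀ᶠ x in 𝓝 q, x ∈ D := hD.isOpen.mem_nhds (hD.mem_of_isFoot h)
  refine HasFDerivAt.of_isLittleO (Asymptotics.IsBigO.trans_isLittleO (g := fun x : Mink =>
    mlen (x - r) - mlen (q - r) - L (x - q)) ?_ hf.isLittleO)
  refine Asymptotics.IsBigO.of_bound 1 ?_
  filter_upwards [h1, h2] with x hx hxD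
  have h3 := hD.mlen_le_cosmoTime h.1 hx
  have hfx := hD.isFoot_foot hxD
  have h4 := h.mlen_le hfx.1 hfx.2.1.causal
  rw [← hD.cosmoTime_eq hfx] at h4
  have h5 : -mink (x - r) w / mlen w = mlen w + L (x - q) := by
    rw [hM, show x - r = w + (x - q) by rw [hw]; abel, mink_add_left, neg_add, add_div,
      neg_mink_self_div_mlen h.2.1]
  rw [← hw, h5] at h4
  rw [hD.cosmoTime_eq h, one_mul, Real.norm_eq_abs, Real.norm_eq_abs, ← hw,
    abs_of_nonpos (by linarith), abs_of_nonpos (by linarith)]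
  linarith

/-- The unit normal of the level surface at `q` points from the foot of `q` to `q`. -/
theorem unitNormal_eq (hD : IsDomainOfDependence D) {q r : Mink} (h : IsFoot D q r) :
    unitNormal D q = (mlen (q - r))⁻¹ • (q - r) := by
  obtain ⟨L, hL, hLe⟩ := hD.hasFDerivAt_cosmoTime h
  have hpos := mlen_pos h.2.1
  have hg : mgrad (cosmoTime D) q = -((mlen (q - r))⁻¹ • (q - r)) := by
    rw [mgrad, hL.fderiv, hLe, hLe, hLe]
    funext i
    fin_cases i
    · simp [mink, div_eq_inv_mul]
    · simp [mink, div_eq_inv_mul]; ring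
    · simp [mink, div_eq_inv_mul]; ring
  have hm : mlen (mgrad (cosmoTime D) q) = 1 := by
    have e : mlen (mgrad (cosmoTime D) q) = mlen ((mlen (q - r))⁻¹ • (q - r)) := by
      rw [hg]; unfold mlen; rw [mink_neg_left, mink_neg_right, neg_neg]
    rw [e, mlen_smul (inv_pos.2 hpos).le, inv_mul_cancel₀ hpos.ne']
  rw [unitNormal, hm, hg, inv_one, one_smul, neg_neg]

end IsDomainOfDependence

/-! ### The intensity as the height above the singularity -/

/-- The lightlike segment from `q` in the past direction `-n` inside `∂D` has its past endpoint
at `q - b • n`; the case `b = 0` of a segment reduced to `q` is allowed. -/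
def IsRayStart (D : Set Mink) (q n : Mink) (b : ℝ) : Prop :=
  n ∈ nullNormals D q ∧ 0 ≤ b ∧ q - b • n ∈ closure D ∧ ∀ c : ℝ, q - c • n ∈ closure D → c ≤ b

theorem mlen_hyp_smul {v : Mink} (hv : v ∈ hyp) {c : ℝ} (hc : 0 ≤ c) : mlen (c • v) = c := by
  rw [mlen_smul hc, mlen, hv.1, neg_neg, Real.sqrt_one, mul_one]

theorem continuous_mlen : Continuous mlen := by unfold mlen; fun_prop

theorem causal_eq_smul_of_nullNormal {D : Set Mink} {q n y : Mink} (hn : n ∈ nullNormals D q)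
    (hy : y ∈ closure D) (hc : FutureCausal (q - y)) : q - y = (q - y) 0 • n := by
  refine hc.eq_smul_of_orth hn.1 (le_antisymm (hc.mink_nonpos (dirs_causal hn.1)) ?_)
  have := mink_sub_le_of_mem_closure hn.2 hy
  rw [show q - y = -(y - q) by abel, mink_neg_left]
  linarith

theorem IsRayStart.mem_closure {D : Set Mink} (hD : IsDomainOfDependence D) {q n : Mink} {b : ℝ}
    (h : IsRayStart D q n b) : q ∈ closure D := by
  have := hD.add_mem_closure h.2.2.1 ((dirs_causal h.1.1).smul h.2.1)
  rwa [sub_add_cancel] at this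

namespace IsDomainOfDependence

variable {D : Set Mink}

theorem exists_isRayStart (hD : IsDomainOfDependence D) {q : Mink} (hq : q ∈ frontier D) :
    ∃ n b, IsRayStart D q n b := by
  obtain ⟨hqc, hqD⟩ := hD.mem_frontier_iff.1 hq
  obtain ⟨n, hn⟩ := hD.exists_nullNormal hqD
  have hne : {y | y ∈ closure D ∧ FutureCausal (q - y)}.Nonempty :=
    ⟨q, hqc, by simp [FutureCausal]⟩
  obtain ⟨r, ⟨hr, hrq⟩, hmax⟩ := (hD.isCompact_past q).exists_isMaxOn hne
    (f := fun y => (q - y) 0) (Continuous.continuousOn (by fun_prop))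
  have h1 := causal_eq_smul_of_nullNormal hn hr hrq
  refine ⟨n, (q - r) 0, hn, hrq.2, by rwa [← h1, sub_sub_cancel], fun c hc => ?_⟩
  rcases le_total c 0 with h0 | h0
  · exact h0.trans hrq.2
  · have h2 : (q - (q - c • n)) 0 ≤ (q - r) 0 := hmax ⟨hc, by
      rw [sub_sub_cancel]; exact (dirs_causal hn.1).smul h0⟩
    rw [sub_sub_cancel] at h2
    simpa [hn.1.2] using h2

/-- The foot of a point above `q` is at least as low as the past endpoint of the lightlike
segment through `q`. That endpoint has squared distance at least `2 b δ |⟨n, v⟩|` from `q + δ • v`,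
and the foot is at least as far away; by `neg_mink_self_le`, a vector `w` from `D` with
`-⟨w, n⟩ ≤ δ |⟨n, v⟩|` is that long only if its height is at least `b |⟨n, v⟩|`. -/
theorem height_foot_ge {q n v s : Mink} {b δ : ℝ} (hv : v ∈ hyp)
    (h : IsRayStart D q n b) (hδ : 0 < δ) (hs : IsFoot D (q + δ • v) s) :
    b * -mink n v ≤ -mink (q + δ • v - s) v := by
  obtain ⟨hn, hb, hr, -⟩ := h
  have hk : 0 < -mink n v := neg_pos.2 ((hyp_timelike hv).mink_dirs_neg hn.1)
  set w := q + δ • v - s with hw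
  have e : q + δ • v - (q - b • n) = δ • v + b • n := by abel
  have hT : FutureTimelike (q + δ • v - (q - b • n)) := by
    rw [e]; exact ((hyp_timelike hv).smul hδ).add ((dirs_causal hn.1).smul hb)
  have h1 := hs.mlen_le hr hT.causal
  rw [neg_mink_self_div_mlen hs.2.1] at h1
  have h2 := pow_le_pow_left₀ (mlen_nonneg _) h1 2
  rw [mlen_sq hT.causal, mlen_sq hs.2.1.causal, e, ← hw] at h2
  simp only [mink_add_left, mink_add_right, mink_smul_left, mink_smul_right, mink_comm v n,
    hn.1.1.1, hv.1] at h2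
  have h3 := neg_mink_self_le (w := w) hn.1 hv
  have h4 : -mink w n ≤ δ * -mink n v := by
    have := mink_sub_le_of_mem_closure hn.2 hs.1
    simp only [hw, mink_sub_left, mink_add_left, mink_smul_left, mink_comm v n] at *
    linarith
  have h5 : 0 ≤ -mink w v := by
    have := hs.2.1.causal.mink_nonpos (hyp_timelike hv).causal
    linarith
  have h6 : 2 * (b * δ * -mink n v) * -mink n v ≤ 2 * (δ * -mink n v * -mink w v) := by
    calc 2 * (b * δ * -mink n v) * -mink n v ≤ -mink w w * -mink n v := by
          refine mul_le_mul_of_nonneg_right ?_ hk.le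
          nlinarith
      _ ≤ 2 * (mink w n * mink w v) := h3
      _ = 2 * (-mink w n * -mink w v) := by ring
      _ ≤ _ := by gcongr
  have h7 : 0 < 2 * (δ * -mink n v) := by positivity
  refine le_of_mul_le_mul_left ?_ h7
  linarith

/-- As points descend vertically to boundary points `Q i → q`, their feet tend to the past
endpoint of the lightlike segment through `q`, provided that the heights converge. -/
theorem tendsto_foot_of_height (hD : IsDomainOfDependence D) {ι : Type*} {F : Filter ι}
    {Q N : ι → Mink} {β δ : ι → ℝ} {q n v : Mink} {b : ℝ} (hv : v ∈ hyp)
    (hQ : Tendsto Q F (𝓝 q)) (hδ : Tendsto δ F (𝓝 0)) (hδ0 : ∀ᶠ i in F, 0 < δ i)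
    (hi : ∀ᶠ i in F, IsRayStart D (Q i) (N i) (β i)) (hq : IsRayStart D q n b)
    (hβ : Tendsto (fun i => β i * -mink (N i) v) F (𝓝 (b * -mink n v))) :
    Tendsto (fun i => foot D (Q i + δ i • v)) F (𝓝 (q - b • n)) := by
  have hk : 0 < -mink n v := neg_pos.2 ((hyp_timelike hv).mink_dirs_neg hq.1.1)
  obtain ⟨S, hS, hS'⟩ := hD.exists_compact_past q
  have hX : Tendsto (fun i => Q i + δ i • v) F (𝓝 q) := by
    simpa using hQ.add (hδ.smul_const v)
  have hf : ∀ᶠ i in F, IsFoot D (Q i + δ i • v) (foot D (Q i + δ i • v)) := by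
    filter_upwards [hδ0, hi] with i h0 h1
    exact hD.isFoot_foot (hD.add_timelike_mem (IsRayStart.mem_closure hD h1)
      ((hyp_timelike hv).smul h0))
  refine hS.tendsto_nhds_of_unique_mapClusterPt ?_ ?_
  · filter_upwards [hX.eventually hS', hf] with i h1 h2
    exact h1 _ h2.1 h2.2.1.causal
  · intro s _ hs
    obtain ⟨U, hU, hUs⟩ := mapClusterPt_iff_ultrafilter.1 hs
    have hw := (hX.mono_left hU).sub hUs
    have hfU := hf.filter_mono hU
    have hsD : s ∈ closure D := isClosed_closure.mem_of_tendsto hUs (hfU.mono fun x hx => hx.1)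
    have hc : FutureCausal (q - s) :=
      isClosed_futureCausal.mem_of_tendsto hw (hfU.mono fun x hx => hx.2.1.causal)
    have h1 : b * -mink n v ≤ -mink (q - s) v := by
      refine le_of_tendsto_of_tendsto (hβ.mono_left hU)
        (tendsto_mink hw tendsto_const_nhds).neg ?_
      filter_upwards [hfU, hδ0.filter_mono hU, hi.filter_mono hU] with i h1 h2 h3
      exact height_foot_ge hv h3 h2 h1
    have h2 := causal_eq_smul_of_nullNormal hq.1 hsD hc
    rw [h2, mink_smul_left, ← mul_neg] at h1
    have h3 := le_of_mul_le_mul_right h1 hk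
    have h4 := hq.2.2.2 _ (by rwa [← h2, sub_sub_cancel])
    rw [← le_antisymm h4 h3, ← h2, sub_sub_cancel]

theorem tendsto_foot_vertical (hD : IsDomainOfDependence D) {q n v : Mink} {b : ℝ} (hv : v ∈ hyp)
    (h : IsRayStart D q n b) :
    Tendsto (fun δ : ℝ => foot D (q + δ • v)) (𝓝[>] 0) (𝓝 (q - b • n)) :=
  hD.tendsto_foot_of_height (Q := fun _ => q) (N := fun _ => n) (β := fun _ => b) hv
    tendsto_const_nhds (tendsto_id.mono_left nhdsWithin_le_nhds) self_mem_nhdsWithin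
    (Eventually.of_forall fun _ => h) h tendsto_const_nhds

theorem projPerp_add (v q : Mink) (s : ℝ) :
    projPerp v q + s • v = q + (mink q v + s) • v := by
  rw [projPerp, add_smul, add_assoc]

/-- The rescaled intensity at `q ∈ ∂D` is the height of `q` above the past endpoint of the
lightlike segment through `q` in `∂D`. -/
theorem iota_eq (hD : IsDomainOfDependence D) {q n v : Mink} {b : ℝ} (hv : v ∈ hyp)
    (h : IsRayStart D q n b) : iota D v (projPerp v q) = b * -mink n v := by
  have hqc := IsRayStart.mem_closure hD h
  have hqD : q ∉ D := hD.notMem_of_nullNormal h.1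
  have hvt := hyp_timelike hv
  have hmem : ∀ {δ : ℝ}, 0 < δ → q + δ • v ∈ D := fun hδ =>
    hD.add_timelike_mem hqc (hvt.smul hδ)
  have hmem' : ∀ {δ : ℝ}, q + δ • v ∈ D → 0 < δ := fun {δ} hδ => by
    by_contra hle
    push Not at hle
    have := hD.add_mem hδ (hvt.causal.smul (c := -δ) (by linarith))
    rw [add_assoc, ← add_smul, add_neg_cancel, zero_smul, add_zero] at this
    exact hqD this
  set τ : ℝ → ℝ := fun δ => cosmoTime D (q + δ • v) with hτ
  have hcont : ContinuousOn τ (Ioi 0) := by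
    intro δ hδ
    obtain ⟨L, hL, -⟩ := hD.hasFDerivAt_cosmoTime (hD.isFoot_foot (hmem hδ))
    have hc : Continuous fun δ : ℝ => q + δ • v := by fun_prop
    exact (ContinuousAt.comp (f := fun δ : ℝ => q + δ • v) hL.continuousAt
      hc.continuousAt).continuousWithinAt
  have hge : ∀ δ, 0 < δ → δ ≤ τ δ := fun δ hδ => by
    have := hD.mlen_le_cosmoTime (q := q + δ • v) hqc (by
      rw [add_sub_cancel_left]; exact hvt.smul hδ)
    rwa [add_sub_cancel_left, mlen_hyp_smul hv hδ.le] at this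
  have hfoot := hD.tendsto_foot_vertical hv h
  have hline : Tendsto (fun δ : ℝ => q + δ • v) (𝓝[>] 0) (𝓝 q) := by
    have hc : Continuous fun δ : ℝ => q + δ • v := by fun_prop
    have := hc.tendsto 0
    rw [zero_smul, add_zero] at this
    exact this.mono_left nhdsWithin_le_nhds
  have hw : Tendsto (fun δ : ℝ => q + δ • v - foot D (q + δ • v)) (𝓝[>] 0) (𝓝 (b • n)) := by
    have := hline.sub hfoot
    rwa [sub_sub_cancel] at this
  have hzero : Tendsto τ (𝓝[>] 0) (𝓝 0) := by
    have h1 := (continuous_mlen.tendsto _).comp hw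
    have h2 : mlen (b • n) = 0 := by simp [mlen, h.1.1.1.1]
    rw [h2] at h1
    refine h1.congr' ?_
    filter_upwards [self_mem_nhdsWithin] with δ hδ
    exact (hD.cosmoTime_eq (hD.isFoot_foot (hmem hδ))).symm
  have hmono : ∀ δ δ', 0 < δ → δ < δ' → τ δ < τ δ' := fun δ δ' hδ hlt => by
    have hf := hD.isFoot_foot (hmem hδ)
    set r := foot D (q + δ • v)
    have e : q + δ' • v - r = (q + δ • v - r) + (δ' - δ) • v := by
      rw [sub_smul]; abel
    have hT : FutureTimelike (q + δ' • v - r) := by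
      rw [e]; exact hf.2.1.add (hvt.causal.smul (by linarith))
    refine lt_of_lt_of_le ?_ (hD.mlen_le_cosmoTime hf.1 hT)
    rw [hτ]
    simp only
    rw [hD.cosmoTime_eq hf]
    refine Real.sqrt_lt_sqrt (by linarith [hf.2.1.1]) ?_
    rw [e]
    have h1 := hf.2.1.causal.mink_nonpos hvt.causal
    generalize q + δ • v - r = w at *
    simp only [mink_add_left, mink_add_right, mink_smul_left, mink_smul_right, hv.1, mink_comm v w]
    nlinarith [sub_pos.2 hlt]
  have hex : ∀ ε : ℝ, 0 < ε → ∃ δ, 0 < δ ∧ τ δ = ε := fun ε hε => by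
    obtain ⟨δ, hδ, hδ0⟩ := ((hzero.eventually (gt_mem_nhds hε)).and self_mem_nhdsWithin).exists
    have hδ0' : 0 < δ := hδ0
    have hle : δ ≤ ε := (hge δ hδ0).trans hδ.le
    obtain ⟨c, hc, hc'⟩ := intermediate_value_Icc hle
      (hcont.mono fun x hx => lt_of_lt_of_le hδ0' hx.1) ⟨hδ.le, hge ε hε⟩
    exact ⟨c, lt_of_lt_of_le hδ0' hc.1, hc'⟩
  choose! Δ hΔ0 hΔ using hex
  have hΔlim : Tendsto Δ (𝓝[>] 0) (𝓝[>] 0) := by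
    refine tendsto_nhdsWithin_iff.2 ⟨?_, ?_⟩
    · refine tendsto_of_tendsto_of_tendsto_of_le_of_le' tendsto_const_nhds
        (tendsto_id.mono_left nhdsWithin_le_nhds) ?_ ?_
      · filter_upwards [self_mem_nhdsWithin] with ε hε using (hΔ0 ε hε).le
      · filter_upwards [self_mem_nhdsWithin] with ε hε
        exact (hge _ (hΔ0 ε hε)).trans (hΔ ε hε).le
    · filter_upwards [self_mem_nhdsWithin] with ε hε using hΔ0 ε hε
  have hiota : ∀ ε : ℝ, 0 < ε → iotaEps D v ε (projPerp v q)
      = -mink (q + Δ ε • v - foot D (q + Δ ε • v)) v := fun ε hε => by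
    have hset : {s : ℝ | projPerp v q + s • v ∈ levelSurface D ε} = {Δ ε - mink q v} := by
      ext s
      simp only [mem_ofPred_eq, mem_singleton_iff, levelSurface, projPerp_add]
      constructor
      · rintro ⟨h1, h2⟩
        have h3 := hmem' h1
        rcases lt_trichotomy (mink q v + s) (Δ ε) with h4 | h4 | h4
        · have := hmono _ _ h3 h4
          rw [hΔ ε hε] at this
          exact absurd h2 this.ne
        · linarith
        · have := hmono _ _ (hΔ0 ε hε) h4
          rw [hΔ ε hε] at this
          exact absurd h2 this.ne'
      · rintro rfl
        rw [add_sub_cancel]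
        exact ⟨hmem (hΔ0 ε hε), hΔ ε hε⟩
    have hlev : levelHeight D v ε (projPerp v q) = Δ ε - mink q v := by
      rw [levelHeight, hset, csInf_singleton]
    have hf := hD.isFoot_foot (hmem (hΔ0 ε hε))
    have hm : mlen (q + Δ ε • v - foot D (q + Δ ε • v)) = ε := by
      rw [← hD.cosmoTime_eq hf]; exact hΔ ε hε
    rw [iotaEps, hlev, projPerp_add, add_sub_cancel, hD.unitNormal_eq hf, hm, mink_smul_left,
      ← mul_assoc, neg_mul, mul_inv_cancel₀ hε.ne', neg_one_mul]
  refine Tendsto.limUnder_eq ?_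
  have h1 := (tendsto_mink (hw.comp hΔlim) (tendsto_const_nhds (x := v))).neg
  rw [mink_smul_left, ← mul_neg] at h1
  refine h1.congr' ?_
  filter_upwards [self_mem_nhdsWithin] with ε hε
  exact (hiota ε hε).symm

end IsDomainOfDependence

/-! ### The cone of null directions at a point of the singularity -/

/-- The direction from the foot `r` to `q` lies in the bidual of the null directions at `r`:
otherwise `r` could be moved inside `D` across the support plane at `r`. -/
theorem IsFoot.mink_nonpos {D : Set Mink} (hD : IsDomainOfDependence D) {q r z : Mink}
    (h : IsFoot D q r) (hz : ∀ n ∈ nullNormals D r, mink z n ≤ 0) : mink z (q - r) ≤ 0 := by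
  -- A strict version, by compactness of the circle of directions.
  have key : ∀ z : Mink, (∀ n ∈ nullNormals D r, mink z n < 0) → mink z (q - r) ≤ 0 := by
    intro z h1
    have h3 : ∀ᶠ t : ℝ in 𝓝[>] 0, r + t • z ∈ D := by
      by_contra hfr
      rw [not_eventually] at hfr
      obtain ⟨t, ht, htD⟩ := exists_seq_forall_of_frequently hfr
      choose n hn hn' using fun k => hD.exists_separating (htD k)
      obtain ⟨m, hm, φ, hφ, hlim⟩ := isCompact_dirs.tendsto_subseq hn
      have ht' := ht.comp hφ.tendsto_atTop
      have ht0 : Tendsto (t ∘ φ) atTop (𝓝 0) := ht'.mono_right nhdsWithin_le_nhds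
      have htz : Tendsto (fun k => r + (t ∘ φ) k • z) atTop (𝓝 r) := by
        simpa using (ht0.smul_const z).const_add r
      have hmr : m ∈ nullNormals D r := by
        refine ⟨hm, fun y hy => le_of_tendsto (tendsto_mink (htz.const_sub y) hlim) ?_⟩
        exact Eventually.of_forall fun k => (hn' _ y hy).le
      refine (h1 m hmr).not_ge (ge_of_tendsto (tendsto_mink tendsto_const_nhds hlim) ?_)
      filter_upwards [ht'.eventually self_mem_nhdsWithin] with k hk
      have h5 := mink_sub_le_of_mem_closure (fun y hy => (hn' (φ k) y hy).le) h.1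
      rw [sub_add_cancel_left, mink_neg_left, mink_smul_left] at h5
      have h6 : 0 < t (φ k) := hk
      rw [Function.comp_apply]
      by_contra h7
      push Not at h7
      nlinarith
    obtain ⟨t, ht, ht0⟩ := (h3.and self_mem_nhdsWithin).exists
    have h4 := h.2.2 _ ht
    rw [add_sub_cancel_left, mink_smul_left] at h4
    have ht0' : 0 < t := ht0
    by_contra h5
    push Not at h5
    nlinarith [mul_pos ht0' h5]
  have he : FutureTimelike ![1, 0, 0] := by constructor <;> simp [mink]
  have hlim : Tendsto (fun η : ℝ => mink (z + η • ![1, 0, 0]) (q - r)) (𝓝[>] 0)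
      (𝓝 (mink z (q - r))) := by
    have hc : Continuous fun η : ℝ => mink (z + η • ![1, 0, 0]) (q - r) := by fun_prop
    have := hc.tendsto 0
    rw [zero_smul, add_zero] at this
    exact this.mono_left nhdsWithin_le_nhds
  refine le_of_tendsto hlim ?_
  filter_upwards [self_mem_nhdsWithin] with η hη
  refine key _ fun n hn => ?_
  have h1 := he.mink_dirs_neg hn.1
  rw [mink_comm] at h1
  rw [mink_add_left, mink_smul_left]
  have hη' : 0 < η := hη
  nlinarith [hz n hn, mul_neg_of_pos_of_neg hη' h1]

theorem IsFoot.nullNormals_nontrivial {D : Set Mink} (hD : IsDomainOfDependence D) {q r : Mink}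
    (h : IsFoot D q r) : (nullNormals D r).Nontrivial := by
  by_contra hn
  rw [Set.not_nontrivial_iff] at hn
  rcases (nullNormals D r).eq_empty_or_nonempty with h0 | ⟨n, hn'⟩
  · have := h.mink_nonpos hD (z := -(q - r)) (by simp [h0])
    rw [mink_neg_left] at this
    linarith [h.2.1.1]
  · have := h.mink_nonpos hD (z := -n) fun m hm => by
      rw [hn hm hn', mink_neg_left, hn'.1.1.1, neg_zero]
    rw [mink_neg_left] at this
    linarith [h.2.1.mink_dirs_neg hn'.1]

/-- Distinct points of the singularity are not causally related. -/
theorem eq_of_causal_of_isFoot {D : Set Mink} (hD : IsDomainOfDependence D) {q s c : Mink}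
    (h : IsFoot D q s) (hc : c ∈ closure D) (hsc : FutureCausal (s - c)) : s = c := by
  obtain ⟨n, hn, m, hm, hnm⟩ := h.nullNormals_nontrivial hD
  have h1 := causal_eq_smul_of_nullNormal hn hc hsc
  have h2 := causal_eq_smul_of_nullNormal hm hc hsc
  by_contra hne
  have h0 := hsc.pos_of_ne (sub_ne_zero.2 hne)
  exact hnm (smul_right_injective Mink h0.ne' (h1.symm.trans h2))

theorem dirs_eq_or_eq_of_orth_perp {n m x : Mink} (hn : n ∈ dirs) (hm : m ∈ dirs) (h : n ≠ m)
    (hx : x ∈ dirs) (hp : mink x (perp n m) = 0) : x = n ∨ x = m := by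
  have hk := (dirs_mink_neg hn hm h).ne
  have hd := dirs_decomposition hn hm h x
  rw [hp, zero_div, zero_smul, add_zero] at hd
  have hxx : mink x x = 0 := hx.1.1
  rw [hd] at hxx
  simp only [mink_add_left, mink_add_right, mink_smul_left, mink_smul_right, hn.1.1, hm.1.1,
    mink_comm m n] at hxx
  have h3 : (mink x m / mink n m) * (mink x n / mink n m) = 0 := by
    have : 2 * mink n m * ((mink x m / mink n m) * (mink x n / mink n m)) = 0 := by linarith
    rcases mul_eq_zero.1 this with h | h
    · exact absurd h (mul_ne_zero two_ne_zero hk)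
    · exact h
  rcases mul_eq_zero.1 h3 with h | h
  · rw [div_eq_zero_iff, or_iff_left hk] at h
    exact Or.inr (dirs_eq_of_orth hx hm h)
  · rw [div_eq_zero_iff, or_iff_left hk] at h
    exact Or.inl (dirs_eq_of_orth hx hn h)

/-! ### Edges of the singularity -/

/-- `s` is an interior point of a segment in the singularity, with null directions `n` and `m`.
The segment is orthogonal to `n` and `m`, so its direction is `perp n m`. -/
def IsEdgePoint (D : Set Mink) (s n m : Mink) : Prop :=
  n ∈ nullNormals D s ∧ m ∈ nullNormals D s ∧ n ≠ m ∧
    ∃ ε > 0, ∀ t : ℝ, |t| ≤ ε → s + t • perp n m ∈ closure D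

theorem perp_swap (n m : Mink) : perp m n = -perp n m := by
  funext i; fin_cases i
  · simp [perp]; ring
  · simp [perp]
  · simp [perp]

theorem IsEdgePoint.symm {D : Set Mink} {s n m : Mink} (h : IsEdgePoint D s n m) :
    IsEdgePoint D s m n := by
  obtain ⟨hn, hm, hnm, ε, hε, he⟩ := h
  refine ⟨hm, hn, hnm.symm, ε, hε, fun t ht => ?_⟩
  rw [perp_swap, smul_neg, ← neg_smul]
  exact he _ (by rwa [abs_neg])

theorem IsEdgePoint.mem_closure {D : Set Mink} {s n m : Mink} (h : IsEdgePoint D s n m) :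
    s ∈ closure D := by
  obtain ⟨-, -, -, ε, hε, he⟩ := h
  simpa using he 0 (by simpa using hε.le)

theorem IsEdgePoint.eq_or_eq {D : Set Mink} {s n m x : Mink} (h : IsEdgePoint D s n m)
    (hx : x ∈ nullNormals D s) : x = n ∨ x = m := by
  obtain ⟨hn, hm, hnm, ε, hε, he⟩ := h
  refine dirs_eq_or_eq_of_orth_perp hn.1 hm.1 hnm hx.1 ?_
  have h1 := mink_sub_le_of_mem_closure hx.2 (he ε (by rw [abs_of_pos hε]))
  have h2 := mink_sub_le_of_mem_closure hx.2 (he (-ε) (by rw [abs_neg, abs_of_pos hε]))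
  rw [add_sub_cancel_left, mink_smul_left, mink_comm] at h1 h2
  nlinarith

theorem IsEdgePoint.nullNormals_eq {D : Set Mink} {s n m : Mink} (h : IsEdgePoint D s n m) :
    nullNormals D s = {n, m} := by
  ext x
  refine ⟨fun hx => h.eq_or_eq hx, ?_⟩
  rintro (rfl | rfl)
  exacts [h.1, h.2.1]

/-- Interior points of a segment in `closure D` that are feet are edge points. -/
theorem IsFoot.exists_isEdgePoint {D : Set Mink} (hD : IsDomainOfDependence D) {q s a b : Mink}
    (h : IsFoot D q s) (ha : a ∈ closure D) (hb : b ∈ closure D) {t : ℝ} (ht0 : 0 < t)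
    (ht1 : t < 1) (hab : a ≠ b) (hs : s = a + t • (b - a)) :
    ∃ n m, IsEdgePoint D s n m ∧ ∃ c : ℝ, c ≠ 0 ∧ b - a = c • perp n m := by
  obtain ⟨n, hn, m, hm, hnm⟩ := h.nullNormals_nontrivial hD
  have key : ∀ x ∈ nullNormals D s, mink (b - a) x = 0 := fun x hx => by
    have h1 := mink_sub_le_of_mem_closure hx.2 ha
    have h2 := mink_sub_le_of_mem_closure hx.2 hb
    rw [hs, show a - (a + t • (b - a)) = (-t) • (b - a) by rw [neg_smul]; abel,
      mink_smul_left] at h1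
    rw [hs, show b - (a + t • (b - a)) = (1 - t) • (b - a) by rw [sub_smul, one_smul]; abel,
      mink_smul_left] at h2
    nlinarith
  obtain ⟨c, hc⟩ := orth_dirs_eq_smul_perp hn.1 hm.1 hnm (key n hn) (key m hm)
  have hc0 : c ≠ 0 := by
    rintro rfl
    rw [zero_smul] at hc
    exact hab (sub_eq_zero.1 hc).symm
  refine ⟨n, m, ⟨hn, hm, hnm, |c| * min t (1 - t), ?_, fun u hu => ?_⟩, c, hc0, hc⟩
  · exact mul_pos (abs_pos.2 hc0) (lt_min ht0 (by linarith))
  · have e : s + u • perp n m = a + (t + u / c) • (b - a) := by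
      rw [hs, add_smul, hc, smul_smul (u / c), div_mul_cancel₀ _ hc0]; abel
    have h2 : |u / c| ≤ min t (1 - t) := by
      rw [abs_div, div_le_iff₀ (abs_pos.2 hc0)]; linarith
    have h3 := (le_min_iff.1 h2).1
    have h4 := (le_min_iff.1 h2).2
    rw [abs_le] at h3 h4
    rw [e]
    exact hD.closure_convex.add_smul_sub_mem ha hb ⟨by linarith, by linarith⟩

theorem IsFoot.eq_add_of_isEdgePoint {D : Set Mink} (hD : IsDomainOfDependence D)
    {q s n m : Mink} (h : IsFoot D q s) (he : IsEdgePoint D s n m) :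
    ∃ α β : ℝ, 0 ≤ α ∧ 0 ≤ β ∧ q - s = α • n + β • m := by
  have hk := dirs_mink_neg he.1.1 he.2.1.1 he.2.2.1
  have h1 : ∀ σ : ℝ, mink (σ • perp n m) (q - s) ≤ 0 := fun σ => by
    refine h.mink_nonpos hD fun x hx => ?_
    rw [mink_smul_left]
    rcases he.eq_or_eq hx with rfl | rfl
    · rw [mink_perp_left he.1.1, mul_zero]
    · rw [mink_perp_right he.2.1.1, mul_zero]
  have h2 : mink (q - s) (perp n m) = 0 := by
    have h3 := h1 1
    have h4 := h1 (-1)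
    rw [mink_smul_left, mink_comm] at h3 h4
    linarith
  have hd := dirs_decomposition he.1.1 he.2.1.1 he.2.2.1 (q - s)
  rw [h2, zero_div, zero_smul, add_zero] at hd
  have hc := h.2.1.causal
  exact ⟨_, _, div_nonneg_of_nonpos (hc.mink_nonpos (dirs_causal he.2.1.1)) hk.le,
    div_nonneg_of_nonpos (hc.mink_nonpos (dirs_causal he.1.1)) hk.le, hd⟩

theorem isFoot_of_add {D : Set Mink} {r x : Mink} (hr : r ∈ closure D)
    (hx : FutureTimelike x) (h : ∀ y ∈ D, mink (y - r) x ≤ 0) : IsFoot D (r + x) r :=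
  ⟨hr, by rwa [add_sub_cancel_left], by rwa [add_sub_cancel_left]⟩

theorem timelike_of_dirs {n m : Mink} (hn : n ∈ dirs) (hm : m ∈ dirs) (h : n ≠ m) {α β : ℝ}
    (hα : 0 < α) (hβ : 0 < β) : FutureTimelike (α • n + β • m) := by
  have hk := dirs_mink_neg hn hm h
  refine ⟨?_, ?_⟩
  · simp only [mink_add_left, mink_add_right, mink_smul_left, mink_smul_right, hn.1.1, hm.1.1,
      mink_comm m n]
    nlinarith [mul_pos hα hβ]
  · simp only [Pi.add_apply, Pi.smul_apply, hn.2, hm.2, smul_eq_mul]; linarith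

theorem IsEdgePoint.mem_singularity {D : Set Mink} (hD : IsDomainOfDependence D)
    {s n m : Mink} (h : IsEdgePoint D s n m) : s ∈ singularity D := by
  refine hD.mem_singularity_iff.2 ⟨s + ((1 : ℝ) • n + (1 : ℝ) • m), isFoot_of_add h.mem_closure
    (timelike_of_dirs h.1.1 h.2.1.1 h.2.2.1 one_pos one_pos) fun y hy => ?_⟩
  rw [one_smul, one_smul, mink_add_right]
  linarith [h.1.2 y hy, h.2.1.2 y hy]

/-- The plane through an edge point `c` orthogonal to the edge meets the singularity only in `c`:
in that plane, `closure D` lies in the causal future of `c`. -/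
theorem mink_perp_ne_zero {D : Set Mink} (hD : IsDomainOfDependence D) {s c n m : Mink}
    (hc : IsEdgePoint D c n m) (hs : s ∈ singularity D) (hne : s ≠ c) :
    mink (s - c) (perp n m) ≠ 0 := by
  intro h
  obtain ⟨q, hq⟩ := hD.mem_singularity_iff.1 hs
  have hk := dirs_mink_neg hc.1.1 hc.2.1.1 hc.2.2.1
  have hd := dirs_decomposition hc.1.1 hc.2.1.1 hc.2.2.1 (s - c)
  rw [h, zero_div, zero_smul, add_zero] at hd
  refine hne (eq_of_causal_of_isFoot hD hq hc.mem_closure ?_)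
  rw [hd]
  exact ((dirs_causal hc.1.1).smul (div_nonneg_of_nonpos
      (mink_sub_le_of_mem_closure hc.2.1.2 hq.1) hk.le)).add
    ((dirs_causal hc.2.1.1).smul (div_nonneg_of_nonpos
      (mink_sub_le_of_mem_closure hc.1.2 hq.1) hk.le))

/-- A preconnected part of the singularity that avoids an edge point stays on one side of it. -/
theorem pos_of_isPreconnected {D : Set Mink} (hD : IsDomainOfDependence D) {c n m h : Mink} {k : ℝ}
    (hk : k ≠ 0) (hh : h = k • perp n m) (hc : IsEdgePoint D c n m) {C : Set Mink}
    (hC : IsPreconnected C) (hCs : C ⊆ singularity D) (hcC : c ∉ C) {x z : Mink} (hx : x ∈ C)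
    (hz : z ∈ C) (hpos : 0 < mink (x - c) h) : 0 < mink (z - c) h := by
  by_contra hle
  push Not at hle
  have hf : Continuous fun y => mink (y - c) h := by fun_prop
  obtain ⟨y, hy, hy0⟩ := hC.intermediate_value hz hx hf.continuousOn ⟨hle, hpos.le⟩
  refine mink_perp_ne_zero hD hc (hCs hy) (fun e => hcC (e ▸ hy)) ?_
  simp only [hh, mink_smul_right] at hy0
  exact (mul_eq_zero.1 hy0).resolve_left hk

/-! ### Simplicial dual trees -/

theorem exists_param_of_mem_segment {a b s : Mink} (h : s ∈ segment ℝ a b) :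
    ∃ t : ℝ, 0 ≤ t ∧ t ≤ 1 ∧ s = a + t • (b - a) := by
  rw [segment_eq_image'] at h
  obtain ⟨t, ht, rfl⟩ := h
  exact ⟨t, ht.1, ht.2, rfl⟩

theorem param_mem_segment (a b : Mink) {t : ℝ} (h0 : 0 ≤ t) (h1 : t ≤ 1) :
    a + t • (b - a) ∈ segment ℝ a b := by
  rw [segment_eq_image']
  exact ⟨t, ⟨h0, h1⟩, rfl⟩

theorem singularity_subset_closure {D : Set Mink} (hD : IsDomainOfDependence D) :
    singularity D ⊆ closure D := fun r hr => by
  obtain ⟨q, hq⟩ := hD.mem_singularity_iff.1 hr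
  exact hq.1

theorem exists_isEdgePoint_of_segment {D : Set Mink} (hD : IsDomainOfDependence D) {a b : Mink}
    (hab : a ≠ b) (h : segment ℝ a b ⊆ singularity D) {t : ℝ} (ht0 : 0 < t) (ht1 : t < 1) :
    ∃ n m, IsEdgePoint D (a + t • (b - a)) n m ∧ ∃ c : ℝ, c ≠ 0 ∧ b - a = c • perp n m := by
  obtain ⟨q, hq⟩ := hD.mem_singularity_iff.1 (h (param_mem_segment a b ht0.le ht1.le))
  exact hq.exists_isEdgePoint hD (singularity_subset_closure hD (h (left_mem_segment ℝ a b)))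
    (singularity_subset_closure hD (h (right_mem_segment ℝ a b))) ht0 ht1 hab rfl

theorem IsEdgePoint.mink_self_pos {D : Set Mink} {c n m h : Mink} (hc : IsEdgePoint D c n m)
    {k : ℝ} (hk : k ≠ 0) (hh : h = k • perp n m) : 0 < mink h h := by
  rw [hh, mink_smul_left, mink_smul_right, ← mul_assoc]
  exact mul_pos (mul_self_pos.2 hk) (mink_perp_self_pos hc.1.1 hc.2.1.1 hc.2.2.1)

section Tree

variable {D : Set Mink} {V : Set Mink} {G : SimpleGraph V}

/-- An edge other than `r b` does not cross the plane orthogonal to the edge `r b` at an interior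
point `c`. -/
theorem edge_pos (hD : IsDomainOfDependence D)
    (hinj : ∀ a b c d : V, G.Adj a b → G.Adj c d → s(a, b) ≠ s(c, d) →
      segment ℝ a.1 b.1 ∩ segment ℝ c.1 d.1 ⊆ {a.1, b.1} ∩ {c.1, d.1})
    (hseg : ∀ a b : V, G.Adj a b → segment ℝ a.1 b.1 ⊆ singularity D)
    {r b : V} (hrb : G.Adj r b) {c n m h : Mink} {k : ℝ} (hk : k ≠ 0) (hh : h = k • perp n m)
    (hc : IsEdgePoint D c n m) (hcs : c ∈ segment ℝ r.1 b.1) (hcr : c ≠ r.1) (hcb : c ≠ b.1)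
    {x y : V} (hxy : G.Adj x y) (hne : s(x, y) ≠ s(r, b)) {z : Mink}
    (hz : z ∈ segment ℝ x.1 y.1) (hpos : 0 < mink (x.1 - c) h) : 0 < mink (z - c) h := by
  refine pos_of_isPreconnected hD hk hh hc (convex_segment x.1 y.1).isPreconnected (hseg x y hxy)
    (fun hcx => ?_) (left_mem_segment ℝ x.1 y.1) hz hpos
  have h1 := (hinj x y r b hxy hrb hne ⟨hcx, hcs⟩).2
  rcases h1 with h1 | h1
  exacts [hcr h1, hcb h1]

/-- A walk that avoids the edge `r b` stays on one side of the plane orthogonal to that edge at an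
interior point `c`. -/
theorem walk_pos (hD : IsDomainOfDependence D)
    (hinj : ∀ a b c d : V, G.Adj a b → G.Adj c d → s(a, b) ≠ s(c, d) →
      segment ℝ a.1 b.1 ∩ segment ℝ c.1 d.1 ⊆ {a.1, b.1} ∩ {c.1, d.1})
    (hseg : ∀ a b : V, G.Adj a b → segment ℝ a.1 b.1 ⊆ singularity D)
    {r b : V} (hrb : G.Adj r b) {c n m h : Mink} {k : ℝ} (hk : k ≠ 0) (hh : h = k • perp n m)
    (hc : IsEdgePoint D c n m) (hcs : c ∈ segment ℝ r.1 b.1) (hcr : c ≠ r.1) (hcb : c ≠ b.1)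
    {x y : V} (w : G.Walk x y) (hw : s(r, b) ∉ w.edges) (hpos : 0 < mink (x.1 - c) h) :
    0 < mink (y.1 - c) h := by
  induction w with
  | nil => exact hpos
  | @cons x u y hxu w ih =>
    rw [SimpleGraph.Walk.edges_cons, List.mem_cons, not_or] at hw
    exact ih hw.2 (edge_pos hD hinj hseg hrb hk hh hc hcs hcr hcb hxu (Ne.symm hw.1)
      (right_mem_segment ℝ x.1 u.1) hpos)

/-- A preconnected part of a simplicial singularity that contains a vertex `r` and another point
runs through an interior point of an edge at `r`. -/
theorem exists_edge_mem_of_isPreconnected (hD : IsDomainOfDependence D) (hG : G.Connected)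
    (hinj : ∀ a b c d : V, G.Adj a b → G.Adj c d → s(a, b) ≠ s(c, d) →
      segment ℝ a.1 b.1 ∩ segment ℝ c.1 d.1 ⊆ {a.1, b.1} ∩ {c.1, d.1})
    (hsing : singularity D = V ∪ {x | ∃ a b : V, G.Adj a b ∧ x ∈ segment ℝ a.1 b.1})
    {C : Set Mink} (hC : IsPreconnected C) (hCs : C ⊆ singularity D) {r : V} {s : Mink}
    (hr : r.1 ∈ C) (hs : s ∈ C) (hsr : s ≠ r.1) :
    ∃ b : V, G.Adj r b ∧ ∃ t : ℝ, 0 < t ∧ t < 1 ∧ r.1 + t • (b.1 - r.1) ∈ C := by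
  have hseg : ∀ a b : V, G.Adj a b → segment ℝ a.1 b.1 ⊆ singularity D := fun a b hab x hx => by
    rw [hsing]; exact Or.inr ⟨a, b, hab, hx⟩
  have hvne : ∀ {a b : V}, G.Adj a b → a.1 ≠ b.1 := fun hab e => hab.ne (Subtype.ext e)
  -- It suffices that `s` and `r` lie on different sides of an interior point of an edge at `r`.
  suffices H : ∃ b : V, G.Adj r b ∧ ∃ t : ℝ, 0 < t ∧ t < 1 ∧
      0 < mink (s - (r.1 + t • (b.1 - r.1))) (b.1 - r.1) by
    obtain ⟨b, hrb, t, ht0, ht1, hpos⟩ := H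
    refine ⟨b, hrb, t, ht0, ht1, ?_⟩
    by_contra hcC
    obtain ⟨n, m, hc, k, hk, hh⟩ := exists_isEdgePoint_of_segment hD (hvne hrb) (hseg r b hrb)
      ht0 ht1
    have h1 := pos_of_isPreconnected hD hk hh hc hC hCs hcC hs hr hpos
    rw [sub_add_cancel_left, mink_neg_left, mink_smul_left] at h1
    have h2 : 0 < mink (b.1 - r.1) (b.1 - r.1) := hc.mink_self_pos hk hh
    nlinarith [mul_pos ht0 h2]
  -- Every interior point of the first edge of a path from `r` to `a` separates `r` from `a`.
  have path : ∀ a : V, a ≠ r → ∃ b : V, G.Adj r b ∧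
      ∀ (c n m : Mink) (k : ℝ), k ≠ 0 → b.1 - r.1 = k • perp n m → IsEdgePoint D c n m →
      c ∈ segment ℝ r.1 b.1 → c ≠ r.1 → c ≠ b.1 → 0 < mink (b.1 - c) (b.1 - r.1) →
      0 < mink (a.1 - c) (b.1 - r.1) := by
    intro a har
    obtain ⟨p, hp⟩ := (hG.preconnected r a).exists_isPath
    cases p with
    | nil => exact absurd rfl har
    | @cons _ b _ hrb p =>
      rw [SimpleGraph.Walk.cons_isPath_iff] at hp
      refine ⟨b, hrb, fun c n m k hk hh hc hcs hcr hcb hpos => ?_⟩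
      exact walk_pos hD hinj hseg hrb hk hh hc hcs hcr hcb p
        (fun he => hp.2 (p.fst_mem_support_of_mem_edges he)) hpos
  have mid : ∀ b : V, G.Adj r b → ∃ (c n m : Mink) (k : ℝ),
      c = r.1 + (1 / 2 : ℝ) • (b.1 - r.1) ∧ k ≠ 0 ∧
      b.1 - r.1 = k • perp n m ∧ IsEdgePoint D c n m ∧ c ∈ segment ℝ r.1 b.1 ∧ c ≠ r.1 ∧
      c ≠ b.1 ∧ 0 < mink (b.1 - c) (b.1 - r.1) := by
    intro b hrb
    obtain ⟨n, m, hc, k, hk, hh⟩ := exists_isEdgePoint_of_segment hD (hvne hrb) (hseg r b hrb)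
      (t := 1 / 2) (by norm_num) (by norm_num)
    have h2 : 0 < mink (b.1 - r.1) (b.1 - r.1) := hc.mink_self_pos hk hh
    have e : b.1 - (r.1 + (1 / 2 : ℝ) • (b.1 - r.1)) = (1 / 2 : ℝ) • (b.1 - r.1) := by
      module
    have hbr : b.1 - r.1 ≠ 0 := sub_ne_zero.2 (hvne hrb).symm
    have hhalf : (1 / 2 : ℝ) • (b.1 - r.1) ≠ 0 := smul_ne_zero (by norm_num) hbr
    refine ⟨_, n, m, k, rfl, hk, hh, hc, param_mem_segment _ _ (by norm_num) (by norm_num),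
      fun h => hhalf (by simpa using h), fun h => hhalf ?_, ?_⟩
    · rw [← e, sub_eq_zero]; exact h.symm
    · rw [e, mink_smul_left]; linarith
  have hs' := hCs hs
  rw [hsing] at hs'
  rcases hs' with hsV | ⟨a, a', haa, hsa⟩
  · obtain ⟨b, hrb, hb⟩ := path ⟨s, hsV⟩ (fun e => hsr (congrArg Subtype.val e))
    obtain ⟨c, n, m, k, hce, hk, hh, hc, hcs, hcr, hcb, hpos⟩ := mid b hrb
    exact ⟨b, hrb, 1 / 2, by norm_num, by norm_num,
      hce ▸ hb c n m k hk hh hc hcs hcr hcb hpos⟩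
  · -- If `s` lies on an edge at `r`, a point halfway between `r` and `s` separates them.
    have near : ∀ b : V, G.Adj r b → s ∈ segment ℝ r.1 b.1 → ∃ b : V, G.Adj r b ∧
        ∃ t : ℝ, 0 < t ∧ t < 1 ∧ 0 < mink (s - (r.1 + t • (b.1 - r.1))) (b.1 - r.1) := by
      intro b hrb hsb
      obtain ⟨c, n, m, k, -, hk, hh, hc, -⟩ := mid b hrb
      have h2 : 0 < mink (b.1 - r.1) (b.1 - r.1) := hc.mink_self_pos hk hh
      obtain ⟨t, ht0, ht1, e⟩ := exists_param_of_mem_segment hsb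
      have ht : 0 < t := ht0.lt_of_ne (by rintro rfl; simp at e; exact hsr e)
      refine ⟨b, hrb, t / 2, by linarith, by linarith, ?_⟩
      rw [e, show r.1 + t • (b.1 - r.1) - (r.1 + (t / 2) • (b.1 - r.1))
        = (t / 2) • (b.1 - r.1) by module, mink_smul_left]
      exact mul_pos (by linarith) h2
    by_cases har : a = r
    · subst har; exact near a' haa hsa
    by_cases har' : a' = r
    · subst har'; exact near a haa.symm (by rwa [segment_symm])
    obtain ⟨b, hrb, hb⟩ := path a har
    obtain ⟨c, n, m, k, hce, hk, hh, hc, hcs, hcr, hcb, hpos⟩ := mid b hrb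
    refine ⟨b, hrb, 1 / 2, by norm_num, by norm_num, hce ▸ ?_⟩
    refine edge_pos hD hinj hseg hrb hk hh hc hcs hcr hcb haa (fun e => ?_) hsa
      (hb c n m k hk hh hc hcs hcr hcb hpos)
    have : r ∈ s(a, a') := by rw [e]; exact Sym2.mem_mk_left r b
    rcases Sym2.mem_iff.1 this with h | h
    exacts [har h.symm, har' h.symm]

end Tree

/-! ### Geodesics and leaves -/

/-- The complete geodesic with ideal endpoints `n` and `m`. -/
def geod (n m : Mink) : Set Mink := {x | x ∈ hyp ∧ mink x (perp n m) = 0}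

theorem exists_pos_coeff_of_orth_perp {n m x : Mink} (hn : n ∈ dirs) (hm : m ∈ dirs) (h : n ≠ m)
    (hx : FutureTimelike x) (hp : mink x (perp n m) = 0) :
    ∃ α β : ℝ, 0 < α ∧ 0 < β ∧ x = α • n + β • m := by
  have hk := dirs_mink_neg hn hm h
  have hd := dirs_decomposition hn hm h x
  rw [hp, zero_div, zero_smul, add_zero] at hd
  refine ⟨_, _, div_pos_of_neg_of_neg ?_ hk, div_pos_of_neg_of_neg ?_ hk, hd⟩
  · rw [mink_comm]; exact hx.mink_dirs_neg hm
  · rw [mink_comm]; exact hx.mink_dirs_neg hn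

theorem normalize_mem_geod {n m : Mink} (hn : n ∈ dirs) (hm : m ∈ dirs) (h : n ≠ m) {α β : ℝ}
    (hα : 0 < α) (hβ : 0 < β) :
    ∃ c : ℝ, 0 < c ∧ c • (α • n + β • m) ∈ geod n m := by
  have hT := timelike_of_dirs hn hm h hα hβ
  have hl := mlen_pos hT
  refine ⟨(mlen (α • n + β • m))⁻¹, inv_pos.2 hl, ⟨?_, mul_pos (inv_pos.2 hl) hT.2⟩, ?_⟩
  · have h1 := mlen_sq hT.causal
    rw [mink_smul_left, mink_smul_right, ← neg_eq_iff_eq_neg.2 h1]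
    field_simp
  · rw [mink_smul_left, mink_add_left, mink_smul_left, mink_smul_left, mink_comm n,
      mink_perp_left hn, mink_comm m, mink_perp_right hm]
    ring

theorem geod_subset_halfspace {n m y : Mink} (hn : n ∈ dirs) (hm : m ∈ dirs) (h : n ≠ m)
    (hy : ∀ x ∈ geod n m, mink y x ≤ 0) : mink y n ≤ 0 := by
  have key : ∀ α : ℝ, 0 < α → α * mink y n + mink y m ≤ 0 := fun α hα => by
    obtain ⟨c, hc, hmem⟩ := normalize_mem_geod hn hm h hα one_pos
    have := hy _ hmem
    rw [mink_smul_right, mink_add_right, mink_smul_right, mink_smul_right, one_mul] at this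
    by_contra hlt
    push Not at hlt
    nlinarith [mul_pos hc hlt]
  by_contra hlt
  push Not at hlt
  have h1 := key (|mink y m| / mink y n + 1) (by positivity)
  rw [add_mul, div_mul_cancel₀ _ hlt.ne'] at h1
  linarith [neg_abs_le (mink y m)]

theorem linearIndependent_dirs {n m : Mink} (hn : n ∈ dirs) (hm : m ∈ dirs) (h : n ≠ m) :
    LinearIndependent ℝ ![n, m] := by
  rw [LinearIndependent.pair_iff]
  intro s t hst
  have hk := (dirs_mink_neg hn hm h).ne
  have h1 : mink (s • n + t • m) n = 0 := by rw [hst, mink_zero_left]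
  have h2 : mink (s • n + t • m) m = 0 := by rw [hst, mink_zero_left]
  simp only [mink_add_left, mink_smul_left, hn.1.1, hm.1.1, mink_comm m n, mul_zero, zero_add,
    add_zero] at h1 h2
  exact ⟨(mul_eq_zero.1 h2).resolve_right hk, (mul_eq_zero.1 h1).resolve_right hk⟩

theorem geod_eq_inter_span {n m : Mink} (hn : n ∈ dirs) (hm : m ∈ dirs) (h : n ≠ m) :
    geod n m = hyp ∩ (Submodule.span ℝ {n, m} : Submodule ℝ Mink) := by
  ext x
  constructor
  · rintro ⟨hx, hp⟩
    obtain ⟨α, β, -, -, e⟩ := exists_pos_coeff_of_orth_perp hn hm h (hyp_timelike hx) hp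
    exact ⟨hx, Submodule.mem_span_pair.2 ⟨α, β, e.symm⟩⟩
  · rintro ⟨hx, hs⟩
    obtain ⟨α, β, rfl⟩ := Submodule.mem_span_pair.1 hs
    refine ⟨hx, ?_⟩
    rw [mink_add_left, mink_smul_left, mink_smul_left, mink_comm n,
      mink_perp_left hn, mink_comm m, mink_perp_right hm]
    ring

theorem finrank_span_dirs {n m : Mink} (hn : n ∈ dirs) (hm : m ∈ dirs) (h : n ≠ m) :
    Module.finrank ℝ (Submodule.span ℝ {n, m} : Submodule ℝ Mink) = 2 := by
  have h1 := finrank_span_eq_card (linearIndependent_dirs hn hm h)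
  rwa [Matrix.range_cons, Matrix.range_cons, Matrix.range_empty, union_empty,
    singleton_union, Fintype.card_fin] at h1

theorem isGeodesic_geod {n m : Mink} (hn : n ∈ dirs) (hm : m ∈ dirs) (h : n ≠ m) :
    IsGeodesic (geod n m) := by
  refine ⟨_, finrank_span_dirs hn hm h, ⟨(1 : ℝ) • n + (1 : ℝ) • m,
    Submodule.mem_span_pair.2 ⟨1, 1, rfl⟩, (timelike_of_dirs hn hm h one_pos one_pos).1⟩,
    geod_eq_inter_span hn hm h⟩

theorem IsGeodesic.exists_eq_geod {l : Set Mink} (hl : IsGeodesic l) :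
    ∃ n m, n ∈ dirs ∧ m ∈ dirs ∧ n ≠ m ∧ l = geod n m := by
  obtain ⟨W, hW, ⟨w, hwW, hw⟩, rfl⟩ := hl
  -- A spatial vector `y` in the plane and a timelike one span two null directions.
  obtain ⟨y, hyW, hy0, hyne⟩ : ∃ y ∈ W, y 0 = 0 ∧ y ≠ 0 := by
    let f : W →ₗ[ℝ] ℝ := (LinearMap.proj 0 : Mink →ₗ[ℝ] ℝ).comp W.subtype
    have h1 : LinearMap.ker f ≠ ⊥ := fun h0 => by
      have h2 := f.finrank_range_add_finrank_ker
      have h3 : Module.finrank ℝ (LinearMap.range f) ≤ 1 := by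
        simpa using (LinearMap.range f).finrank_le
      rw [hW, h0, finrank_bot] at h2
      omega
    obtain ⟨y, hy, hne⟩ := Submodule.exists_mem_ne_zero_of_ne_bot h1
    refine ⟨y.1, y.2, hy, fun h0 => hne (Subtype.ext h0)⟩
  have hyy : 0 < mink y y := by
    by_contra hle
    push Not at hle
    simp only [mink, hy0] at hle
    have h1 : y 1 = 0 := by nlinarith [sq_nonneg (y 1), sq_nonneg (y 2)]
    have h2 : y 2 = 0 := by nlinarith [sq_nonneg (y 1), sq_nonneg (y 2)]
    apply hyne
    funext i; fin_cases i <;> simp [hy0, h1, h2]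
  have hw0 : w 0 ≠ 0 := by
    intro h0
    simp only [mink, h0] at hw
    nlinarith [sq_nonneg (w 1), sq_nonneg (w 2)]
  set S := Real.sqrt (mink w y ^ 2 - mink y y * mink w w) with hS
  have hdisc : 0 < mink w y ^ 2 - mink y y * mink w w := by nlinarith [sq_nonneg (mink w y)]
  have hSpos : 0 < S := Real.sqrt_pos.2 hdisc
  have hS2 : S ^ 2 = mink w y ^ 2 - mink y y * mink w w := Real.sq_sqrt hdisc.le
  have hroot : ∀ t : ℝ, t ^ 2 = S ^ 2 →
      (w 0)⁻¹ • (w + ((-mink w y + t) / mink y y) • y) ∈ dirs := fun t ht => by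
    have h0 : (w + ((-mink w y + t) / mink y y) • y) 0 = w 0 := by simp [hy0]
    refine ⟨⟨?_, ?_⟩, ?_⟩
    · simp only [mink_add_left, mink_add_right, mink_smul_left, mink_smul_right, mink_comm y w]
      field_simp
      linear_combination ht + hS2
    · simp [hy0, hw0]
    · simp [hy0, hw0]
  have hn := hroot S rfl
  have hm := hroot (-S) (by ring)
  have hnm : (w 0)⁻¹ • (w + ((-mink w y + S) / mink y y) • y)
      ≠ (w 0)⁻¹ • (w + ((-mink w y + -S) / mink y y) • y) := by
    intro h
    have h1 := smul_right_injective Mink (inv_ne_zero hw0) h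
    have h2 := smul_left_injective ℝ hyne (add_left_cancel h1)
    rw [div_left_inj' hyy.ne'] at h2
    linarith
  refine ⟨_, _, hn, hm, hnm, ?_⟩
  rw [geod_eq_inter_span hn hm hnm]
  congr 2
  refine (Submodule.eq_of_le_of_finrank_eq ?_ ?_).symm
  · rw [Submodule.span_le]
    rintro x (rfl | rfl)
    · exact W.smul_mem _ (W.add_mem hwW (W.smul_mem _ hyW))
    · exact W.smul_mem _ (W.add_mem hwW (W.smul_mem _ hyW))
  · rw [finrank_span_dirs hn hm hnm, hW]

theorem mink_nonpos_of_mem_stratum {D : Set Mink} (hD : IsDomainOfDependence D) {r x y : Mink}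
    (hr : r ∈ closure D) (hx : x ∈ stratum D r) (hy : y ∈ closure D) : mink (y - r) x ≤ 0 := by
  have hconv : Convex ℝ {z : Mink | mink (y - r) (z - r) ≤ 0} := by
    intro a ha b hb s t hs ht hst
    simp only [mem_ofPred_eq] at *
    have e : s • a + t • b - r = s • (a - r) + t • (b - r) := by
      have : r = (s + t) • r := by rw [hst, one_smul]
      conv_lhs => rw [this]
      module
    rw [e, mink_add_right, mink_smul_right, mink_smul_right]
    nlinarith [mul_nonpos_of_nonneg_of_nonpos hs ha, mul_nonpos_of_nonneg_of_nonpos ht hb]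
  have h1 := convexHull_min (s := {y | ∃ n ∈ nullDirs D r, ∃ t : ℝ, 0 ≤ t ∧ y = r + t • n})
    (fun z hz => ?_) hconv hx.2
  · simpa only [mem_ofPred_eq, add_sub_cancel_left] using h1
  · obtain ⟨n, hn, t, ht, rfl⟩ := hz
    rw [hD.nullDirs_eq hr] at hn
    rw [mem_ofPred_eq, add_sub_cancel_left, mink_smul_right]
    exact mul_nonpos_of_nonneg_of_nonpos ht (mink_sub_le_of_mem_closure hn.2 hy)

theorem add_mem_nullHull {D : Set Mink} (hD : IsDomainOfDependence D) {r n₁ n₂ n₃ : Mink}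
    (hr : r ∈ closure D) (h₁ : n₁ ∈ nullNormals D r) (h₂ : n₂ ∈ nullNormals D r)
    (h₃ : n₃ ∈ nullNormals D r) {a b c : ℝ} (ha : 0 ≤ a) (hb : 0 ≤ b) (hc : 0 ≤ c) :
    r + (c • n₃ + (a • n₁ + b • n₂)) ∈ nullHull D r := by
  rw [← hD.nullDirs_eq hr] at h₁ h₂ h₃
  have hconv := convex_convexHull ℝ {y | ∃ n ∈ nullDirs D r, ∃ t : ℝ, 0 ≤ t ∧ y = r + t • n}
  have hmem : ∀ n ∈ nullDirs D r, ∀ t : ℝ, 0 ≤ t → r + t • n ∈ nullHull D r := fun n hn t ht =>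
    subset_convexHull ℝ _ ⟨n, hn, t, ht, rfl⟩
  have h12 := hconv (hmem _ h₁ (4 * a) (by linarith)) (hmem _ h₂ (4 * b) (by linarith))
    (a := 1 / 2) (b := 1 / 2) (by norm_num) (by norm_num) (by norm_num)
  have h123 := hconv (hmem _ h₃ (2 * c) (by linarith)) h12
    (a := 1 / 2) (b := 1 / 2) (by norm_num) (by norm_num) (by norm_num)
  have e : r + (c • n₃ + (a • n₁ + b • n₂)) = (1 / 2 : ℝ) • (r + (2 * c) • n₃)
      + (1 / 2 : ℝ) • ((1 / 2 : ℝ) • (r + (4 * a) • n₁) + (1 / 2 : ℝ) • (r + (4 * b) • n₂)) := by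
    module
  rw [e]
  exact h123

/-- A complete geodesic in the frontier of a stratum has the stratum on one of its sides. -/
theorem same_side_of_subset_hypFrontier {D : Set Mink} (hD : IsDomainOfDependence D)
    {r n m : Mink} (hr : r ∈ closure D) (hn : n ∈ nullNormals D r) (hm : m ∈ nullNormals D r)
    (hnm : n ≠ m) (hl : geod n m ⊆ hypFrontier (stratum D r)) {a b : Mink}
    (ha : a ∈ nullNormals D r) (hb : b ∈ nullNormals D r) (ha0 : mink a (perp n m) < 0) :
    mink b (perp n m) ≤ 0 := by
  by_contra hb0
  push Not at hb0
  have hk := dirs_mink_neg hn.1 hm.1 hnm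
  obtain ⟨c, hc, hx⟩ := normalize_mem_geod hn.1 hm.1 hnm one_pos one_pos
  set x := c • ((1 : ℝ) • n + (1 : ℝ) • m)
  have hxF := (hl hx).2
  have hxT := hyp_timelike hx.1
  -- Near `x` one can reach the plane of the geodesic by subtracting a multiple of `a` or `b`.
  have near : ∀ d ∈ nullNormals D r, ∀ᶠ y in 𝓝 x,
      0 ≤ mink y (perp n m) / mink d (perp n m) → y ∈ hyp → mink d (perp n m) ≠ 0 →
      y ∈ stratum D r := by
    intro d hd
    set γ : Mink → ℝ := fun y => mink y (perp n m) / mink d (perp n m)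
    have hγ : Continuous γ := Continuous.div_const (by fun_prop) _
    have hc' : ∀ e ∈ dirs, ∀ᶠ y in 𝓝 x, mink (y - γ y • d) e < 0 := fun e he => by
      have hcont : Continuous fun y => mink (y - γ y • d) e := by fun_prop
      refine hcont.tendsto x |>.eventually (gt_mem_nhds ?_)
      have : γ x = 0 := by simp only [γ, hx.2, zero_div]
      rw [this, zero_smul, sub_zero, mink_comm]
      exact hxT.mink_dirs_neg he
    filter_upwards [hc' n hn.1, hc' m hm.1] with y h1 h2 h3 h4 h5
    refine ⟨h4, ?_⟩
    have hd' := dirs_decomposition hn.1 hm.1 hnm (y - γ y • d)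
    have h6 : mink (y - γ y • d) (perp n m) = 0 := by
      rw [mink_sub_left, mink_smul_left]
      simp only [γ]
      rw [div_mul_cancel₀ _ h5, sub_self]
    rw [h6, zero_div, zero_smul, add_zero] at hd'
    have h7 := add_mem_nullHull hD hr hn hm hd (div_nonneg_of_nonpos h2.le hk.le)
      (div_nonneg_of_nonpos h1.le hk.le) h3
    rwa [← hd', add_sub_cancel] at h7
  obtain ⟨y, ⟨hy, hyn⟩, h1, h2⟩ := (mem_closure_iff_frequently.1 hxF).and_eventually
    ((near a ha).and (near b hb)) |>.exists
  apply hyn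
  rcases le_total (mink y (perp n m)) 0 with h0 | h0
  · exact h1 (div_nonneg_of_nonpos h0 ha0.le) hy ha0.ne
  · exact h2 (div_nonneg h0 hb0.le) hy hb0.ne'

/-- Every leaf is a geodesic in a stratum that lies on one side of it. -/
theorem exists_of_mem_leaves {D : Set Mink} (hD : IsDomainOfDependence D) {l : Set Mink}
    (hl : l ∈ leaves D) : ∃ r n m, ∃ σ : ℝ, r ∈ closure D ∧ n ∈ nullNormals D r ∧
      m ∈ nullNormals D r ∧ n ≠ m ∧ σ * σ = 1 ∧
      (∀ a ∈ nullNormals D r, σ * mink a (perp n m) ≤ 0) ∧ l = geod n m := by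
  obtain ⟨hgeo, hl⟩ := hl
  obtain ⟨n, m, hn, hm, hnm, rfl⟩ := hgeo.exists_eq_geod
  have key : ∀ r, r ∈ closure D → geod n m ⊆ closure (stratum D r) →
      n ∈ nullNormals D r ∧ m ∈ nullNormals D r := fun r hr hsub => by
    have h1 : ∀ y ∈ D, ∀ x ∈ geod n m, mink (y - r) x ≤ 0 := fun y hy x hx => by
      have hc : IsClosed {x : Mink | mink (y - r) x ≤ 0} :=
        isClosed_le (by fun_prop) continuous_const
      exact closure_minimal (t := {x : Mink | mink (y - r) x ≤ 0})
        (fun z hz => mink_nonpos_of_mem_stratum hD hr hz (subset_closure hy)) hc (hsub hx)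
    refine ⟨⟨hn, fun y hy => geod_subset_halfspace hn hm hnm (h1 y hy)⟩,
      ⟨hm, fun y hy => geod_subset_halfspace hm hn hnm.symm fun x hx => h1 y hy x ⟨hx.1, ?_⟩⟩⟩
    have := hx.2
    rw [perp_swap, mink_neg_right, neg_eq_zero] at this
    exact this
  rcases hl with ⟨r, hr, hv, hl⟩ | ⟨r, hr, hl⟩
  · obtain ⟨q, hq⟩ := hD.mem_singularity_iff.1 hr
    obtain ⟨hnr, hmr⟩ := key r hq.1 (by rw [hl]; exact subset_closure)
    refine ⟨r, n, m, 1, hq.1, hnr, hmr, hnm, one_mul 1, fun a ha => ?_, rfl⟩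
    by_contra hne
    have ha' : a ≠ n ∧ a ≠ m := by
      constructor
      · rintro rfl
        rw [mink_comm, mink_perp_left hn] at hne
        simp at hne
      · rintro rfl
        rw [mink_comm, mink_perp_right hm] at hne
        simp at hne
    refine hv ⟨hr.choose_spec.2.1.1, ?_⟩
    rw [hD.nullDirs_eq hq.1, ← Set.encard_eq_three.2 ⟨a, n, m, ha'.1, ha'.2, hnm, rfl⟩]
    refine Set.encard_le_encard ?_
    rintro x (rfl | rfl | rfl)
    exacts [ha, hnr, hmr]
  · have hrc := (hD.mem_frontier_iff.1 hr.1).1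
    obtain ⟨hnr, hmr⟩ := key r hrc fun x hx => (hl hx).1.2
    by_cases h : ∃ a ∈ nullNormals D r, mink a (perp n m) < 0
    · obtain ⟨a, ha, ha0⟩ := h
      refine ⟨r, n, m, 1, hrc, hnr, hmr, hnm, one_mul 1, fun b hb => ?_, rfl⟩
      rw [one_mul]
      exact same_side_of_subset_hypFrontier hD hrc hnr hmr hnm hl ha hb ha0
    · push Not at h
      exact ⟨r, n, m, -1, hrc, hnr, hmr, hnm, by norm_num,
        fun b hb => by have := h b hb; linarith, rfl⟩

/-! ### Seen leaves and edge points in the past of the observer -/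

theorem IsEdgePoint.of_nullNormals {D : Set Mink} {s n m a b : Mink} (h : IsEdgePoint D s a b)
    (hn : n ∈ nullNormals D s) (hm : m ∈ nullNormals D s) (hnm : n ≠ m) : IsEdgePoint D s n m := by
  rcases h.eq_or_eq hn with rfl | rfl <;> rcases h.eq_or_eq hm with rfl | rfl
  exacts [absurd rfl hnm, h, h.symm, absurd rfl hnm]

theorem mem_or_exists_isEdgePoint {D V : Set Mink} {G : SimpleGraph V}
    (hD : IsDomainOfDependence D)
    (hsing : singularity D = V ∪ {x | ∃ a b : V, G.Adj a b ∧ x ∈ segment ℝ a.1 b.1})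
    {s : Mink} (hs : s ∈ singularity D) : s ∈ V ∨ ∃ n m, IsEdgePoint D s n m := by
  have hs' := hs
  rw [hsing] at hs'
  rcases hs' with h | ⟨a, b, hab, h⟩
  · exact Or.inl h
  · obtain ⟨t, ht0, ht1, rfl⟩ := exists_param_of_mem_segment h
    rcases ht0.eq_or_lt with rfl | ht0
    · left; rw [zero_smul, add_zero]; exact a.2
    rcases ht1.eq_or_lt with rfl | ht1
    · left; rw [one_smul, add_sub_cancel]; exact b.2
    · obtain ⟨n, m, hnm, -⟩ := exists_isEdgePoint_of_segment hD
        (fun e => hab.ne (Subtype.ext e)) (fun x hx => by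
          rw [hsing]; exact Or.inr ⟨a, b, hab, hx⟩) ht0 ht1
      exact Or.inr ⟨n, m, hnm⟩

theorem isFoot_add_dirs {D : Set Mink} {s n m : Mink} (hs : s ∈ closure D)
    (hn : n ∈ nullNormals D s) (hm : m ∈ nullNormals D s) (hnm : n ≠ m) {α β : ℝ} (hα : 0 < α)
    (hβ : 0 < β) : IsFoot D (s + (α • n + β • m)) s := by
  refine isFoot_of_add hs (timelike_of_dirs hn.1 hm.1 hnm hα hβ) fun y hy => ?_
  rw [mink_add_right, mink_smul_right, mink_smul_right]
  nlinarith [mul_nonpos_of_nonneg_of_nonpos hα.le (hn.2 y hy),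
    mul_nonpos_of_nonneg_of_nonpos hβ.le (hm.2 y hy)]

theorem isOpen_chronPast (p : Mink) : IsOpen (chronPast p) :=
  isOpen_futureTimelike.preimage (by fun_prop)

/-- A path of feet leaving a vertex `r` across a leaf `geod n m` runs through an edge at `r`; the
inequalities at the foot force this edge to be dual to the leaf. -/
theorem exists_isEdgePoint_near_vertex {D V : Set Mink} {G : SimpleGraph V}
    (hD : IsDomainOfDependence D) (hG : G.Connected)
    (hinj : ∀ a b c d : V, G.Adj a b → G.Adj c d → s(a, b) ≠ s(c, d) →
      segment ℝ a.1 b.1 ∩ segment ℝ c.1 d.1 ⊆ {a.1, b.1} ∩ {c.1, d.1})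
    (hsing : singularity D = V ∪ {x | ∃ a b : V, G.Adj a b ∧ x ∈ segment ℝ a.1 b.1})
    {r : V} {n m : Mink} {σ : ℝ} (hr : r.1 ∈ closure D) (hn : n ∈ nullNormals D r.1)
    (hm : m ∈ nullNormals D r.1) (hnm : n ≠ m) (hσ : σ * σ = 1)
    (hside : ∀ a ∈ nullNormals D r.1, σ * mink a (perp n m) ≤ 0) {U : Set Mink} (hU : IsOpen U)
    (hrU : r.1 ∈ U) : ∃ c ∈ U, IsEdgePoint D c n m := by
  set P := perp n m with hP
  have hPP : 0 < mink P P := mink_perp_self_pos hn.1 hm.1 hnm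
  set x : Mink := (1 : ℝ) • n + (1 : ℝ) • m with hx
  have hxP : mink x P = 0 := by
    rw [hx, mink_add_left, mink_smul_left, mink_smul_left, mink_comm n, mink_comm m,
      mink_perp_left hn.1, mink_perp_right hm.1]
    ring
  have hfr := isFoot_add_dirs hr hn hm hnm one_pos one_pos
  rw [← hx] at hfr
  have hqD := hD.mem_of_isFoot hfr
  set Q : ℝ → Mink := fun η => r.1 + x + (η * σ) • P with hQ
  have hQc : Continuous Q := by fun_prop
  have hQ0 : Q 0 = r.1 + x := by simp [hQ]
  have hev : ∀ᶠ η in 𝓝 (0 : ℝ), Q η ∈ D ∧ foot D (Q η) ∈ U := by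
    have h1 : Tendsto Q (𝓝 0) (𝓝 (r.1 + x)) := by rw [← hQ0]; exact hQc.tendsto 0
    have h2 := (hD.tendsto_foot hqD).comp h1
    rw [hD.foot_eq hfr] at h2
    exact (h1.eventually (hD.isOpen.mem_nhds hqD)).and (h2.eventually (hU.mem_nhds hrU))
  obtain ⟨ε, hε, hball⟩ := Metric.eventually_nhds_iff.1 hev
  set η₀ := ε / 2 with hη₀
  have hη₀pos : 0 < η₀ := by positivity
  have hI : ∀ η ∈ Icc 0 η₀, Q η ∈ D ∧ foot D (Q η) ∈ U := fun η hη => by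
    apply hball
    rw [Real.dist_eq, sub_zero, abs_of_nonneg hη.1]
    linarith [hη.2]
  have hC : IsPreconnected ((fun η => foot D (Q η)) '' Icc 0 η₀) :=
    isPreconnected_Icc.image _ (hD.continuousOn_foot.comp hQc.continuousOn fun η hη => (hI η hη).1)
  have hCs : (fun η => foot D (Q η)) '' Icc 0 η₀ ⊆ singularity D := by
    rintro _ ⟨η, hη, rfl⟩
    exact hD.foot_mem_singularity (hI η hη).1
  have hne : foot D (Q η₀) ≠ r.1 := by
    intro he
    have hf := hD.isFoot_foot (hI η₀ ⟨hη₀pos.le, le_rfl⟩).1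
    rw [he] at hf
    have h1 := hf.mink_nonpos hD (z := σ • P) fun a ha => by
      rw [mink_smul_left, mink_comm]; exact hside a ha
    rw [show Q η₀ - r.1 = x + (η₀ * σ) • P by simp only [hQ]; abel, mink_add_right,
      mink_smul_right, mink_smul_left, mink_smul_left, mink_comm P x, hxP] at h1
    have h2 : η₀ * (σ * σ) * mink P P ≤ 0 := by linarith
    rw [hσ, mul_one] at h2
    nlinarith [mul_pos hη₀pos hPP]
  obtain ⟨b, hrb, t, ht0, ht1, η, hη, hc⟩ := exists_edge_mem_of_isPreconnected hD hG hinj hsing hC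
    hCs ⟨0, ⟨le_rfl, hη₀pos.le⟩, by simp only [hQ0]; exact hD.foot_eq hfr⟩
    ⟨η₀, ⟨hη₀pos.le, le_rfl⟩, rfl⟩ hne
  obtain ⟨hηD, hηU⟩ := hI η hη
  simp only at hc
  have hf := hD.isFoot_foot hηD
  rw [hc] at hf hηU
  obtain ⟨m₁, m₂, hcE, k, -, hk⟩ := exists_isEdgePoint_of_segment hD
    (fun e => hrb.ne (Subtype.ext e)) (fun x hx => by
      rw [hsing]; exact Or.inr ⟨r, b, hrb, hx⟩) ht0 ht1
  have hdk : r.1 + t • (b.1 - r.1) - r.1 = (t * k) • perp m₁ m₂ := by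
    rw [add_sub_cancel_left, hk, smul_smul]
  set c := r.1 + t • (b.1 - r.1)
  refine ⟨c, hηU, ?_⟩
  -- `d` is the displacement along the edge and `w` the direction from the foot to `Q η`.
  set d := c - r.1 with hd
  set w := Q η - c with hw
  have hdw : x + (η * σ) • P = d + w := by simp only [hd, hw, hQ]; abel
  have hdm : ∀ a ∈ nullNormals D c, mink d a = 0 := fun a ha => by
    rw [hdk, mink_smul_left]
    rcases hcE.eq_or_eq ha with rfl | rfl
    · rw [mink_perp_left hcE.1.1, mul_zero]
    · rw [mink_perp_right hcE.2.1.1, mul_zero]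
  have hsub : ∀ a ∈ nullNormals D c, a ∈ nullNormals D r.1 := fun a ha => by
    refine nullNormals_of_orth ha ?_
    rw [show r.1 - c = -d by rw [hd]; abel, mink_neg_left, hdm a ha, neg_zero]
  have hw1 : σ * mink w P ≤ 0 := by
    have := hf.mink_nonpos hD (z := σ • P) fun a ha => by
      rw [mink_smul_left, mink_comm]; exact hside a (hsub a ha)
    rwa [mink_smul_left, mink_comm] at this
  have hd1 : 0 ≤ σ * mink d P := by
    have h1 : mink (d + w) P = η * σ * mink P P := by
      rw [← hdw, mink_add_left, mink_smul_left, hxP, zero_add]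
    rw [mink_add_left] at h1
    have h2 : σ * mink d P + σ * mink w P = η * (σ * σ) * mink P P := by
      rw [← mul_add, h1]; ring
    rw [hσ, mul_one] at h2
    have := mul_nonneg hη.1 hPP.le
    linarith
  have hdw0 : mink d w = 0 := by
    obtain ⟨α, β, -, -, e⟩ := hf.eq_add_of_isEdgePoint hD hcE
    rw [← hw] at e
    rw [e, mink_add_right, mink_smul_right, mink_smul_right, hdm _ hcE.1, hdm _ hcE.2.1]
    ring
  have hdn := mink_sub_le_of_mem_closure hn.2 hf.1
  have hdm' := mink_sub_le_of_mem_closure hm.2 hf.1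
  rw [← hd] at hdn hdm'
  have hwn := hf.2.1.mink_dirs_neg hn.1
  have hwm := hf.2.1.mink_dirs_neg hm.1
  have hK := dirs_mink_neg hn.1 hm.1 hnm
  have hexp : mink d w = (mink d m / mink n m) * mink n w + (mink d n / mink n m) * mink m w
      + mink d P * mink w P / mink P P := by
    conv_lhs => rw [dirs_decomposition hn.1 hm.1 hnm d]
    rw [mink_add_left, mink_add_left, mink_smul_left, mink_smul_left, mink_smul_left, ← hP,
      mink_comm P w]
    ring
  have t1 : (mink d m / mink n m) * mink n w ≤ 0 :=
    mul_nonpos_of_nonneg_of_nonpos (div_nonneg_of_nonpos hdm' hK.le) hwn.le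
  have t2 : (mink d n / mink n m) * mink m w ≤ 0 :=
    mul_nonpos_of_nonneg_of_nonpos (div_nonneg_of_nonpos hdn hK.le) hwm.le
  have t3 : mink d P * mink w P / mink P P ≤ 0 := by
    refine div_nonpos_of_nonpos_of_nonneg ?_ hPP.le
    have : mink d P * mink w P = (σ * mink d P) * (σ * mink w P) := by
      linear_combination (-(mink d P * mink w P)) * hσ
    rw [this]
    exact mul_nonpos_of_nonneg_of_nonpos hd1 hw1
  have z1 : mink d m = 0 := by
    have : (mink d m / mink n m) * mink n w = 0 := by linarith
    rcases mul_eq_zero.1 this with h | h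
    · exact (div_eq_zero_iff.1 h).resolve_right hK.ne
    · exact absurd h hwn.ne
  have z2 : mink d n = 0 := by
    have : (mink d n / mink n m) * mink m w = 0 := by linarith
    rcases mul_eq_zero.1 this with h | h
    · exact (div_eq_zero_iff.1 h).resolve_right hK.ne
    · exact absurd h hwm.ne
  exact hcE.of_nullNormals (nullNormals_of_orth hn z2) (nullNormals_of_orth hm z1) hnm

/-- A seen leaf is dual to an edge that has a point in the past of the observer. -/
theorem exists_isEdgePoint_of_mem_seenLeaves {D : Set Mink} (hD : IsDomainOfDependence D)
    (hT : HasSimplicialDualTree D) {p : Mink} {l : Set Mink} (hl : l ∈ seenLeaves D p) :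
    ∃ s n m, IsEdgePoint D s n m ∧ s ∈ chronPast p ∧ l = geod n m := by
  obtain ⟨hll, x, hxl, y, ⟨hyc, hy⟩, hyp⟩ := hl
  obtain ⟨r, n, m, σ, hr, hn, hm, hnm, hσ, hside, rfl⟩ := exists_of_mem_leaves hD hll
  obtain ⟨α, β, hα, hβ, hx⟩ := exists_pos_coeff_of_orth_perp hn.1 hm.1 hnm (hyp_timelike hxl.1)
    hxl.2
  have hfr := isFoot_add_dirs hr hn hm hnm hα hβ
  by_cases hyr : y = r
  · subst hyr
    obtain ⟨V, G, hG, -, hinj, hsing⟩ := hT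
    rcases mem_or_exists_isEdgePoint hD hsing (hD.mem_singularity_iff.2 ⟨_, hfr⟩) with hV | hE
    · obtain ⟨c, hc, hcE⟩ := exists_isEdgePoint_near_vertex hD hG.connected hinj hsing (r := ⟨y, hV⟩)
        hr hn hm hnm hσ hside (isOpen_chronPast p) hyp
      exact ⟨c, n, m, hcE, hc, rfl⟩
    · obtain ⟨a, b, hE⟩ := hE
      exact ⟨y, n, m, hE.of_nullNormals hn hm hnm, hyp, rfl⟩
  · -- The segment from `y` to `r` lies in the support face, so it is dual to the leaf.
    have h1 : 0 ≤ mink (y - r) x := by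
      have := mink_sub_le_of_mem_closure (a := y) (n := x) (c := 0)
        (fun z hz => by rw [mink_sub_left]; linarith [hy z hz]) hr
      rw [mink_sub_left] at *
      linarith
    have h2 := mink_sub_le_of_mem_closure hn.2 hyc
    have h3 := mink_sub_le_of_mem_closure hm.2 hyc
    rw [hx, mink_add_right, mink_smul_right, mink_smul_right] at h1
    have h4 : mink (y - r) n = 0 := by
      have := mul_nonpos_of_nonneg_of_nonpos hβ.le h3
      have h5 : 0 ≤ α * mink (y - r) n := by linarith
      exact le_antisymm h2 (nonneg_of_mul_nonneg_right h5 hα)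
    have h5 : mink (y - r) m = 0 := by
      have h6 : 0 ≤ β * mink (y - r) m := by rw [h4] at h1; linarith
      exact le_antisymm h3 (nonneg_of_mul_nonneg_right h6 hβ)
    have hcont : Continuous fun t : ℝ => y + t • (r - y) := by fun_prop
    have hev : ∀ᶠ t : ℝ in 𝓝 0, y + t • (r - y) ∈ chronPast p ∧ t < 1 :=
      (hcont.tendsto 0 |>.eventually ((isOpen_chronPast p).mem_nhds (by simpa using hyp))).and
        (gt_mem_nhds zero_lt_one)
    obtain ⟨t, ⟨htp, ht1⟩, ht0⟩ := ((hev.filter_mono nhdsWithin_le_nhds).and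
      (self_mem_nhdsWithin (s := Ioi (0 : ℝ)))).exists
    have ht0' : (0 : ℝ) < t := ht0
    set s := y + t • (r - y) with hs
    have hsr : s - r = (1 - t) • (y - r) := by rw [hs]; module
    have hns : n ∈ nullNormals D s :=
      nullNormals_of_orth hn (by rw [hsr, mink_smul_left, h4, mul_zero])
    have hms : m ∈ nullNormals D s :=
      nullNormals_of_orth hm (by rw [hsr, mink_smul_left, h5, mul_zero])
    have hsc : s ∈ closure D := hD.closure_convex.add_smul_sub_mem hyc hr ⟨ht0'.le, ht1.le⟩
    obtain ⟨a, b, hE, -⟩ := (isFoot_add_dirs hsc hns hms hnm one_pos one_pos).exists_isEdgePoint hD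
      hyc hr ht0' ht1 hyr hs
    exact ⟨s, n, m, hE.of_nullNormals hns hms hnm, htp, rfl⟩

theorem IsEdgePoint.stratum_eq {D : Set Mink} (hD : IsDomainOfDependence D) {s n m : Mink}
    (h : IsEdgePoint D s n m) : geod n m = stratum D s := by
  ext x
  constructor
  · rintro ⟨hx, hp⟩
    obtain ⟨α, β, hα, hβ, e⟩ := exists_pos_coeff_of_orth_perp h.1.1 h.2.1.1 h.2.2.1
      (hyp_timelike hx) hp
    refine ⟨hx, ?_⟩
    have := add_mem_nullHull hD h.mem_closure h.1 h.2.1 h.1 hα.le hβ.le le_rfl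
    rwa [zero_smul, zero_add, ← e] at this
  · intro hx
    refine ⟨hx.1, ?_⟩
    obtain ⟨-, -, -, ε, hε, he⟩ := id h
    have h1 := mink_nonpos_of_mem_stratum hD h.mem_closure hx (he ε (by rw [abs_of_pos hε]))
    have h2 := mink_nonpos_of_mem_stratum hD h.mem_closure hx
      (he (-ε) (by rw [abs_neg, abs_of_pos hε]))
    rw [add_sub_cancel_left, mink_smul_left, mink_comm] at h1 h2
    nlinarith

/-- The geodesic dual to an edge with a point in the past of the observer is a seen leaf. -/
theorem IsEdgePoint.geod_mem_seenLeaves {D : Set Mink} (hD : IsDomainOfDependence D)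
    {p s n m : Mink} (h : IsEdgePoint D s n m) (hs : s ∈ chronPast p) :
    geod n m ∈ seenLeaves D p := by
  refine ⟨⟨isGeodesic_geod h.1.1 h.2.1.1 h.2.2.1, Or.inl ⟨s, h.mem_singularity hD, fun hv => ?_,
    h.stratum_eq hD⟩⟩, ?_⟩
  · have h1 := hv.2
    rw [hD.nullDirs_eq h.mem_closure, h.nullNormals_eq, Set.encard_pair h.2.2.1] at h1
    exact absurd h1 (by decide)
  · obtain ⟨c, hc, hx⟩ := normalize_mem_geod h.1.1 h.2.1.1 h.2.2.1 one_pos one_pos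
    refine ⟨_, hx, s, ⟨h.mem_closure, fun y hy => ?_⟩, hs⟩
    have h1 := (isFoot_add_dirs h.mem_closure h.1 h.2.1 h.2.2.1 one_pos one_pos).2.2 y hy
    rw [add_sub_cancel_left, mink_sub_left] at h1
    rw [mink_smul_right, mink_smul_right]
    nlinarith

/-! ### The intensity as a function of the light ray -/

/-- The point where the past light ray from `p` in the direction `-m` leaves `D`. -/
def hit (D : Set Mink) (p v m : Mink) : Mink := boundaryHit D p v (v + (mink m v)⁻¹ • m)

/-- The intensity seen by the observer `(p, v)` in the direction of the light ray spanned
by `m`. -/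
def rayIntensity (D : Set Mink) (p v m : Mink) : ℝ := iota D v (projPerp v (hit D p v m))

theorem mem_unitTangent {v m : Mink} (hv : v ∈ hyp) (hm : m ∈ dirs) :
    v + (mink m v)⁻¹ • m ∈ unitTangent v := by
  have h := ((hyp_timelike hv).mink_dirs_neg hm).ne
  constructor
  · rw [mink_add_left, mink_smul_left, hv.1, inv_mul_cancel₀ h]; ring
  · simp only [mink_add_left, mink_add_right, mink_smul_left, mink_smul_right, hv.1, hm.1.1,
      mink_comm v m]
    field_simp
    ring

theorem rayIntensity_eq_intensity (D : Set Mink) (p : Mink) {v m : Mink} (hv : v ∈ hyp)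
    (hm : m ∈ dirs) :
    rayIntensity D p v m = intensity D p v ⟨_, mem_unitTangent hv hm⟩ := rfl

section Hit

variable {D : Set Mink} {p v m : Mink}

theorem hit_eq (hD : IsDomainOfDependence D) (hp : p ∈ D) (hv : v ∈ hyp) (hm : m ∈ dirs)
    {q : Mink} (hq : q ∈ frontier D) {c : ℝ} (hc : p - q = c • m) : hit D p v m = q := by
  have hmv := (hyp_timelike hv).mink_dirs_neg hm
  obtain ⟨hqc, hqD⟩ := hD.mem_frontier_iff.1 hq
  have hq' : q = p - c • m := by rw [← hc]; abel
  have hc0 : 0 < c := by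
    by_contra hle
    push Not at hle
    apply hqD
    rw [hq', sub_eq_add_neg, ← neg_smul]
    exact hD.add_mem hp ((dirs_causal hm).smul (by linarith))
  set t := c * -mink m v with ht
  have ht0 : 0 < t := mul_pos hc0 (by linarith)
  set u := v + (mink m v)⁻¹ • m with hu
  have huv : u - v = (mink m v)⁻¹ • m := by rw [hu]; abel
  have hqt : q = p + t • (u - v) := by
    rw [hq', huv, smul_smul, ht, sub_eq_add_neg, ← neg_smul]
    congr 2
    rw [mul_neg, neg_mul, mul_assoc, mul_inv_cancel₀ hmv.ne, mul_one]
  have hset : {s : ℝ | 0 ≤ s ∧ p + s • (u - v) ∈ D} = Ico 0 t := by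
    ext s
    constructor
    · rintro ⟨hs0, hs⟩
      refine ⟨hs0, ?_⟩
      by_contra hle
      push Not at hle
      have hspos : 0 < s := ht0.trans_le hle
      apply hqD
      have := hD.convex.add_smul_sub_mem hp hs (t := t / s) ⟨by positivity, (div_le_one hspos).2 hle⟩
      rwa [add_sub_cancel_left, smul_smul, div_mul_cancel₀ _ hspos.ne', ← hqt] at this
    · rintro ⟨hs0, hst⟩
      refine ⟨hs0, ?_⟩
      have := hD.add_smul_sub_mem hqc hp (t := 1 - s / t)
        (by rw [sub_pos, div_lt_one ht0]; exact hst) (by have := div_nonneg hs0 ht0.le; linarith)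
      have e : q + (1 - s / t) • (p - q) = p + s • (u - v) := by
        have h1 : p - q = (-t) • (u - v) := by rw [hqt, neg_smul]; abel
        rw [h1, hqt, smul_smul, show (1 - s / t) * -t = s - t by field_simp; ring, sub_smul]
        abel
      rwa [e] at this
  rw [hit, boundaryHit, hset, csSup_Ico ht0, ← hqt]

theorem exists_hit (hD : IsDomainOfDependence D) (hp : p ∈ D) (hv : v ∈ hyp) (hm : m ∈ dirs) :
    hit D p v m ∈ frontier D ∧ ∃ c : ℝ, 0 < c ∧ p - hit D p v m = c • m := by
  obtain ⟨w, C, hw, hC⟩ := hD.exists_bound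
  have hmw := hw.mink_dirs_neg hm
  have hcont : Continuous fun c : ℝ => p - c • m := by fun_prop
  have hpre : IsPreconnected ((fun c : ℝ => p - c • m) '' Ici 0) :=
    isPreconnected_Ici.image _ hcont.continuousOn
  -- Far along the ray the linear form bounded on `D` exceeds its bound.
  set c₁ := (|C| + |mink p w| + 1) / -mink m w with hc₁
  have hc₁0 : 0 ≤ c₁ := div_nonneg (by positivity) (by linarith)
  have hout : p - c₁ • m ∉ closure D := fun hin => by
    have h1 := hC _ hin
    rw [mink_sub_left, mink_smul_left] at h1
    have h2 : c₁ * -mink m w = |C| + |mink p w| + 1 :=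
      div_mul_cancel₀ _ (neg_pos.2 hmw).ne'
    linarith [le_abs_self C, neg_abs_le (mink p w)]
  obtain ⟨q, ⟨c, hc, hcq⟩, hq⟩ :
      (((fun c : ℝ => p - c • m) '' Ici 0) ∩ frontier D).Nonempty := by
    by_contra hemp
    obtain ⟨y, -, hy, hy'⟩ := hpre D (closure D)ᶜ hD.isOpen isClosed_closure.isOpen_compl
      (fun y hy => by
        by_contra h
        rw [mem_union, not_or, mem_compl_iff, not_not] at h
        exact hemp ⟨y, hy, hD.mem_frontier_iff.2 ⟨h.2, h.1⟩⟩)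
      ⟨p, ⟨0, self_mem_Ici, by simp⟩, hp⟩ ⟨_, ⟨c₁, hc₁0, rfl⟩, hout⟩
    exact hy' (subset_closure hy)
  have hpq : p - q = c • m := by rw [← hcq]; simp
  have hc0 : 0 < c := by
    refine lt_of_le_of_ne hc fun h0 => (hD.mem_frontier_iff.1 hq).2 ?_
    rw [← h0, zero_smul, sub_eq_zero] at hpq
    rwa [← hpq]
  rw [hit_eq hD hp hv hm hq hpq]
  exact ⟨hq, c, hc0, hpq⟩

theorem tendsto_hit (hD : IsDomainOfDependence D) (hp : p ∈ D) (hv : v ∈ hyp) (hm : m ∈ dirs) :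
    Tendsto (hit D p v) (𝓝[dirs] m) (𝓝 (hit D p v m)) := by
  refine (hD.isCompact_past p).tendsto_nhds_of_unique_mapClusterPt ?_ ?_
  · filter_upwards [self_mem_nhdsWithin] with x hx
    obtain ⟨h1, c, hc, h2⟩ := exists_hit hD hp hv hx
    exact ⟨frontier_subset_closure h1, by rw [h2]; exact (dirs_causal hx).smul hc.le⟩
  · intro y _ hy
    obtain ⟨U, hU, hUy⟩ := mapClusterPt_iff_ultrafilter.1 hy
    have hid : Tendsto id (U : Filter Mink) (𝓝 m) := hU.trans nhdsWithin_le_nhds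
    have hmem : ∀ᶠ x in (U : Filter Mink), x ∈ dirs := hU self_mem_nhdsWithin
    have hyf : y ∈ frontier D := isClosed_frontier.mem_of_tendsto hUy
      (hmem.mono fun x hx => (exists_hit hD hp hv hx).1)
    have h0 : Continuous fun z : Mink => (p - z) 0 := by fun_prop
    have hc : p - y = (p - y) 0 • m := by
      refine tendsto_nhds_unique (hUy.const_sub p) ?_
      refine (((h0.tendsto y).comp hUy).smul hid).congr' ?_
      filter_upwards [hmem] with x hx
      obtain ⟨-, c, -, h2⟩ := exists_hit hD hp hv hx
      simp only [Function.comp_apply, h2, id, Pi.smul_apply, hx.2, smul_eq_mul, mul_one]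
    exact (hit_eq hD hp hv hm hyf hc).symm

end Hit

/-- The direction of the light ray from `p` through the point at which the half-line from `p - w`
in the direction `n` meets the past light cone of `p`. -/
def rayDir (w n : Mink) : Mink :=
  ((w - (mink w w / (2 * mink w n)) • n) 0)⁻¹ • (w - (mink w w / (2 * mink w n)) • n)

theorem rayDir_spec {w n : Mink} (hw : FutureTimelike w) (hn : n ∈ dirs) :
    rayDir w n ∈ dirs ∧ ∃ α c : ℝ, 0 < α ∧ 0 < c ∧ w - α • n = c • rayDir w n := by
  have hwn : mink w n < 0 := by rw [mink_comm]; exact hw.mink_dirs_neg hn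
  have hwn0 := hwn.ne
  have hα : 0 < mink w w / (2 * mink w n) := div_pos_of_neg_of_neg hw.1 (by linarith)
  have hnull : mink (w - (mink w w / (2 * mink w n)) • n) (w - (mink w w / (2 * mink w n)) • n)
      = 0 := by
    simp only [mink_sub_left, mink_sub_right, mink_smul_left, mink_smul_right, hn.1.1,
      mink_comm n w]
    field_simp; ring
  have hwk : mink (w - (mink w w / (2 * mink w n)) • n) w < 0 := by
    have : mink (w - (mink w w / (2 * mink w n)) • n) w = mink w w / 2 := by
      rw [mink_sub_left, mink_smul_left, mink_comm n w]; field_simp; ring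
    rw [this]; linarith [hw.1]
  unfold rayDir
  set α := mink w w / (2 * mink w n)
  set k := w - α • n
  have hk0 : 0 < k 0 := by
    by_contra hle
    push Not at hle
    have h1 : FutureCausal (-k) := by
      refine ⟨?_, by simpa using hle⟩
      rw [mink_neg_left, mink_neg_right, neg_neg, hnull]
    have := h1.mink_nonpos hw.causal
    rw [mink_neg_left] at this
    linarith
  refine ⟨FutureNull.normalize ⟨hnull, hk0⟩, α, k 0, hα, hk0, ?_⟩
  rw [smul_smul, mul_inv_cancel₀ hk0.ne', one_smul]

theorem rayDir_add {m n : Mink} (hm : m ∈ dirs) (hn : n ∈ dirs) (h : m ≠ n) {b c : ℝ}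
    (hc : 0 < c) : rayDir (c • m + b • n) n = m := by
  have hk := (dirs_mink_neg hm hn h).ne
  have e : mink (c • m + b • n) (c • m + b • n) / (2 * mink (c • m + b • n) n) = b := by
    simp only [mink_add_left, mink_add_right, mink_smul_left, mink_smul_right, hn.1.1, hm.1.1,
      mink_comm n m]
    field_simp; ring
  rw [rayDir, e, add_sub_cancel_right]
  simp [hm.2, smul_smul, hc.ne']

theorem continuousAt_rayDir {w n : Mink} (hw : FutureTimelike w) (hn : n ∈ dirs) :
    ContinuousAt (fun x : Mink × Mink => rayDir x.1 x.2) (w, n) := by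
  obtain ⟨h1, α, c, hα, hc, h2⟩ := rayDir_spec hw hn
  have hwn : mink w n < 0 := by rw [mink_comm]; exact hw.mink_dirs_neg hn
  have hA : ContinuousAt (fun x : Mink × Mink => mink x.1 x.1 / (2 * mink x.1 x.2)) (w, n) := by
    refine ContinuousAt.div (Continuous.continuousAt (by fun_prop))
      (Continuous.continuousAt (by fun_prop)) ?_
    simp only
    linarith
  have hB : ContinuousAt (fun x : Mink × Mink =>
      x.1 - (mink x.1 x.1 / (2 * mink x.1 x.2)) • x.2) (w, n) :=
    continuousAt_fst.sub (hA.smul continuousAt_snd)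
  have hC : ContinuousAt (fun x : Mink × Mink =>
      (x.1 - (mink x.1 x.1 / (2 * mink x.1 x.2)) • x.2) 0) (w, n) :=
    (continuous_apply 0).continuousAt.comp hB
  refine (hC.inv₀ ?_).smul hB
  simp only
  intro h0
  rw [rayDir, h0, inv_zero, zero_smul] at h1
  exact dirs_ne_zero h1 rfl

/-- The intensity along the lightlike strip spanned by an edge and one of its null directions. -/
theorem rayIntensity_strip {D : Set Mink} (hD : IsDomainOfDependence D) {p v s n₁ n₂ : Mink}
    (hv : v ∈ hyp) (hs : IsEdgePoint D s n₁ n₂) (hsp : s ∈ chronPast p) :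
    ∃ A B : ℝ, B < 0 ∧ ∀ᶠ m in 𝓝[dirs] rayDir (p - s) n₁, 0 < rayIntensity D p v m ∧
      mink m n₁ ≠ 0 ∧ rayIntensity D p v m * mink m n₁ = A * mink m n₁ + B * mink m n₂ := by
  obtain ⟨hn₁, hn₂, hne, ε, hε, he⟩ := id hs
  have hsp' : FutureTimelike (p - s) := hsp
  have hp : p ∈ D := hD.mem_of_timelike hs.mem_closure hsp'
  obtain ⟨hm₀, α₀, c₀, hα₀, hc₀, hw₀⟩ := rayDir_spec hsp' hn₁.1
  set m₀ := rayDir (p - s) n₁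
  set w := p - s with hw
  set P := perp n₁ n₂ with hP
  have hk := dirs_mink_neg hn₁.1 hn₂.1 hne
  have hPP := mink_perp_self_pos hn₁.1 hn₂.1 hne
  have hwn : mink w n₁ < 0 := by rw [mink_comm]; exact hsp'.mink_dirs_neg hn₁.1
  have hn₁v := (hyp_timelike hv).mink_dirs_neg hn₁.1
  have hcm₀ : c₀ * mink m₀ n₁ = mink w n₁ := by
    rw [← mink_smul_left, ← hw₀, mink_sub_left, mink_smul_left, hn₁.1.1.1]; ring
  have hm₀n : mink m₀ n₁ ≠ 0 := by
    intro h0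
    rw [h0, mul_zero] at hcm₀
    linarith
  have hcc₀ : mink w n₁ / mink m₀ n₁ = c₀ := by rw [← hcm₀, mul_div_cancel_right₀ _ hm₀n]
  set X : Mink → Mink := fun m => w - (mink w n₁ / mink m n₁) • m with hX
  have hXm₀ : X m₀ = α₀ • n₁ := by
    simp only [hX]; rw [hcc₀, ← hw₀]; abel
  have hXc : Tendsto X (𝓝[dirs] m₀) (𝓝 (α₀ • n₁)) := by
    rw [← hXm₀]
    have h1 : ContinuousAt (fun m : Mink => mink w n₁ / mink m n₁) m₀ :=
      continuousAt_const.div (Continuous.continuousAt (by fun_prop)) hm₀n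
    exact (ContinuousAt.tendsto (continuousAt_const.sub (h1.smul continuousAt_id))).mono_left
      nhdsWithin_le_nhds
  have e1 : ∀ᶠ m in 𝓝[dirs] m₀, mink m n₁ ≠ 0 := by
    have hc : Continuous fun m => mink m n₁ := by fun_prop
    exact (hc.continuousAt.eventually_ne hm₀n).filter_mono nhdsWithin_le_nhds
  have e2 : ∀ᶠ m in 𝓝[dirs] m₀, mink (X m) n₂ < 0 := by
    refine (tendsto_mink hXc tendsto_const_nhds).eventually (gt_mem_nhds ?_)
    rw [mink_smul_left]
    exact mul_neg_of_pos_of_neg hα₀ hk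
  have e3 : ∀ᶠ m in 𝓝[dirs] m₀, |mink (X m) P / mink P P| < ε := by
    have h1 := ((tendsto_mink hXc (tendsto_const_nhds (x := P))).div_const (mink P P)).abs
    rw [mink_smul_left, mink_comm n₁ P, mink_perp_left hn₁.1, mul_zero, zero_div, abs_zero] at h1
    exact h1.eventually (gt_mem_nhds hε)
  refine ⟨-mink n₁ v / mink n₁ n₂ * mink w n₂, mink n₁ v / mink n₁ n₂ * mink w n₁,
    mul_neg_of_pos_of_neg (div_pos_of_neg_of_neg hn₁v hk) hwn, ?_⟩
  filter_upwards [e1, e2, e3, self_mem_nhdsWithin] with m h1 h2 h3 hm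
  have hXn : mink (X m) n₁ = 0 := by
    simp only [hX, mink_sub_left, mink_smul_left]
    field_simp; ring
  have hdec := dirs_decomposition hn₁.1 hn₂.1 hne (X m)
  rw [hXn, zero_div, zero_smul, add_zero, ← hP] at hdec
  set α := mink (X m) n₂ / mink n₁ n₂ with hα
  set lam := mink (X m) P / mink P P
  have hαpos : 0 < α := div_pos_of_neg_of_neg h2 hk
  set s' := s + lam • P with hs'
  have hs'c : s' ∈ closure D := he lam h3.le
  have hPn₁ : mink (s' - s) n₁ = 0 := by
    rw [hs', add_sub_cancel_left, mink_smul_left, mink_perp_left hn₁.1, mul_zero]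
  have hPn₂ : mink (s' - s) n₂ = 0 := by
    rw [hs', add_sub_cancel_left, mink_smul_left, mink_perp_right hn₂.1, mul_zero]
  have hn₂' := nullNormals_of_orth hn₂ hPn₂
  set q := s' + α • n₁ with hq
  have hqX : q = s + X m := by rw [hq, hs', hdec]; abel
  have hpq : p - q = (mink w n₁ / mink m n₁) • m := by
    rw [hqX]; simp only [hX, hw]; abel
  have hrs : IsRayStart D q n₁ α := by
    refine ⟨nullNormals_of_orth (nullNormals_of_orth hn₁ hPn₁) ?_, hαpos.le, ?_, fun c hc => ?_⟩
    · rw [hq, add_sub_cancel_left, mink_smul_left, hn₁.1.1.1, mul_zero]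
    · rwa [hq, add_sub_cancel_right]
    · have h4 := mink_sub_le_of_mem_closure hn₂'.2 hc
      rw [show q - c • n₁ - s' = (α - c) • n₁ by rw [hq, sub_smul]; abel, mink_smul_left] at h4
      by_contra hlt
      push Not at hlt
      nlinarith
  have hqf : q ∈ frontier D :=
    hD.mem_frontier_iff.2 ⟨hrs.mem_closure hD, hD.notMem_of_nullNormal hrs.1⟩
  have hval : rayIntensity D p v m = α * -mink n₁ v := by
    rw [rayIntensity, hit_eq hD hp hv hm hqf hpq, hD.iota_eq hv hrs]
  refine ⟨by rw [hval]; exact mul_pos hαpos (by linarith), h1, ?_⟩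
  rw [hval, hα]
  simp only [hX, mink_sub_left, mink_smul_left]
  field_simp
  ring

/-! ### Analytic continuation along the circle of light rays -/

/-- The lightlike direction with angle `φ`. -/
def angleDir (φ : ℝ) : Mink := ![1, Real.cos φ, Real.sin φ]

theorem angleDir_mem (φ : ℝ) : angleDir φ ∈ dirs :=
  mem_dirs_iff.2 ⟨rfl, by simp [angleDir]⟩

theorem exists_angleDir_eq {m : Mink} (hm : m ∈ dirs) : ∃ φ, angleDir φ = m := by
  obtain ⟨h0, h1⟩ := mem_dirs_iff.1 hm
  have hn : ‖(⟨m 1, m 2⟩ : ℂ)‖ = 1 := by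
    rw [Complex.norm_def, Complex.normSq_mk, Real.sqrt_eq_one]
    linarith
  have hz : (⟨m 1, m 2⟩ : ℂ) ≠ 0 := by
    rw [← norm_ne_zero_iff, hn]; exact one_ne_zero
  refine ⟨Complex.arg ⟨m 1, m 2⟩, ?_⟩
  funext i
  fin_cases i
  · simp [angleDir, h0]
  · simp [angleDir, Complex.cos_arg hz, hn]
  · simp [angleDir, Complex.sin_arg, hn]

theorem continuous_angleDir : Continuous angleDir := by
  refine continuous_pi fun i => ?_
  fin_cases i
  · exact continuous_const
  · exact Real.continuous_cos
  · exact Real.continuous_sin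

theorem tendsto_angleDir (φ : ℝ) : Tendsto angleDir (𝓝 φ) (𝓝[dirs] angleDir φ) :=
  tendsto_nhdsWithin_iff.2 ⟨continuous_angleDir.tendsto φ, Eventually.of_forall angleDir_mem⟩

theorem analyticAt_mink_angleDir (x : Mink) (φ : ℝ) :
    AnalyticAt ℝ (fun φ => mink (angleDir φ) x) φ := by
  simp only [mink, angleDir, Matrix.cons_val_zero, Matrix.cons_val_one, Matrix.cons_val]
  fun_prop

/-- A quadratic relation between lightlike directions that holds on an arc holds everywhere. -/
theorem eq_of_eventually_eq_arc {a b c d e f g h : Mink} {φ₀ : ℝ}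
    (hev : ∀ᶠ φ in 𝓝 φ₀, mink (angleDir φ) a * mink (angleDir φ) b
      + mink (angleDir φ) c * mink (angleDir φ) d
      = mink (angleDir φ) e * mink (angleDir φ) f + mink (angleDir φ) g * mink (angleDir φ) h)
    {m : Mink} (hm : m ∈ dirs) :
    mink m a * mink m b + mink m c * mink m d = mink m e * mink m f + mink m g * mink m h := by
  obtain ⟨φ, rfl⟩ := exists_angleDir_eq hm
  have key : ∀ a b c d : Mink, AnalyticOnNhd ℝ (fun φ => mink (angleDir φ) a * mink (angleDir φ) b
      + mink (angleDir φ) c * mink (angleDir φ) d) univ := fun a b c d φ _ =>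
    ((analyticAt_mink_angleDir a φ).mul (analyticAt_mink_angleDir b φ)).add
      ((analyticAt_mink_angleDir c φ).mul (analyticAt_mink_angleDir d φ))
  exact (key a b c d).eqOn_of_preconnected_of_eventuallyEq (key e f g h) isPreconnected_univ
    (mem_univ φ₀) hev (mem_univ φ)

/-- The intensity along a strip determines both null directions of the edge. -/
theorem eq_of_strip_formulas {n₁ n₂ k₁ k₂ : Mink} (hn₁ : n₁ ∈ dirs) (hn₂ : n₂ ∈ dirs)
    (hn : n₁ ≠ n₂) (hk₁ : k₁ ∈ dirs) (hk₂ : k₂ ∈ dirs) (hk : k₁ ≠ k₂) {A B A' B' : ℝ} (hB : B < 0)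
    (hB' : B' < 0)
    (h : ∀ m ∈ dirs, (A * mink m n₁ + B * mink m n₂) * mink m k₁
      = (A' * mink m k₁ + B' * mink m k₂) * mink m n₁) : k₁ = n₁ ∧ k₂ = n₂ := by
  have hnn := dirs_mink_neg hn₁ hn₂ hn
  have e1 : n₁ = k₁ := by
    have h1 := h n₁ hn₁
    rw [hn₁.1.1, mul_zero, mul_zero, zero_add] at h1
    refine dirs_eq_of_orth hn₁ hk₁ ?_
    rcases mul_eq_zero.1 h1 with h2 | h2
    · exact absurd h2 (mul_pos_of_neg_of_neg hB hnn).ne'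
    · exact h2
  subst e1
  refine ⟨rfl, ?_⟩
  have hkk := dirs_mink_neg hn₁ hk₂ hk
  have h1 := mul_right_cancel₀ (by rw [mink_comm]; exact hnn.ne) (h n₂ hn₂)
  have h2 := mul_right_cancel₀ (by rw [mink_comm]; exact hkk.ne) (h k₂ hk₂)
  simp only [hn₂.1.1, hk₂.1.1, mul_zero, add_zero, mink_comm n₂ n₁, mink_comm k₂ n₁,
    mink_comm n₂ k₂] at h1 h2
  have h3 : mink k₂ n₂ * (B * mink n₁ n₂ + B' * mink n₁ k₂) = 0 := by
    linear_combination mink n₁ n₂ * h2 - mink n₁ k₂ * h1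
  have h4 : 0 < B * mink n₁ n₂ + B' * mink n₁ k₂ :=
    add_pos (mul_pos_of_neg_of_neg hB hnn) (mul_pos_of_neg_of_neg hB' hkk)
  exact dirs_eq_of_orth hk₂ hn₂ ((mul_eq_zero.1 h3).resolve_right h4.ne')

/-! ### Strips and fans in the boundary -/

/-- If `n₁` and `n₂` span a vector that is nearly orthogonal to `n`, relative to its height, then
one of them is close to `n`. -/
theorem exists_norm_sub_lt {n n₁ n₂ w : Mink} (hn : n ∈ dirs) (hn₁ : n₁ ∈ dirs) (hn₂ : n₂ ∈ dirs)
    {α β ε : ℝ} (hα : 0 ≤ α) (hβ : 0 ≤ β) (hε : 0 < ε) (hw : w = α • n₁ + β • n₂)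
    (h : -2 * mink w n < ε ^ 2 * w 0) : ‖n₁ - n‖ < ε ∨ ‖n₂ - n‖ < ε := by
  by_contra hcon
  push Not at hcon
  have h1 : ∀ x ∈ dirs, ε ≤ ‖x - n‖ → ε ^ 2 ≤ -2 * mink x n := fun x hx hle =>
    (pow_le_pow_left₀ hε.le hle 2).trans (dirs_norm_sub_sq_le hx hn)
  have h2 := mul_le_mul_of_nonneg_left (h1 n₁ hn₁ hcon.1) hα
  have h3 := mul_le_mul_of_nonneg_left (h1 n₂ hn₂ hcon.2) hβ
  rw [hw] at h
  simp only [mink_add_left, mink_smul_left, Pi.add_apply, Pi.smul_apply, hn₁.2, hn₂.2,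
    smul_eq_mul, mul_one] at h
  linarith

/-- Near a light ray with positive, continuous intensity, either an edge is met whose strip
crosses nearby light rays, or all nearby light rays end in the future light cone of one point. -/
theorem strip_or_fan {D : Set Mink} (hD : IsDomainOfDependence D) (hT : HasSimplicialDualTree D)
    {p v : Mink} (hp : p ∈ D) (hv : v ∈ hyp) {φ₀ : ℝ}
    (hpos : 0 < rayIntensity D p v (angleDir φ₀))
    (hcont : Tendsto (rayIntensity D p v) (𝓝[dirs] angleDir φ₀)
      (𝓝 (rayIntensity D p v (angleDir φ₀)))) {J : Set Mink} (hJ : J ∈ 𝓝 (angleDir φ₀)) :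
    (∃ s n₁ n₂, IsEdgePoint D s n₁ n₂ ∧ s ∈ chronPast p ∧ rayDir (p - s) n₁ ∈ J) ∨
    (∃ a ∈ chronPast p, ∀ᶠ φ in 𝓝 φ₀, mink (hit D p v (angleDir φ) - a)
        (hit D p v (angleDir φ) - a) = 0 ∧
      rayIntensity D p v (angleDir φ) = -mink (hit D p v (angleDir φ) - a) v) := by
  have hm₀ := angleDir_mem φ₀
  set m₀ := angleDir φ₀
  choose! N β hstart using fun m (hm : m ∈ dirs) =>
    hD.exists_isRayStart (exists_hit hD hp hv hm).1
  have hval : ∀ m ∈ dirs, rayIntensity D p v m = β m * -mink (N m) v := fun m hm =>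
    hD.iota_eq hv (hstart m hm)
  set q₀ := hit D p v m₀ with hq₀
  set n := N m₀
  set b := β m₀
  have hst := hstart m₀ hm₀
  rw [← hq₀] at hst
  have hn := hst.1
  have hb : 0 < b := by
    have h1 := (hyp_timelike hv).mink_dirs_neg hn.1
    rw [hval m₀ hm₀] at hpos
    exact pos_of_mul_pos_left hpos (by linarith)
  obtain ⟨c, hc, hpq⟩ := (exists_hit hD hp hv hm₀).2
  rw [← hq₀] at hpq
  have hmn : m₀ ≠ n := by
    intro h0
    have h1 := hD.nullNormal_lt hn hp
    have h2 : mink m₀ n = 0 := (congrArg (fun x => mink x n) h0).trans hn.1.1.1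
    rw [hpq, mink_smul_left, h2, mul_zero] at h1
    exact lt_irrefl _ h1
  set r₀ := q₀ - b • n with hr₀
  have hpr : p - r₀ = c • m₀ + b • n := by rw [hr₀, ← hpq]; abel
  have hrp : FutureTimelike (p - r₀) := by
    rw [hpr]; exact timelike_of_dirs hm₀ hn.1 hmn hc hb
  -- Edges near `r₀` with a null direction near `n` span strips over light rays in `J`.
  have hdir : ∀ᶠ x : Mink × Mink in 𝓝 r₀ ×ˢ 𝓝 n, rayDir (p - x.1) x.2 ∈ J := by
    have h1 := continuousAt_rayDir hrp hn.1
    have h2 : ContinuousAt (fun x : Mink × Mink => rayDir (p - x.1) x.2) (r₀, n) :=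
      ContinuousAt.comp (f := fun x : Mink × Mink => (p - x.1, x.2))
        (g := fun x : Mink × Mink => rayDir x.1 x.2) h1 (Continuous.continuousAt (by fun_prop))
    rw [← nhds_prod_eq]
    refine h2.eventually_mem ?_
    simp only
    rwa [hpr, rayDir_add hm₀ hn.1 hmn hc]
  obtain ⟨pa, hpa, pb, hpb, hpab⟩ := eventually_prod_iff.1 hdir
  obtain ⟨ε, hε, hpb'⟩ := Metric.eventually_nhds_iff.1 hpb
  set F := (𝓝[dirs] m₀) ×ˢ (𝓝[>] (0 : ℝ))
  have hfoot : Tendsto (fun i : Mink × ℝ => foot D (hit D p v i.1 + i.2 • v)) F (𝓝 r₀) := by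
    refine hD.tendsto_foot_of_height (Q := fun i : Mink × ℝ => hit D p v i.1)
      (N := fun i => N i.1) (β := fun i => β i.1) hv ((tendsto_hit hD hp hv hm₀).comp tendsto_fst)
      (tendsto_snd.mono_right nhdsWithin_le_nhds) (tendsto_snd.eventually self_mem_nhdsWithin)
      ?_ hst ?_
    · exact (tendsto_fst.eventually self_mem_nhdsWithin).mono fun i hi => hstart i.1 hi
    · rw [← hval m₀ hm₀]
      refine (hcont.comp tendsto_fst).congr' ?_
      exact (tendsto_fst.eventually self_mem_nhdsWithin).mono fun i hi => hval i.1 hi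
  have hQ : Tendsto (fun i : Mink × ℝ => hit D p v i.1 + i.2 • v) F (𝓝 q₀) := by
    have h1 : Tendsto (fun i : Mink × ℝ => i.2) F (𝓝 0) :=
      tendsto_snd.mono_right nhdsWithin_le_nhds
    simpa using ((tendsto_hit hD hp hv hm₀).comp tendsto_fst).add (h1.smul_const v)
  have hw := hQ.sub hfoot
  rw [hr₀, sub_sub_cancel] at hw
  have hsmall : ∀ᶠ i in F, -2 * mink (hit D p v i.1 + i.2 • v - foot D (hit D p v i.1 + i.2 • v)) n
      < ε ^ 2 * (hit D p v i.1 + i.2 • v - foot D (hit D p v i.1 + i.2 • v)) 0 := by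
    have h1 := (tendsto_mink hw (tendsto_const_nhds (x := n))).const_mul (-2)
    have h2 := (((continuous_apply (0 : Fin 3)).tendsto _).comp hw).const_mul (ε ^ 2)
    refine h1.eventually_lt h2 ?_
    change -2 * mink (b • n) n < ε ^ 2 * (b * n 0)
    rw [mink_smul_left, show mink n n = 0 from hn.1.1.1, show n 0 = 1 from hn.1.2, mul_zero,
      mul_zero, mul_one]
    positivity
  have hall : ∀ᶠ i in F, i.1 ∈ dirs ∧ 0 < i.2 ∧ pa (foot D (hit D p v i.1 + i.2 • v)) ∧
      foot D (hit D p v i.1 + i.2 • v) ∈ chronPast p ∧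
      -2 * mink (hit D p v i.1 + i.2 • v - foot D (hit D p v i.1 + i.2 • v)) n
      < ε ^ 2 * (hit D p v i.1 + i.2 • v - foot D (hit D p v i.1 + i.2 • v)) 0 :=
    (tendsto_fst.eventually self_mem_nhdsWithin).and <|
      (tendsto_snd.eventually self_mem_nhdsWithin).and <| (hfoot.eventually hpa).and <|
      (hfoot.eventually ((isOpen_chronPast p).mem_nhds hrp)).and hsmall
  have hinD : ∀ m ∈ dirs, ∀ δ : ℝ, 0 < δ → hit D p v m + δ • v ∈ D := fun m hm δ hδ =>
    hD.add_timelike_mem (frontier_subset_closure (exists_hit hD hp hv hm).1)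
      ((hyp_timelike hv).smul hδ)
  by_cases hcase : ∃ s n₁ n₂, IsEdgePoint D s n₁ n₂ ∧ s ∈ chronPast p ∧ rayDir (p - s) n₁ ∈ J
  · exact Or.inl hcase
  right
  -- Otherwise all feet over a small rectangle are vertices, so they coincide.
  have hno : ∀ᶠ i in F, i.1 ∈ dirs ∧ 0 < i.2 ∧ foot D (hit D p v i.1 + i.2 • v) ∈ chronPast p ∧
      ∀ n₁ n₂, ¬IsEdgePoint D (foot D (hit D p v i.1 + i.2 • v)) n₁ n₂ := by
    filter_upwards [hall] with i hi
    obtain ⟨h1, h2, h3, h4, h5⟩ := hi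
    refine ⟨h1, h2, h4, fun n₁ n₂ hE => hcase ?_⟩
    have hf := hD.isFoot_foot (hinD _ h1 _ h2)
    obtain ⟨α, β', hα, hβ', hwe⟩ := hf.eq_add_of_isEdgePoint hD hE
    rcases exists_norm_sub_lt hn.1 hE.1.1 hE.2.1.1 hα hβ' hε hwe h5 with h6 | h6
    · exact ⟨_, n₁, n₂, hE, h4, hpab h3 (hpb' (by rwa [dist_eq_norm]))⟩
    · exact ⟨_, n₂, n₁, hE.symm, h4, hpab h3 (hpb' (by rwa [dist_eq_norm]))⟩
  have hno' := ((tendsto_angleDir φ₀).prodMap (tendsto_id (x := 𝓝[>] (0 : ℝ)))).eventually hno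
  obtain ⟨ga, hga, gb, hgb, hgab⟩ := eventually_prod_iff.1 hno'
  obtain ⟨ε₁, hε₁, hga'⟩ := Metric.eventually_nhds_iff_ball.1 hga
  obtain ⟨ε₂, hε₂, hgb'⟩ := mem_nhdsGT_iff_exists_Ioo_subset.1 hgb
  have hε₂' : (0 : ℝ) < ε₂ := hε₂
  set R : Set (ℝ × ℝ) := Metric.ball φ₀ ε₁ ×ˢ Ioo 0 ε₂
  set Φ : ℝ × ℝ → Mink := fun x => hit D p v (angleDir x.1) + x.2 • v with hΦ
  have hRno : ∀ x ∈ R, foot D (Φ x) ∈ chronPast p ∧ ∀ n₁ n₂, ¬IsEdgePoint D (foot D (Φ x)) n₁ n₂ :=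
    fun x hx => (hgab (hga' x.1 hx.1) (hgb' hx.2)).2.2
  have hRD : ∀ x ∈ R, Φ x ∈ D := fun x hx => hinD _ (angleDir_mem _) _ hx.2.1
  have hΦc : Continuous Φ := by
    have h1 : Continuous fun φ => hit D p v (angleDir φ) := continuous_iff_continuousAt.2 fun φ =>
      (tendsto_hit hD hp hv (angleDir_mem φ)).comp (tendsto_angleDir φ)
    exact (h1.comp continuous_fst).add (continuous_snd.smul continuous_const)
  have hpre : IsPreconnected ((fun x => foot D (Φ x)) '' R) := by
    refine IsPreconnected.image ?_ _ (hD.continuousOn_foot.comp hΦc.continuousOn hRD)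
    exact (convex_ball φ₀ ε₁).isPreconnected.prod isPreconnected_Ioo
  have hsub : (fun x => foot D (Φ x)) '' R ⊆ singularity D := by
    rintro _ ⟨x, hx, rfl⟩
    exact hD.foot_mem_singularity (hRD x hx)
  obtain ⟨V, G, hG, -, hinj, hsing⟩ := hT
  have hconst : ∀ x ∈ R, ∀ y ∈ R, foot D (Φ x) = foot D (Φ y) := by
    intro x hx y hy
    by_contra hne
    rcases mem_or_exists_isEdgePoint hD hsing (hsub ⟨y, hy, rfl⟩) with hV | ⟨n₁, n₂, hE⟩
    · obtain ⟨b', hrb, t, ht0, ht1, z, hz, hze⟩ := exists_edge_mem_of_isPreconnected hD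
        hG.connected hinj hsing hpre hsub (r := ⟨_, hV⟩) ⟨y, hy, rfl⟩ ⟨x, hx, rfl⟩ hne
      obtain ⟨n₁, n₂, hE, -⟩ := exists_isEdgePoint_of_segment hD
        (fun e => hrb.ne (Subtype.ext e)) (fun x hx => by
          rw [hsing]; exact Or.inr ⟨_, b', hrb, hx⟩) ht0 ht1
      rw [← hze] at hE
      exact (hRno z hz).2 n₁ n₂ hE
    · exact (hRno y hy).2 n₁ n₂ hE
  have hx₀ : ((φ₀, ε₂ / 2) : ℝ × ℝ) ∈ R :=
    ⟨Metric.mem_ball_self hε₁, by constructor <;> simp only <;> linarith⟩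
  refine ⟨foot D (Φ (φ₀, ε₂ / 2)), (hRno _ hx₀).1, ?_⟩
  filter_upwards [Metric.ball_mem_nhds φ₀ hε₁] with φ hφ
  have hs := hstart _ (angleDir_mem φ)
  have hlim : hit D p v (angleDir φ) - β (angleDir φ) • N (angleDir φ)
      = foot D (Φ (φ₀, ε₂ / 2)) := by
    refine tendsto_nhds_unique (hD.tendsto_foot_vertical hv hs) ?_
    refine tendsto_const_nhds.congr' ?_
    filter_upwards [Ioo_mem_nhdsGT hε₂'] with δ hδ
    exact hconst _ hx₀ (φ, δ) ⟨hφ, hδ⟩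
  have e : hit D p v (angleDir φ) - foot D (Φ (φ₀, ε₂ / 2))
      = β (angleDir φ) • N (angleDir φ) := by rw [← hlim]; abel
  rw [e, hval _ (angleDir_mem φ), mink_smul_left, mink_smul_left, mink_smul_right, hs.1.1.1.1]
  constructor <;> ring

/-- An edge in the past of the observer can be recovered from the intensity. -/
theorem exists_isEdgePoint_of_rayIntensity_eq {D₁ D₂ : Set Mink} (hD₁ : IsDomainOfDependence D₁)
    (hD₂ : IsDomainOfDependence D₂) (hT₂ : HasSimplicialDualTree D₂) {p₁ p₂ v : Mink}
    (hp₂ : p₂ ∈ D₂) (hv : v ∈ hyp)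
    (hρ : ∀ m ∈ dirs, rayIntensity D₁ p₁ v m = rayIntensity D₂ p₂ v m) {s n₁ n₂ : Mink}
    (hs : IsEdgePoint D₁ s n₁ n₂) (hsp : s ∈ chronPast p₁) :
    ∃ s', IsEdgePoint D₂ s' n₁ n₂ ∧ s' ∈ chronPast p₂ := by
  obtain ⟨A, B, hB, hev⟩ := rayIntensity_strip hD₁ hv hs hsp
  have hm₀ := (rayDir_spec hsp hs.1.1).1
  obtain ⟨φ₀, hφ₀⟩ := exists_angleDir_eq hm₀
  rw [← hφ₀] at hev hm₀
  have h0 := hev.self_of_nhdsWithin hm₀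
  have hform : ∀ m ∈ dirs, mink m n₁ ≠ 0 →
      rayIntensity D₁ p₁ v m * mink m n₁ = A * mink m n₁ + B * mink m n₂ →
      rayIntensity D₁ p₁ v m = A + B * mink m n₂ / mink m n₁ := fun m _ h1 h2 => by
    field_simp
    linarith
  have hcont : Tendsto (rayIntensity D₂ p₂ v) (𝓝[dirs] angleDir φ₀)
      (𝓝 (rayIntensity D₂ p₂ v (angleDir φ₀))) := by
    rw [← hρ _ hm₀, hform _ hm₀ h0.2.1 h0.2.2]
    have h1 : ContinuousAt (fun m : Mink => A + B * mink m n₂ / mink m n₁) (angleDir φ₀) :=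
      continuousAt_const.add (ContinuousAt.div (Continuous.continuousAt (by fun_prop))
        (Continuous.continuousAt (by fun_prop)) h0.2.1)
    refine (h1.tendsto.mono_left nhdsWithin_le_nhds).congr' ?_
    filter_upwards [hev, self_mem_nhdsWithin] with m h2 h3
    rw [← hρ m h3, hform m h3 h2.2.1 h2.2.2]
  obtain ⟨J, hJ, hJ'⟩ := mem_nhdsWithin_iff_exists_mem_nhds_inter.1 hev
  rw [hφ₀] at hJ
  obtain ⟨J₀, hJ₀J, hJ₀o, hJ₀⟩ := mem_nhds_iff.1 hJ
  rw [← hφ₀] at hJ₀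
  rcases strip_or_fan hD₂ hT₂ hp₂ hv (by rw [← hρ _ hm₀]; exact h0.1) hcont
    (hJ₀o.mem_nhds hJ₀) with ⟨s', k₁, k₂, hs', hsp', hdir⟩ | ⟨a, ha, hfan⟩
  · obtain ⟨A', B', hB', hev'⟩ := rayIntensity_strip hD₂ hv hs' hsp'
    obtain ⟨φ₁, hφ₁⟩ := exists_angleDir_eq (rayDir_spec hsp' hs'.1.1).1
    rw [← hφ₁] at hev' hdir
    have hquad : ∀ᶠ φ in 𝓝 φ₁, mink (angleDir φ) (A • n₁ + B • n₂) * mink (angleDir φ) k₁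
        + mink (angleDir φ) 0 * mink (angleDir φ) 0
        = mink (angleDir φ) (A' • k₁ + B' • k₂) * mink (angleDir φ) n₁
        + mink (angleDir φ) 0 * mink (angleDir φ) 0 := by
      have h1 := (tendsto_angleDir φ₁).eventually hev'
      have h2 := (continuous_angleDir.tendsto φ₁).eventually (hJ₀o.mem_nhds hdir)
      filter_upwards [h1, h2] with φ h3 h4
      have h5 := (hJ' ⟨hJ₀J h4, angleDir_mem φ⟩).2.2
      have h6 := h3.2.2
      rw [← hρ _ (angleDir_mem φ)] at h6
      simp only [mink_add_right, mink_smul_right]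
      rw [← h5, ← h6]
      ring
    obtain ⟨rfl, rfl⟩ := eq_of_strip_formulas hs.1.1 hs.2.1.1 hs.2.2.1 hs'.1.1 hs'.2.1.1 hs'.2.2.1
      hB hB' fun m hm => by
        simpa using eq_of_eventually_eq_arc hquad hm
    exact ⟨s', hs', hsp'⟩
  · -- On a fan the intensity has no pole at a null direction.
    exfalso
    set w := p₂ - a with hw
    have hwT : FutureTimelike w := ha
    have hquad : ∀ᶠ φ in 𝓝 φ₀,
        mink (angleDir φ) (A • n₁ + B • n₂) * mink (angleDir φ) ((2 : ℝ) • w)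
        + mink (angleDir φ) 0 * mink (angleDir φ) 0
        = mink (angleDir φ) ((-2 * mink w v) • w + mink w w • v) * mink (angleDir φ) n₁
        + mink (angleDir φ) 0 * mink (angleDir φ) 0 := by
      have h1 := (tendsto_angleDir φ₀).eventually hev
      filter_upwards [hfan, h1] with φ h2 h3
      have h4 := h3.2.2
      rw [hρ _ (angleDir_mem φ), h2.2] at h4
      obtain ⟨-, c, -, hc⟩ := exists_hit hD₂ hp₂ hv (angleDir_mem φ)
      have h5 := h2.1
      have e : hit D₂ p₂ v (angleDir φ) - a = w - c • angleDir φ := by rw [← hc, hw]; abel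
      rw [e] at h4 h5
      have hmm := (angleDir_mem φ).1.1
      generalize angleDir φ = m at *
      simp only [mink_sub_left, mink_sub_right, mink_smul_left, mink_smul_right, hmm,
        mink_comm w m] at h4 h5
      simp only [mink_add_right, mink_smul_right, mink_zero_right]
      rw [← h4]
      linear_combination (-(mink m v) * mink m n₁) * h5
    have h1 := eq_of_eventually_eq_arc hquad hs.1.1
    simp only [mink_add_right, mink_smul_right, mink_zero_right, hs.1.1.1.1] at h1
    have h2 := dirs_mink_neg hs.1.1 hs.2.1.1 hs.2.2.1
    have h3 := hwT.mink_dirs_neg hs.1.1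
    have h4 := mul_pos_of_neg_of_neg hB h2
    nlinarith [mul_neg_of_pos_of_neg h4 h3]

theorem seenLeaves_subset {D₁ D₂ : Set Mink} (hD₁ : IsDomainOfDependence D₁)
    (hD₂ : IsDomainOfDependence D₂) (hT₁ : HasSimplicialDualTree D₁)
    (hT₂ : HasSimplicialDualTree D₂) {p₁ p₂ v : Mink} (hp₂ : p₂ ∈ D₂) (hv : v ∈ hyp)
    (hρ : intensity D₁ p₁ v = intensity D₂ p₂ v) : seenLeaves D₁ p₁ ⊆ seenLeaves D₂ p₂ := by
  intro l hl
  obtain ⟨s, n₁, n₂, hs, hsp, rfl⟩ := exists_isEdgePoint_of_mem_seenLeaves hD₁ hT₁ hl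
  obtain ⟨s', hs', hsp'⟩ := exists_isEdgePoint_of_rayIntensity_eq hD₁ hD₂ hT₂ hp₂ hv
    (fun m hm => by rw [rayIntensity_eq_intensity D₁ p₁ hv hm, hρ,
      rayIntensity_eq_intensity D₂ p₂ hv hm]) hs hsp
  exact hs'.geod_mem_seenLeaves hD₂ hsp'

end Mink21

end

theorem mainTheorem12 (D₁ D₂ : Set Mink21.Mink)
    (hD₁ : Mink21.IsDomainOfDependence D₁) (hD₂ : Mink21.IsDomainOfDependence D₂)
    (hT₁ : Mink21.HasSimplicialDualTree D₁) (hT₂ : Mink21.HasSimplicialDualTree D₂)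
    (p₁ p₂ v : Mink21.Mink) (hp₁ : p₁ ∈ D₁) (hp₂ : p₂ ∈ D₂) (hv : v ∈ Mink21.hyp)
    (hρ : Mink21.intensity D₁ p₁ v = Mink21.intensity D₂ p₂ v) :
    Mink21.seenLeaves D₁ p₁ = Mink21.seenLeaves D₂ p₂ :=
  Subset.antisymm (Mink21.seenLeaves_subset hD₁ hD₂ hT₁ hT₂ hp₂ hv hρ)
    (Mink21.seenLeaves_subset hD₂ hD₁ hT₂ hT₁ hp₁ hv hρ.symm)
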